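/- Let $0\le\alpha<1$, $c>0$, $X=\mathbb R\times\mathbb R$ with Lebesgue measure, $\beta(\omega)=(1+|\omega|)^{-\alpha}$. On $L^2(\mathbb R)$ (inner product linear in the first variable) let $T_xf(t)=f(t-x)$, $M_\omega f(t)=e^{2\pi i\omega t}f(t)$, $D_af(t)=a^{-1/2}f(t/a)$, and for $\psi\in L^2(\mathbb R)$ put $\psi_{(x,\omega)}=T_xM_\omega D_{\beta(\omega)}\psi$. If the operator $A_\psi f=\int_X\langle f,\psi_z\rangle\psi_z\,dz$ (weak integral) is bounded and boundedly invertible on $L^2(\mathbb R)$, set $\mathcal R(x,y)=\langle A_\psi^{-1}\psi_x,\psi_y\rangle$ for $x,y\in X$. Put $p_\alpha(\omega)=\operatorname{sgn}(\omega)\big((1+(1-\alpha)|\omega|)^{1/(1-\alpha)}-1\big)$ and, for $\varepsilon>0$ and $j,k\in\mathbb Z$, $\omega_j=p_\alpha(\varepsilon j)$, $$U^\varepsilon_{j,k}=\varepsilon\beta(\omega_j)(k-1,k+1)\times\big(\omega_j-2\varepsilon c\,\beta(\omega_j)^{-1},\ \omega_j+2\varepsilon c\,\beta(\omega_j)^{-1}\big),\qquad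 \mathcal U^\varepsilon=\{U^\varepsilon_{j,k}\}_{j,k\in\mathbb Z}.$$ For $y\in X$ let $Q_y$ be the union of the members of $\mathcal U^\varepsilon$ containing $y$, and for measurable $\Gamma:X\times X\to\mathbb C$ with $|\Gamma|\equiv1$ let $$osc_{\mathcal U^\varepsilon,\Gamma}(x,y)=\sup_{z\in Q_y}|\mathcal R(x,y)-\Gamma(y,z)\mathcal R(x,z)|$$ (a supremum over the empty set being $0$). For $s\ge 0$ let $v_s(x,\omega)=(1+|\omega|)^s$ and $w_s(x,y)=\max\{v_s(x)/v_s(y),v_s(y)/v_s(x)\}$ for $x,y\in X$, and $$\gamma_1(\varepsilon)=\sup_{y\in X}\int_X osc_{\mathcal U^\varepsilon,\Gamma}(x,y)\,w_s(x,y)\,dx,\qquad \gamma_2(\varepsilon)=\sup_{x\in X}\int_X osc_{\mathcal U^\varepsilon,\Gamma}(x,y)\,w_s(x,y)\,dy,$$ $\gamma(\varepsilon)=\max\{\gamma_1(\varepsilon),\gamma_2(\varepsilon)\}$, $\rho=\sup_{y}\int_X|\mathcal R(x,y)|w_s(x,y)\,dx$ and $C_{w_s,\mathcal U^\varepsilon}=\sup_{j,k}\sup_{x,y\in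 U^\varepsilon_{j,k}}w_s(x,y)$. **Theorem.** There is a measurable $\Gamma:X\times X\to\mathbb C$ with $|\Gamma|\equiv1$ such that the following holds for all $s\ge0$, all real $r$ with $$r>\frac{2+2s+7\alpha-4\alpha^2}{2(1-\alpha)^2}+1$$ and all $0\neq\psi\in L^2(\mathbb R)$ such that $\hat\psi\in C^3(\mathbb R)$ and, for some constant $C$, $|\hat\psi^{(n)}(\xi)|\le C(1+|\xi|)^{-r}$ for $n=0,1,2,3$ and all $\xi\in\mathbb R$. The operator $A_\psi$ is bounded and boundedly invertible, $osc_{\mathcal U^\varepsilon,\Gamma}$ is measurable for every $\varepsilon>0$, and $\gamma(\varepsilon)\to0$ as $\varepsilon\to0^+$. Moreover, if $c>1/4$, the hypotheses of the discretization theorem for generalized coorbit spaces are met for small $\varepsilon$: $\rho<\infty$, and there are $\varepsilon_0>0$ and $K<\infty$ such that for all $0<\varepsilon<\varepsilon_0$ the family $\mathcal U^\varepsilon$ is a moderate admissible covering of $X$ (relatively compact sets with non-empty interior that cover $X$, each meeting at most $N$ of them, with measures bounded below by a positive constant and comparable, with a uniform constant, for sets that meet), $C_{w_s,\mathcal U^\varepsilon}\le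 K$, and $$\gamma(\varepsilon)\Big(\rho+\max\{\rho\,C_{w_s,\mathcal U^\varepsilon},\ \rho+\gamma(\varepsilon)\}\Big)<1 .$$ Finally, there is a compactly supported $0\ne\psi\in L^2(\mathbb R)$ that satisfies the above regularity and decay condition on $\hat\psi$ for every real $r$. -/

import Mathlib

open MeasureTheory Filter Topology Set
open scoped ENNReal FourierTransform

namespace AlphaMod

noncomputable section

/-- The Hilbert space `L²(ℝ)`. -/
abbrev L2 : Type := Lp ℂ 2 (volume : Measure ℝ)

/-! ### Translation, modulation, dilation -/

/-- `T_x f(t) = f(t - x)`. -/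
def translate (x : ℝ) (f : ℝ → ℂ) : ℝ → ℂ := fun t => f (t - x)

/-- `M_ω f(t) = e^{2πiωt} f(t)`. -/
def modulate (ω : ℝ) (f : ℝ → ℂ) : ℝ → ℂ :=
  fun t => Complex.exp (2 * Real.pi * Complex.I * ω * t) * f t

/-- `D_a f(t) = a^{-1/2} f(t / a)`, for `a > 0`. -/
def dilate (a : ℝ) (f : ℝ → ℂ) : ℝ → ℂ := fun t => ((1 / Real.sqrt a : ℝ) : ℂ) * f (t / a)

theorem memLp_translate (x : ℝ) {f : ℝ → ℂ} (hf : MemLp f 2 volume) :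
    MemLp (translate x f) 2 volume :=
  hf.comp_measurePreserving (measurePreserving_sub_right volume x)

theorem memLp_modulate (ω : ℝ) {f : ℝ → ℂ} (hf : MemLp f 2 volume) :
    MemLp (modulate ω f) 2 volume := by
  refine hf.congr_norm ?_ ?_
  · refine AEStronglyMeasurable.mul ?_ hf.1
    exact Continuous.aestronglyMeasurable (by fun_prop)
  · refine Eventually.of_forall fun t => ?_
    have h : (2 * Real.pi * Complex.I * ω * t : ℂ) = ((2 * Real.pi * ω * t : ℝ) : ℂ) * Complex.I := by
      push_cast; ring
    simp only [modulate, norm_mul, h, Complex.norm_exp_ofReal_mul_I, one_mul]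

theorem memLp_dilate {a : ℝ} (ha : 0 < a) {f : ℝ → ℂ} (hf : MemLp f 2 volume) :
    MemLp (dilate a f) 2 volume := by
  have ha' : a⁻¹ ≠ 0 := inv_ne_zero ha.ne'
  have hmap := Real.map_volume_mul_right ha'
  have h1 : MemLp f 2 (Measure.map (· * a⁻¹) volume) := by
    rw [hmap]
    exact hf.smul_measure ENNReal.ofReal_ne_top
  have h2 : MemLp (f ∘ (· * a⁻¹)) 2 volume :=
    (memLp_map_measure_iff h1.1 (by fun_prop)).1 h1
  exact h2.const_mul _

/-! ### The section and the system `π(σ(x, ω))ψ` -/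

/-- `β(ω) = (1 + |ω|)^{-α}`. -/
def beta (α ω : ℝ) : ℝ := (1 + |ω|) ^ (-α)

theorem beta_pos (α ω : ℝ) : 0 < beta α ω := Real.rpow_pos_of_pos (by positivity) _

/-- `π(σ(x, ω))ψ = T_x M_ω D_{β(ω)} ψ` as an element of `L²(ℝ)`; the homogeneous space is
`X = ℝ × ℝ` with the measure `dx dω`, and `z = (x, ω)`. -/
def atom (α : ℝ) (ψ : L2) (z : ℝ × ℝ) : L2 :=
  (memLp_translate z.1 (memLp_modulate z.2 (memLp_dilate (beta_pos α z.2) (Lp.memLp ψ)))).toLp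
    (translate z.1 (modulate z.2 (dilate (beta α z.2) ψ)))

/-- `A` is the (bounded and boundedly invertible) frame operator
`A_σ f = ∫_X ⟨f, π(σ(z))ψ⟩ π(σ(z))ψ dz`, the integral being understood weakly. Mathlib's
`inner ℂ g f` is linear in `f`, i.e. it is `⟨f, g⟩` for the inner product linear in the first
variable. The weak identity determines `A`; the existence of such an `A`, for `ψ ≠ 0`, is the
admissibility of `ψ`. -/
def IsFrameOperator (α : ℝ) (ψ : L2) (A : L2 ≃L[ℂ] L2) : Prop :=
  ∀ f h : L2,
    Integrable (fun z : ℝ × ℝ => inner ℂ (atom α ψ z) f * inner ℂ h (atom α ψ z)) ∧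
    inner ℂ h (A f) = ∫ z : ℝ × ℝ, inner ℂ (atom α ψ z) f * inner ℂ h (atom α ψ z)

/-- The reproducing kernel `R(x, y) = ⟨A⁻¹ π(σ(x))ψ, π(σ(y))ψ⟩`. -/
def kernelR (α : ℝ) (ψ : L2) (A : L2 ≃L[ℂ] L2) (x y : ℝ × ℝ) : ℂ :=
  inner ℂ (atom α ψ y) (A.symm (atom α ψ x))

/-- `ψ̂` has a `C^n` representative whose derivatives up to order `n` are bounded by
`C (1 + |ξ|)^{-r}`. -/
def HasFourierDecay (n : ℕ) (r : ℝ) (ψ : L2) : Prop :=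
  ∃ g : ℝ → ℂ, (𝓕 ψ : L2) =ᵐ[volume] g ∧ ContDiff ℝ n g ∧
    ∃ C : ℝ, ∀ l ≤ n, ∀ ξ : ℝ, ‖iteratedDeriv l g ξ‖ ≤ C * (1 + |ξ|) ^ (-r)

/-! ### Weights -/

/-- `v_s(x, ω) = (1 + |ω|)^s`. -/
def weightV (s : ℝ) (z : ℝ × ℝ) : ℝ := (1 + |z.2|) ^ s

/-- `w_s(x, y) = max {v_s(x) / v_s(y), v_s(y) / v_s(x)}`. -/
def weightW (s : ℝ) (x y : ℝ × ℝ) : ℝ :=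
  max (weightV s x / weightV s y) (weightV s y / weightV s x)

/-! ### Coverings -/

/-- Moderate admissible coverings of `X`, with respect to a measure `μ`. -/
structure IsModerateAdmissibleCovering {X ι : Type*} [TopologicalSpace X] [MeasurableSpace X]
    (μ : Measure X) (U : ι → Set X) : Prop where
  countable_index : Countable ι
  relatively_compact : ∀ i, IsCompact (closure (U i))
  interior_nonempty : ∀ i, (interior (U i)).Nonempty
  covers : ⋃ i, U i = univ
  finite_overlap : ∃ N : ℕ, ∀ j, {i | (U i ∩ U j).Nonempty}.encard ≤ N
  measure_lower : ∃ a : ℝ≥0∞, 0 < a ∧ ∀ i, a ≤ μ (U i)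
  measure_comparable : ∃ C : ℝ≥0∞, C ≠ ∞ ∧
    ∀ i j, (U i ∩ U j).Nonempty → μ (U i) ≤ C * μ (U j)

/-- `p_α(ω) = sgn(ω) ((1 + (1 - α)|ω|)^{1/(1-α)} - 1)`. -/
def pAlpha (α ω : ℝ) : ℝ := Real.sign ω * ((1 + (1 - α) * |ω|) ^ (1 / (1 - α)) - 1)

/-- `ω_j = p_α(εj)`. -/
def omegaPt (α ε : ℝ) (j : ℤ) : ℝ := pAlpha α (ε * j)

/-- `U_{j,k}^ε = εβ(ω_j)(k-1, k+1) × (ω_j - 2εcβ(ω_j)⁻¹, ω_j + 2εcβ(ω_j)⁻¹)`. -/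
def coverU (α c ε : ℝ) (i : ℤ × ℤ) : Set (ℝ × ℝ) :=
  Ioo (ε * beta α (omegaPt α ε i.1) * (i.2 - 1)) (ε * beta α (omegaPt α ε i.1) * (i.2 + 1)) ×ˢ
    Ioo (omegaPt α ε i.1 - 2 * ε * c * (beta α (omegaPt α ε i.1))⁻¹)
      (omegaPt α ε i.1 + 2 * ε * c * (beta α (omegaPt α ε i.1))⁻¹)

/-- `Q_y`, the union of all members of the family `U` that contain `y`. -/
def nbhdQ {X ι : Type*} (U : ι → Set X) (y : X) : Set X := ⋃ i ∈ {i | y ∈ U i}, U i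

/-- `C_{w,U} = sup_i sup_{x,y ∈ U_i} w(x, y)`, in `[0, ∞]`. -/
def weightConst {X ι : Type*} (w : X → X → ℝ) (U : ι → Set X) : ℝ≥0∞ :=
  ⨆ i, ⨆ x ∈ U i, ⨆ y ∈ U i, ENNReal.ofReal (w x y)

/-! ### The local oscillation kernel and its weighted integrals -/

/-- `osc_{U,Γ}(x, y) = sup_{z ∈ Q_y} |R(x, y) - Γ(y, z) R(x, z)|`, in `[0, ∞]`. -/
def osc {X ι : Type*} (R : X → X → ℂ) (U : ι → Set X) (Γ : X → X → ℂ) (x y : X) : ℝ≥0∞ :=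
  ⨆ z ∈ nbhdQ U y, ‖R x y - Γ y z * R x z‖ₑ

/-- `sup_y ∫ K(x, y) w(x, y) dx`. -/
def supIntFst {X : Type*} [MeasureSpace X] (K : X → X → ℝ≥0∞) (w : X → X → ℝ) : ℝ≥0∞ :=
  ⨆ y, ∫⁻ x, K x y * ENNReal.ofReal (w x y)

/-- `sup_x ∫ K(x, y) w(x, y) dy`. -/
def supIntSnd {X : Type*} [MeasureSpace X] (K : X → X → ℝ≥0∞) (w : X → X → ℝ) : ℝ≥0∞ :=
  ⨆ x, ∫⁻ y, K x y * ENNReal.ofReal (w x y)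

/-- `osc_{U^ε,Γ}` for the covering `U^ε`. -/
def oscEps (α c : ℝ) (ψ : L2) (A : L2 ≃L[ℂ] L2) (Γ : ℝ × ℝ → ℝ × ℝ → ℂ) (ε : ℝ) :
    ℝ × ℝ → ℝ × ℝ → ℝ≥0∞ :=
  osc (kernelR α ψ A) (coverU α c ε) Γ

/-- `γ₁(ε)`. -/
def gammaOne (α c s : ℝ) (ψ : L2) (A : L2 ≃L[ℂ] L2) (Γ : ℝ × ℝ → ℝ × ℝ → ℂ) (ε : ℝ) : ℝ≥0∞ :=
  supIntFst (oscEps α c ψ A Γ ε) (weightW s)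

/-- `γ₂(ε)`. -/
def gammaTwo (α c s : ℝ) (ψ : L2) (A : L2 ≃L[ℂ] L2) (Γ : ℝ × ℝ → ℝ × ℝ → ℂ) (ε : ℝ) : ℝ≥0∞ :=
  supIntSnd (oscEps α c ψ A Γ ε) (weightW s)

/-- `γ(ε) = max {γ₁(ε), γ₂(ε)}`. -/
def gammaMax (α c s : ℝ) (ψ : L2) (A : L2 ≃L[ℂ] L2) (Γ : ℝ × ℝ → ℝ × ℝ → ℂ) (ε : ℝ) : ℝ≥0∞ :=
  max (gammaOne α c s ψ A Γ ε) (gammaTwo α c s ψ A Γ ε)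

/-- `ρ = sup_y ∫ |R(x, y)| w_s(x, y) dx`; the supremum over all `y` dominates the essential
supremum. -/
def rho (α s : ℝ) (ψ : L2) (A : L2 ≃L[ℂ] L2) : ℝ≥0∞ :=
  supIntFst (fun x y => ‖kernelR α ψ A x y‖ₑ) (weightW s)

end

end AlphaMod

/-
On the Fourier side the frame operator is multiplication by the symbol
`m(ξ) = ∫ β(ω) |ψ̂(β(ω)(ξ - ω))|² dω`, which is bounded above and below and whose derivatives at `ξ`
live on the scale `β(ξ)`; so is `1 / m`. Hence `R(x, y)` is the Fourier transform, at time
`x₁ - y₁`, of `1 / m` times a product of two bumps localized near the frequencies of `x` and `y`.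
Two integrations by parts produce a majorant that decays quadratically in time and polynomially in
frequency, and whose weighted integrals are finite.

The phase `Γ(y, z) = e^{2πi(y₁ - z₁)y₂}` cancels the modulation that separates the atoms at `y` and
`z`. For `z ∈ Q_y` what is left is the atom at `y` of a window of size `O(ε)`, so the oscillation is
`O(ε)` times the same majorant and `γ(ε) = O(ε)`.
-/

namespace AlphaMod

noncomputable section

theorem fourierInv_toLp_ae_eq {f : ℝ → ℂ} (h1 : Integrable f) (h2 : MemLp f 2 volume) :
    (𝓕⁻ (h2.toLp f : L2) : L2) =ᵐ[volume] 𝓕⁻ f := by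
  refine ae_eq_of_integral_contDiff_smul_eq
    ((Lp.memLp _).locallyIntegrable (by norm_num)) ?_ fun g hg hgc => ?_
  · have : Continuous (𝓕⁻ f) :=
      VectorFourier.fourierIntegral_continuous Real.continuous_fourierChar
        (by simp only [LinearMap.neg_apply, innerₗ_apply_apply]; fun_prop) h1
    exact this.locallyIntegrable
  · have hg₁ : HasCompactSupport (Complex.ofRealCLM ∘ g) := hgc.comp_left rfl
    have hg₂ : ContDiff ℝ (⊤ : ℕ∞) (Complex.ofRealCLM ∘ g) := by fun_prop
    set G := hg₁.toSchwartzMap hg₂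
    have hGx : ∀ x, G x = (g x : ℂ) := fun x => rfl
    calc ∫ x, g x • (𝓕⁻ (h2.toLp f : L2) : L2) x
        = ((𝓕⁻ (h2.toLp f : L2) : L2) : TemperedDistribution ℝ ℂ) G := by
          simp [Lp.toTemperedDistribution_apply, hGx]
      _ = ∫ x, (𝓕⁻ G) x • (h2.toLp f : L2) x := by
          rw [← Lp.fourierInv_toTemperedDistribution_eq, TemperedDistribution.fourierInv_apply,
            Lp.toTemperedDistribution_apply]
      _ = ∫ x, (𝓕⁻ (G : ℝ → ℂ)) x • f x := by
          refine integral_congr_ae ?_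
          filter_upwards [h2.coeFn_toLp] with x hx
          rw [hx, SchwartzMap.fourierInv_coe]
      _ = ∫ x, G x • 𝓕⁻ f x := by
          have := VectorFourier.integral_fourierIntegral_smul_eq_flip (μ := volume) (ν := volume)
            (L := -innerₗ ℝ) (f := (G : ℝ → ℂ)) (g := f) Real.continuous_fourierChar
            (by simp only [LinearMap.neg_apply, innerₗ_apply_apply]; fun_prop) G.integrable h1
          have hflip : (-innerₗ ℝ : ℝ →ₗ[ℝ] ℝ →ₗ[ℝ] ℝ).flip = -innerₗ ℝ := by
            ext; simp
          rw [hflip] at this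
          exact this
      _ = _ := by simp [hGx]

theorem fourierInv_eq_of_ae {φ : ℝ → ℂ} {ψ : L2} (hψ : (𝓕 ψ : L2) =ᵐ[volume] φ)
    (h1 : Integrable φ) (h2 : MemLp φ 2 volume) : ψ =ᵐ[volume] 𝓕⁻ φ := by
  have h3 : ψ = 𝓕⁻ (h2.toLp φ : L2) := by
    rw [← show (𝓕 ψ : L2) = h2.toLp φ from Lp.ext (hψ.trans h2.coeFn_toLp.symm),
      FourierTransform.fourierInv_fourier_eq]
  rw [h3]
  exact fourierInv_toLp_ae_eq h1 h2

theorem fourierInv_modulate_neg (x : ℝ) (f : ℝ → ℂ) :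
    𝓕⁻ (modulate (-x) f) = translate x (𝓕⁻ f) := by
  ext t
  simp only [translate, modulate, Real.fourierInv_eq', RCLike.inner_apply, conj_trivial,
    smul_eq_mul]
  congr 1; ext ξ
  rw [← mul_assoc, ← Complex.exp_add]
  congr 2; push_cast; ring

theorem fourierInv_translate (ω : ℝ) (f : ℝ → ℂ) :
    𝓕⁻ (translate ω f) = modulate ω (𝓕⁻ f) := by
  ext t
  simp only [translate, modulate, Real.fourierInv_eq', RCLike.inner_apply, conj_trivial,
    smul_eq_mul]
  rw [← integral_add_right_eq_self _ ω, ← integral_const_mul]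
  congr 1; ext ξ
  rw [add_sub_cancel_right, ← mul_assoc (Complex.exp (2 * Real.pi * Complex.I * ω * t)),
    ← Complex.exp_add]
  congr 2; push_cast; ring

theorem dilate_inv_apply (b : ℝ) (f : ℝ → ℂ) (ξ : ℝ) :
    dilate b⁻¹ f ξ = (Real.sqrt b : ℂ) * f (b * ξ) := by
  rw [dilate, Real.sqrt_inv, one_div, inv_inv, div_inv_eq_mul, mul_comm ξ]

theorem translate_dilate_inv_eq (b ω : ℝ) (f : ℝ → ℂ) :
    translate ω (dilate b⁻¹ f) = fun ξ => (Real.sqrt b : ℂ) * f (b * (ξ - ω)) :=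
  funext fun _ => dilate_inv_apply _ _ _

theorem fourierInv_dilate_inv {b : ℝ} (hb : 0 < b) (f : ℝ → ℂ) :
    𝓕⁻ (dilate b⁻¹ f) = dilate b (𝓕⁻ f) := by
  ext t
  have hs : (((b⁻¹ : ℝ) : ℂ) * (Real.sqrt b : ℂ)) = ((1 / Real.sqrt b : ℝ) : ℂ) := by
    rw [← Complex.ofReal_mul, inv_mul_eq_div, Real.sqrt_div_self']
  set g : ℝ → ℂ := fun η =>
    Complex.exp (((2 * Real.pi * (η * (t / b)) : ℝ) : ℂ) * Complex.I) * ((Real.sqrt b : ℂ) * f η)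
  calc 𝓕⁻ (dilate b⁻¹ f) t
      = ∫ ξ, g (b * ξ) := by
        simp only [Real.fourierInv_eq', RCLike.inner_apply, conj_trivial, smul_eq_mul,
          dilate_inv_apply]
        congr 1; ext ξ
        simp only [g]
        rw [show b * ξ * (t / b) = t * ξ by field_simp]
    _ = dilate b (𝓕⁻ f) t := by
        rw [Measure.integral_comp_mul_left g b, abs_of_pos (inv_pos.2 hb), dilate, ← hs,
          Real.fourierInv_eq', Complex.real_smul, mul_assoc,
          ← integral_const_mul (Real.sqrt b : ℂ)]
        simp only [g, RCLike.inner_apply, conj_trivial, smul_eq_mul, mul_comm _ (t / b),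
          mul_left_comm (Real.sqrt b : ℂ)]

theorem norm_modulate (ω : ℝ) (f : ℝ → ℂ) (t : ℝ) : ‖modulate ω f t‖ = ‖f t‖ := by
  have h : (2 * Real.pi * Complex.I * ω * t : ℂ) = ((2 * Real.pi * ω * t : ℝ) : ℂ) * Complex.I := by
    push_cast; ring
  rw [modulate, norm_mul, h, Complex.norm_exp_ofReal_mul_I, one_mul]

/-- The Fourier transform, as a function, of the atom at `(0, ω)` when `φ` is that of the window:
`φ` moved to the frequency `ω` and stretched to the scale `β(ω)⁻¹`. -/
def windowHat (α : ℝ) (φ : ℝ → ℂ) (ω : ℝ) : ℝ → ℂ := translate ω (dilate (beta α ω)⁻¹ φ)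

/-- The Fourier transform of the atom at `z`, as a function, when `φ` is that of the window. -/
def atomHat (α : ℝ) (φ : ℝ → ℂ) (z : ℝ × ℝ) : ℝ → ℂ := modulate (-z.1) (windowHat α φ z.2)

theorem windowHat_apply (α : ℝ) (φ : ℝ → ℂ) (ω ξ : ℝ) :
    windowHat α φ ω ξ = (Real.sqrt (beta α ω) : ℂ) * φ (beta α ω * (ξ - ω)) :=
  dilate_inv_apply _ _ _

theorem norm_windowHat (α : ℝ) (φ : ℝ → ℂ) (ω ξ : ℝ) :
    ‖windowHat α φ ω ξ‖ = Real.sqrt (beta α ω) * ‖φ (beta α ω * (ξ - ω))‖ := by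
  rw [windowHat_apply, norm_mul, Complex.norm_real, Real.norm_of_nonneg (Real.sqrt_nonneg _)]

theorem norm_atomHat (α : ℝ) (φ : ℝ → ℂ) (z : ℝ × ℝ) (ξ : ℝ) :
    ‖atomHat α φ z ξ‖ = ‖windowHat α φ z.2 ξ‖ := norm_modulate _ _ _

theorem memLp_windowHat (α : ℝ) {φ : ℝ → ℂ} (hφ : MemLp φ 2 volume) (ω : ℝ) :
    MemLp (windowHat α φ ω) 2 volume :=
  memLp_translate _ (memLp_dilate (inv_pos.2 (beta_pos α ω)) hφ)

theorem memLp_atomHat (α : ℝ) {φ : ℝ → ℂ} (hφ : MemLp φ 2 volume) (z : ℝ × ℝ) :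
    MemLp (atomHat α φ z) 2 volume :=
  memLp_modulate _ (memLp_windowHat α hφ z.2)

theorem integrable_windowHat (α : ℝ) {φ : ℝ → ℂ} (hφ : Integrable φ) (ω : ℝ) :
    Integrable (windowHat α φ ω) := by
  refine (((hφ.comp_mul_left' (beta_pos α ω).ne').comp_sub_right ω).const_mul
    (Real.sqrt (beta α ω) : ℂ)).congr (Eventually.of_forall fun ξ => ?_)
  exact (windowHat_apply α φ ω ξ).symm

theorem integrable_atomHat (α : ℝ) {φ : ℝ → ℂ} (hφ : Integrable φ) (z : ℝ × ℝ) :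
    Integrable (atomHat α φ z) :=
  (integrable_windowHat α hφ z.2).bdd_mul (c := 1) (by fun_prop) <| Eventually.of_forall fun ξ => by
    simpa [modulate] using (norm_modulate (-z.1) 1 ξ).le

theorem fourierInv_atomHat (α : ℝ) (φ : ℝ → ℂ) (z : ℝ × ℝ) :
    𝓕⁻ (atomHat α φ z) = translate z.1 (modulate z.2 (dilate (beta α z.2) (𝓕⁻ φ))) := by
  rw [atomHat, windowHat, fourierInv_modulate_neg, fourierInv_translate,
    fourierInv_dilate_inv (beta_pos α z.2)]

theorem quasiMeasurePreserving_sub_div (x : ℝ) {b : ℝ} (hb : b ≠ 0) :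
    Measure.QuasiMeasurePreserving (fun t : ℝ => (t - x) / b) := by
  refine Measure.QuasiMeasurePreserving.comp (g := fun t : ℝ => t / b) ⟨by fun_prop, ?_⟩
    (measurePreserving_sub_right volume x).quasiMeasurePreserving
  simp only [div_eq_mul_inv]
  rw [Real.map_volume_mul_right (inv_ne_zero hb)]
  exact Measure.smul_absolutelyContinuous

theorem fourier_atom (α : ℝ) {φ : ℝ → ℂ} {ψ : L2} (hψ : (𝓕 ψ : L2) =ᵐ[volume] φ)
    (h1 : Integrable φ) (h2 : MemLp φ 2 volume) (z : ℝ × ℝ) :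
    (𝓕 (atom α ψ z) : L2) =ᵐ[volume] atomHat α φ z := by
  suffices atom α ψ z = 𝓕⁻ ((memLp_atomHat α h2 z).toLp (atomHat α φ z) : L2) by
    rw [this, FourierTransform.fourier_fourierInv_eq]
    exact MemLp.coeFn_toLp _
  refine Lp.ext ((MemLp.coeFn_toLp _).trans (EventuallyEq.trans ?_
    (fourierInv_toLp_ae_eq (integrable_atomHat α h1 z) (memLp_atomHat α h2 z)).symm))
  have hq := quasiMeasurePreserving_sub_div z.1 (beta_pos α z.2).ne'
  filter_upwards [hq.ae_eq (fourierInv_eq_of_ae hψ h1 h2)] with t ht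
  rw [fourierInv_atomHat]
  simp only [translate, modulate, dilate]
  rw [show ψ ((t - z.1) / beta α z.2) = 𝓕⁻ φ ((t - z.1) / beta α z.2) from ht]

theorem continuous_beta (α : ℝ) : Continuous (beta α) := by
  unfold beta
  exact Continuous.rpow_const (by fun_prop) fun x => Or.inl (by positivity)

@[fun_prop]
theorem measurable_beta (α : ℝ) : Measurable (beta α) := (continuous_beta α).measurable

theorem beta_le_one {α : ℝ} (hα0 : 0 ≤ α) (ω : ℝ) : beta α ω ≤ 1 :=
  Real.rpow_le_one_of_one_le_of_nonpos (by linarith [abs_nonneg ω]) (by linarith)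

theorem beta_inv (α ω : ℝ) : (beta α ω)⁻¹ = (1 + |ω|) ^ α := by
  rw [beta, Real.rpow_neg (by positivity), inv_inv]

/-- The distance of `ξ` from `ω` on the scale of the covering at `ω`, plus one. -/
def scaledDist (α ω ξ : ℝ) : ℝ := 1 + beta α ω * |ξ - ω|

theorem one_le_scaledDist (α ω ξ : ℝ) : 1 ≤ scaledDist α ω ξ := by
  have := beta_pos α ω
  unfold scaledDist
  have : 0 ≤ beta α ω * |ξ - ω| := by positivity
  linarith

theorem scaledDist_pos (α ω ξ : ℝ) : 0 < scaledDist α ω ξ :=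
  one_pos.trans_le (one_le_scaledDist α ω ξ)

theorem continuous_scaledDist (α : ℝ) : Continuous fun p : ℝ × ℝ => scaledDist α p.1 p.2 := by
  have := continuous_beta α
  unfold scaledDist; fun_prop

theorem scaledDist_eq_abs (α ω ξ : ℝ) : scaledDist α ω ξ = 1 + |beta α ω * (ξ - ω)| := by
  rw [abs_mul, abs_of_pos (beta_pos α ω), scaledDist]

section ScaledDist

variable {α : ℝ}

theorem abs_sub_eq_scaledDist_mul (ω ξ : ℝ) :
    |ξ - ω| = (scaledDist α ω ξ - 1) * (1 + |ω|) ^ α := by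
  rw [← beta_inv, scaledDist]
  field_simp [(beta_pos α ω).ne']
  ring

theorem one_add_abs_rpow_le (hα1 : α < 1) (ω : ℝ) : (1 + |ω|) ^ α ≤ 1 + |ω| := by
  conv_rhs => rw [← Real.rpow_one (1 + |ω|)]
  exact Real.rpow_le_rpow_of_exponent_le (by linarith [abs_nonneg ω]) hα1.le

theorem one_add_abs_le_mul_scaledDist (hα1 : α < 1) (ω ξ : ℝ) :
    1 + |ξ| ≤ (1 + |ω|) * scaledDist α ω ξ := by
  have h1 : |ξ| ≤ |ω| + |ξ - ω| := by
    have := abs_add_le ω (ξ - ω); simpa using this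
  have h2 := abs_sub_eq_scaledDist_mul (α := α) ω ξ
  have h3 : (scaledDist α ω ξ - 1) * (1 + |ω|) ^ α ≤ (scaledDist α ω ξ - 1) * (1 + |ω|) :=
    mul_le_mul_of_nonneg_left (one_add_abs_rpow_le hα1 ω)
      (by linarith [one_le_scaledDist α ω ξ])
  nlinarith

theorem one_add_abs_le_mul_scaledDist_rpow (hα0 : 0 ≤ α) (hα1 : α < 1) (ω ξ : ℝ) :
    1 + |ω| ≤ (1 + |ξ|) * scaledDist α ω ξ ^ (1 / (1 - α)) := by
  have hU := one_le_scaledDist α ω ξ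
  have h1α : 0 < 1 - α := by linarith
  have hX : 0 < 1 + |ξ| := by positivity
  have hW : 0 < 1 + |ω| := by positivity
  rcases le_total (1 + |ω|) (1 + |ξ|) with h | h
  · have : 1 ≤ scaledDist α ω ξ ^ (1 / (1 - α)) := Real.one_le_rpow hU (by positivity)
    nlinarith
  · have h1 : |ω| ≤ |ξ| + |ξ - ω| := by
      have := abs_add_le ξ (ω - ξ); rw [abs_sub_comm]; simpa using this
    rw [abs_sub_eq_scaledDist_mul (α := α) ω ξ] at h1
    have hWα : 0 < (1 + |ω|) ^ α := by positivity
    have e1 : (1 + |ω|) ^ α * (1 + |ω|) ^ (1 - α) = 1 + |ω| := by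
      rw [← Real.rpow_add hW]; simp
    have e2 : (1 + |ξ|) ^ α * (1 + |ξ|) ^ (1 - α) = 1 + |ξ| := by
      rw [← Real.rpow_add hX]; simp
    have h2 : 1 + |ξ| ≤ (1 + |ω|) ^ α * (1 + |ξ|) ^ (1 - α) := by
      refine e2.symm.le.trans ?_
      exact mul_le_mul_of_nonneg_right (Real.rpow_le_rpow hX.le h hα0) (by positivity)
    have hX1 : 1 ≤ (1 + |ξ|) ^ (1 - α) := Real.one_le_rpow (by linarith [abs_nonneg ξ]) h1α.le
    have h3 : (1 + |ω|) ^ (1 - α) ≤ (1 + |ξ|) ^ (1 - α) * scaledDist α ω ξ := by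
      have : (1 + |ω|) ^ α * (1 + |ω|) ^ (1 - α) ≤
          (1 + |ω|) ^ α * ((1 + |ξ|) ^ (1 - α) + (scaledDist α ω ξ - 1)) := by
        rw [e1]; linarith
      have := le_of_mul_le_mul_left this hWα
      nlinarith
    have h4 := Real.rpow_le_rpow (by positivity) h3 (z := 1 / (1 - α)) (by positivity)
    rw [Real.mul_rpow (by positivity) (by positivity), ← Real.rpow_mul hW.le,
      ← Real.rpow_mul hX.le, mul_one_div_cancel h1α.ne', Real.rpow_one, Real.rpow_one] at h4
    exact h4

theorem beta_le_mul_scaledDist (hα0 : 0 ≤ α) (hα1 : α < 1) (ω ξ : ℝ) :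
    beta α ω ≤ beta α ξ * scaledDist α ω ξ ^ α := by
  have hU := scaledDist_pos α ω ξ
  have h := Real.rpow_le_rpow (by positivity) (one_add_abs_le_mul_scaledDist hα1 ω ξ) hα0
  rw [Real.mul_rpow (by positivity) hU.le, ← beta_inv, ← beta_inv] at h
  have hb := beta_pos α ω
  have hx := beta_pos α ξ
  calc beta α ω = beta α ω * beta α ξ * (beta α ξ)⁻¹ := by field_simp
    _ ≤ beta α ω * beta α ξ * ((beta α ω)⁻¹ * scaledDist α ω ξ ^ α) := by gcongr
    _ = _ := by field_simp

theorem beta_le_mul_scaledDist_rpow (hα0 : 0 ≤ α) (hα1 : α < 1) (ω ξ : ℝ) :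
    beta α ξ ≤ beta α ω * scaledDist α ω ξ ^ (α / (1 - α)) := by
  have hU := scaledDist_pos α ω ξ
  have h := Real.rpow_le_rpow (by positivity) (one_add_abs_le_mul_scaledDist_rpow hα0 hα1 ω ξ) hα0
  rw [Real.mul_rpow (by positivity) (by positivity), ← beta_inv, ← beta_inv,
    ← Real.rpow_mul hU.le, one_div_mul_eq_div] at h
  have hb := beta_pos α ω
  have hx := beta_pos α ξ
  calc beta α ξ = beta α ξ * beta α ω * (beta α ω)⁻¹ := by field_simp
    _ ≤ beta α ξ * beta α ω * ((beta α ξ)⁻¹ * scaledDist α ω ξ ^ (α / (1 - α))) := by gcongr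
    _ = _ := by field_simp

theorem scaledDist_swap_rpow_le (hα0 : 0 ≤ α) (hα1 : α < 1) (ω ξ : ℝ) :
    (1 + beta α ξ * |ξ - ω|) ^ (1 - α) ≤ scaledDist α ω ξ := by
  have hU := scaledDist_pos α ω ξ
  have hU1 := one_le_scaledDist α ω ξ
  have h1α : 0 < 1 - α := by linarith
  have hx := beta_pos α ξ
  have h1 : 1 + beta α ξ * |ξ - ω| ≤ scaledDist α ω ξ ^ (1 / (1 - α)) := by
    have h2 : beta α ξ * |ξ - ω| ≤ beta α ω * scaledDist α ω ξ ^ (α / (1 - α)) * |ξ - ω| :=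
      mul_le_mul_of_nonneg_right (beta_le_mul_scaledDist_rpow hα0 hα1 ω ξ) (abs_nonneg _)
    have h3 : 1 ≤ scaledDist α ω ξ ^ (α / (1 - α)) := Real.one_le_rpow hU1 (by positivity)
    have h4 : scaledDist α ω ξ ^ (1 / (1 - α)) =
        scaledDist α ω ξ ^ (α / (1 - α)) * scaledDist α ω ξ := by
      conv_rhs => rw [← Real.rpow_one (scaledDist α ω ξ), ← Real.rpow_mul hU.le,
        ← Real.rpow_add hU]
      congr 1; field_simp; ring
    have h5 : beta α ω * |ξ - ω| = scaledDist α ω ξ - 1 := by rw [scaledDist]; ring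
    rw [h4]
    nlinarith
  have h2 := Real.rpow_le_rpow (by positivity) h1 h1α.le
  rwa [← Real.rpow_mul hU.le, one_div_mul_cancel h1α.ne', Real.rpow_one] at h2

theorem weightV_div_le (hα0 : 0 ≤ α) (hα1 : α < 1) {s : ℝ} (hs : 0 ≤ s) (x y : ℝ × ℝ) (ξ : ℝ) :
    weightV s x / weightV s y ≤
      (scaledDist α x.2 ξ * scaledDist α y.2 ξ) ^ (s / (1 - α)) := by
  have hU := scaledDist_pos α x.2 ξ
  have hV := scaledDist_pos α y.2 ξ
  have hV1 := one_le_scaledDist α y.2 ξ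
  have h1α : 0 < 1 - α := by linarith
  have hy : 0 < 1 + |y.2| := by positivity
  unfold weightV
  rw [← Real.div_rpow (by positivity) (by positivity), show s / (1 - α) = 1 / (1 - α) * s by ring,
    Real.rpow_mul (by positivity)]
  refine Real.rpow_le_rpow (by positivity) ?_ hs
  rw [div_le_iff₀ hy, Real.mul_rpow hU.le hV.le]
  have h1 := one_add_abs_le_mul_scaledDist_rpow hα0 hα1 x.2 ξ
  have h2 := one_add_abs_le_mul_scaledDist hα1 y.2 ξ
  have h3 : scaledDist α y.2 ξ ≤ scaledDist α y.2 ξ ^ (1 / (1 - α)) := by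
    conv_lhs => rw [← Real.rpow_one (scaledDist α y.2 ξ)]
    exact Real.rpow_le_rpow_of_exponent_le hV1 (by rw [le_div_iff₀ h1α]; linarith)
  calc 1 + |x.2| ≤ (1 + |ξ|) * scaledDist α x.2 ξ ^ (1 / (1 - α)) := h1
    _ ≤ ((1 + |y.2|) * scaledDist α y.2 ξ ^ (1 / (1 - α))) *
        scaledDist α x.2 ξ ^ (1 / (1 - α)) := by
      gcongr; exact h2.trans (by gcongr)
    _ = _ := by ring

theorem weightW_le (hα0 : 0 ≤ α) (hα1 : α < 1) {s : ℝ} (hs : 0 ≤ s) (x y : ℝ × ℝ) (ξ : ℝ) :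
    weightW s x y ≤ (scaledDist α x.2 ξ * scaledDist α y.2 ξ) ^ (s / (1 - α)) :=
  max_le (weightV_div_le hα0 hα1 hs x y ξ)
    (mul_comm (scaledDist α y.2 ξ) (scaledDist α x.2 ξ) ▸ weightV_div_le hα0 hα1 hs y x ξ)

end ScaledDist

theorem weightW_comm (s : ℝ) (x y : ℝ × ℝ) : weightW s x y = weightW s y x := max_comm _ _

theorem weightW_nonneg (s : ℝ) (x y : ℝ × ℝ) : 0 ≤ weightW s x y :=
  le_max_of_le_left (by unfold weightV; positivity)

/-- `∫ (1 + |t|)^{-q} dt`. -/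
def bracketInt (q : ℝ) : ℝ≥0∞ := ∫⁻ t : ℝ, ENNReal.ofReal ((1 + |t|) ^ (-q))

theorem integrable_bracket {q : ℝ} (hq : 1 < q) : Integrable fun t : ℝ => (1 + |t|) ^ (-q) := by
  simpa using integrable_one_add_norm (E := ℝ) (μ := volume) (r := q) (by simpa using hq)

theorem bracketInt_lt_top {q : ℝ} (hq : 1 < q) : bracketInt q < ∞ := by
  have := (integrable_bracket hq).hasFiniteIntegral
  rwa [hasFiniteIntegral_iff_ofReal (Eventually.of_forall fun t => by positivity)] at this

theorem lintegral_scale {f : ℝ → ℝ≥0∞} (hf : Measurable f) {b : ℝ} (hb : 0 < b) (x₀ : ℝ) :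
    ∫⁻ x, f (b * (x - x₀)) = ENNReal.ofReal b⁻¹ * ∫⁻ x, f x := by
  have h1 : ∫⁻ x, f (b * (x - x₀)) = ∫⁻ x, f (b * x) :=
    lintegral_sub_right_eq_self (fun x => f (b * x)) x₀
  have h2 : ∫⁻ x, f (b * x) = ∫⁻ x, f x ∂(Measure.map (b * ·) volume) :=
    (lintegral_map hf (by fun_prop)).symm
  rw [h1, h2, Real.map_volume_mul_left hb.ne', lintegral_smul_measure,
    abs_of_pos (inv_pos.2 hb), smul_eq_mul]

theorem lintegral_scaledDist_right (α q η : ℝ) :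
    ∫⁻ ξ, ENNReal.ofReal (scaledDist α η ξ ^ (-q)) =
      ENNReal.ofReal (beta α η)⁻¹ * bracketInt q := by
  rw [bracketInt, ← lintegral_scale (by fun_prop) (beta_pos α η) η]
  simp only [scaledDist_eq_abs]

theorem lintegral_scaledDist_left {α : ℝ} (hα0 : 0 ≤ α) (hα1 : α < 1) {q : ℝ} (hq : 0 ≤ q)
    (ξ : ℝ) :
    ∫⁻ ω, ENNReal.ofReal (beta α ξ * scaledDist α ω ξ ^ (-q)) ≤ bracketInt ((1 - α) * q) := by
  have hx := beta_pos α ξ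
  calc ∫⁻ ω, ENNReal.ofReal (beta α ξ * scaledDist α ω ξ ^ (-q))
      ≤ ∫⁻ ω, ENNReal.ofReal (beta α ξ) *
          ENNReal.ofReal ((1 + |beta α ξ * (ω - ξ)|) ^ (-((1 - α) * q))) := by
        refine lintegral_mono fun ω => ?_
        rw [← ENNReal.ofReal_mul hx.le]
        refine ENNReal.ofReal_le_ofReal (mul_le_mul_of_nonneg_left ?_ hx.le)
        rw [abs_mul, abs_of_pos hx, abs_sub_comm, ← mul_neg, Real.rpow_mul (by positivity)]
        exact Real.rpow_le_rpow_of_nonpos (by positivity)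
          (scaledDist_swap_rpow_le hα0 hα1 ω ξ) (by linarith)
    _ = ENNReal.ofReal (beta α ξ) * (ENNReal.ofReal (beta α ξ)⁻¹ * bracketInt ((1 - α) * q)) := by
        rw [lintegral_const_mul _ (by fun_prop), bracketInt, ← lintegral_scale (by fun_prop) hx ξ]
    _ = bracketInt ((1 - α) * q) := by
        rw [← mul_assoc, ← ENNReal.ofReal_mul hx.le, mul_inv_cancel₀ hx.ne', ENNReal.ofReal_one,
          one_mul]

/-- The frequency part of `majorant`. The square comes from the two derivatives that produce the
decay in time. -/
def freqMajorant (α p l ω η ξ : ℝ) : ℝ :=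
  Real.sqrt (beta α ω) * Real.sqrt (beta α η) *
    (1 + (beta α ω + beta α η + beta α ξ) / l) ^ 2 *
    (scaledDist α ω ξ ^ (-p) * scaledDist α η ξ ^ (-p))

/-- A majorant of kernels of the form `⟨M atom x, atom y⟩`, where `M` is a Fourier multiplier that
is smooth on the scale `β`; `l` is the scale of the decay in time. -/
def majorant (α p l : ℝ) (x y : ℝ × ℝ) : ℝ≥0∞ :=
  (∫⁻ ξ, ENNReal.ofReal (freqMajorant α p l x.2 y.2 ξ)) *
    ENNReal.ofReal (1 / (1 + ((x.1 - y.1) / l) ^ 2))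

/-- Domination by `L` times the majorant, for all scales `l` of the decay in time at once. -/
def IsMajorized (α p L : ℝ) (k : ℝ × ℝ → ℝ × ℝ → ℝ≥0∞) : Prop :=
  ∀ x y l, 0 < l → k x y ≤ ENNReal.ofReal L * majorant α p l x y

theorem freqMajorant_nonneg (α p l ω η ξ : ℝ) : 0 ≤ freqMajorant α p l ω η ξ := by
  have := scaledDist_pos α ω ξ
  have := scaledDist_pos α η ξ
  unfold freqMajorant; positivity

theorem freqMajorant_comm (α p l ω η ξ : ℝ) :
    freqMajorant α p l ω η ξ = freqMajorant α p l η ω ξ := by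
  unfold freqMajorant
  rw [add_comm (beta α ω)]
  ring

theorem majorant_comm (α p l : ℝ) (x y : ℝ × ℝ) : majorant α p l x y = majorant α p l y x := by
  unfold majorant
  simp only [freqMajorant_comm α p l x.2 y.2]
  rw [← neg_sub y.1 x.1, neg_div, neg_sq]

theorem sqrt_beta_le_mul_scaledDist {α : ℝ} (hα0 : 0 ≤ α) (hα1 : α < 1) (ω ξ : ℝ) :
    Real.sqrt (beta α ω) ≤ Real.sqrt (beta α ξ) * scaledDist α ω ξ ^ (α / 2) := by
  refine (Real.sqrt_le_sqrt (beta_le_mul_scaledDist hα0 hα1 ω ξ)).trans_eq ?_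
  rw [Real.sqrt_mul (beta_pos α ξ).le, Real.sqrt_eq_rpow (scaledDist α ω ξ ^ α),
    ← Real.rpow_mul (scaledDist_pos α ω ξ).le, mul_one_div]

theorem one_add_sum_beta_div_le {α : ℝ} (hα0 : 0 ≤ α) (hα1 : α < 1) (ω η ξ : ℝ) :
    1 + (beta α ω + beta α η + beta α ξ) / beta α η ≤
      4 * (scaledDist α ω ξ ^ α * scaledDist α η ξ ^ (α / (1 - α))) := by
  have hη := beta_pos α η
  have hU : 1 ≤ scaledDist α ω ξ ^ α := Real.one_le_rpow (one_le_scaledDist α ω ξ) hα0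
  have hV : 1 ≤ scaledDist α η ξ ^ (α / (1 - α)) :=
    Real.one_le_rpow (one_le_scaledDist α η ξ) (div_nonneg hα0 (by linarith))
  have hξη : beta α ξ / beta α η ≤ scaledDist α η ξ ^ (α / (1 - α)) := by
    rw [div_le_iff₀ hη, mul_comm]
    exact beta_le_mul_scaledDist_rpow hα0 hα1 η ξ
  have hωξ : beta α ω / beta α ξ ≤ scaledDist α ω ξ ^ α := by
    rw [div_le_iff₀ (beta_pos α ξ), mul_comm]
    exact beta_le_mul_scaledDist hα0 hα1 ω ξ
  have hωη : beta α ω / beta α η ≤ scaledDist α ω ξ ^ α * scaledDist α η ξ ^ (α / (1 - α)) := by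
    rw [← div_mul_div_cancel₀ (beta_pos α ξ).ne']
    exact mul_le_mul hωξ hξη (div_pos (beta_pos α ξ) hη).le (zero_le_one.trans hU)
  rw [add_div, add_div, div_self hη.ne']
  nlinarith [one_le_mul_of_one_le_of_one_le hU hV]

theorem weightW_mul_freqMajorant_le {α : ℝ} (hα0 : 0 ≤ α) (hα1 : α < 1) {s : ℝ} (hs : 0 ≤ s)
    (p : ℝ) (x y : ℝ × ℝ) (ξ : ℝ) :
    freqMajorant α p (beta α y.2) x.2 y.2 ξ * weightW s x y ≤
      16 * (scaledDist α y.2 ξ ^ (-(p - s / (1 - α) - 2 * (α / (1 - α)) - α / 2)) *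
        (beta α ξ * scaledDist α x.2 ξ ^ (-(p - s / (1 - α) - 2 * α - α / 2)))) := by
  have hx := beta_pos α x.2
  have hy := beta_pos α y.2
  have hξ := beta_pos α ξ
  have hU := scaledDist_pos α x.2 ξ
  have hV := scaledDist_pos α y.2 ξ
  have hsqx := sqrt_beta_le_mul_scaledDist hα0 hα1 x.2 ξ
  have hsqy := sqrt_beta_le_mul_scaledDist hα0 hα1 y.2 ξ
  have hsum := one_add_sum_beta_div_le hα0 hα1 x.2 y.2 ξ
  have hweight := weightW_le hα0 hα1 hs x y ξ
  have hweight0 := weightW_nonneg s x y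
  unfold freqMajorant
  set U := scaledDist α x.2 ξ
  set V := scaledDist α y.2 ξ
  calc Real.sqrt (beta α x.2) * Real.sqrt (beta α y.2) *
        (1 + (beta α x.2 + beta α y.2 + beta α ξ) / beta α y.2) ^ 2 * (U ^ (-p) * V ^ (-p)) *
        weightW s x y
      ≤ (Real.sqrt (beta α ξ) * U ^ (α / 2)) * (Real.sqrt (beta α ξ) * V ^ (α / 2)) *
        (4 * (U ^ α * V ^ (α / (1 - α)))) ^ 2 * (U ^ (-p) * V ^ (-p)) *
        (U * V) ^ (s / (1 - α)) := by gcongr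
    _ = 16 * ((V ^ (-p) * V ^ (s / (1 - α)) * (V ^ (α / (1 - α)) * V ^ (α / (1 - α))) *
          V ^ (α / 2)) * ((Real.sqrt (beta α ξ) * Real.sqrt (beta α ξ)) *
          (U ^ (-p) * U ^ (s / (1 - α)) * (U ^ α * U ^ α) * U ^ (α / 2)))) := by
        rw [Real.mul_rpow hU.le hV.le]; ring
    _ = _ := by
        rw [Real.mul_self_sqrt hξ.le]
        simp only [← Real.rpow_add hU, ← Real.rpow_add hV]
        congr 3
        · ring_nf
        · congr 2; ring_nf

/-- The frequency part of the majorant, up to constants, after the weight has been absorbed into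
the decay. -/
def crossInt (α q q' ω η : ℝ) : ℝ≥0∞ :=
  ∫⁻ ξ, ENNReal.ofReal (scaledDist α η ξ ^ (-q')) *
    ENNReal.ofReal (beta α ξ * scaledDist α ω ξ ^ (-q))

theorem measurable_crossInt_integrand (α q q' η : ℝ) :
    Measurable fun z : ℝ × ℝ => ENNReal.ofReal (scaledDist α η z.2 ^ (-q')) *
      ENNReal.ofReal (beta α z.2 * scaledDist α z.1 z.2 ^ (-q)) := by
  have h1 : Measurable fun z : ℝ × ℝ => scaledDist α η z.2 :=
    ((continuous_scaledDist α).comp (by fun_prop : Continuous fun z : ℝ × ℝ => (η, z.2))).measurable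
  have h2 := (continuous_scaledDist α).measurable
  fun_prop

theorem measurable_crossInt (α q q' η : ℝ) : Measurable fun ω => crossInt α q q' ω η :=
  (measurable_crossInt_integrand α q q' η).lintegral_prod_right'

theorem lintegral_crossInt_le {α : ℝ} (hα0 : 0 ≤ α) (hα1 : α < 1) {q : ℝ} (hq : 1 < (1 - α) * q)
    (q' η : ℝ) :
    ∫⁻ ω, crossInt α q q' ω η ≤
      ENNReal.ofReal (beta α η)⁻¹ * (bracketInt q' * bracketInt ((1 - α) * q)) := by
  have hq0 : 0 ≤ q := (pos_of_mul_pos_right (one_pos.trans hq) (by linarith)).le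
  unfold crossInt
  rw [lintegral_lintegral_swap (measurable_crossInt_integrand α q q' η).aemeasurable]
  calc _ = ∫⁻ ξ, ENNReal.ofReal (scaledDist α η ξ ^ (-q')) *
        ∫⁻ ω, ENNReal.ofReal (beta α ξ * scaledDist α ω ξ ^ (-q)) := by
        refine lintegral_congr fun ξ => ?_
        rw [lintegral_const_mul' _ _ ENNReal.ofReal_ne_top]
    _ ≤ ∫⁻ ξ, ENNReal.ofReal (scaledDist α η ξ ^ (-q')) * bracketInt ((1 - α) * q) := by
        gcongr with ξ
        exact lintegral_scaledDist_left hα0 hα1 hq0 ξ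
    _ = _ := by
        rw [lintegral_mul_const' _ _ (bracketInt_lt_top hq).ne, lintegral_scaledDist_right,
          mul_assoc]

theorem majorant_mul_weightW_le {α : ℝ} (hα0 : 0 ≤ α) (hα1 : α < 1) {s : ℝ} (hs : 0 ≤ s)
    (p : ℝ) (x y : ℝ × ℝ) :
    majorant α p (beta α y.2) x y * ENNReal.ofReal (weightW s x y) ≤
      ENNReal.ofReal (1 / (1 + ((x.1 - y.1) / beta α y.2) ^ 2)) *
        (16 * crossInt α (p - s / (1 - α) - 2 * α - α / 2)
          (p - s / (1 - α) - 2 * (α / (1 - α)) - α / 2) x.2 y.2) := by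
  rw [majorant, mul_comm (∫⁻ _, _), mul_assoc]
  refine mul_le_mul_right ?_ _
  rw [crossInt, show (16 : ℝ≥0∞) = ENNReal.ofReal 16 by norm_num,
    ← lintegral_const_mul' _ _ ENNReal.ofReal_ne_top,
    ← lintegral_mul_const' _ _ ENNReal.ofReal_ne_top]
  refine lintegral_mono fun ξ => ?_
  have hV := scaledDist_pos α y.2 ξ
  rw [← ENNReal.ofReal_mul (freqMajorant_nonneg _ _ _ _ _ _), ← ENNReal.ofReal_mul
    (by positivity), ← ENNReal.ofReal_mul (by norm_num)]
  exact ENNReal.ofReal_le_ofReal (weightW_mul_freqMajorant_le hα0 hα1 hs p x y ξ)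

theorem lintegral_one_div_one_add_sq_scale {b : ℝ} (hb : 0 < b) (x₀ : ℝ) :
    ∫⁻ t, ENNReal.ofReal (1 / (1 + ((t - x₀) / b) ^ 2)) =
      ENNReal.ofReal b * ∫⁻ t : ℝ, ENNReal.ofReal (1 / (1 + t ^ 2)) := by
  have := lintegral_scale (f := fun t => ENNReal.ofReal (1 / (1 + t ^ 2))) (by fun_prop)
    (inv_pos.2 hb) x₀
  simpa [div_eq_inv_mul] using this

theorem lintegral_one_div_one_add_sq_lt_top :
    ∫⁻ t : ℝ, ENNReal.ofReal (1 / (1 + t ^ 2)) < ∞ := by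
  have := integrable_inv_one_add_sq.hasFiniteIntegral
  rw [hasFiniteIntegral_iff_ofReal (Eventually.of_forall fun t => by positivity)] at this
  simpa using this

theorem exists_lintegral_majorant_le {α : ℝ} (hα0 : 0 ≤ α) (hα1 : α < 1) {s : ℝ} (hs : 0 ≤ s)
    {p : ℝ} (hp : (1 + s) / (1 - α) + 5 * α / 2 < p)
    (hp' : (s + 2 * α) / (1 - α) + α / 2 + 1 < p) :
    ∃ C : ℝ≥0∞, C < ∞ ∧ ∀ y : ℝ × ℝ,
      ∫⁻ x, majorant α p (beta α y.2) x y * ENNReal.ofReal (weightW s x y) ≤ C := by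
  have h1α : 0 < 1 - α := by linarith
  set q := p - s / (1 - α) - 2 * α - α / 2
  set q' := p - s / (1 - α) - 2 * (α / (1 - α)) - α / 2
  have hq : 1 < (1 - α) * q := by
    rw [add_div] at hp
    rw [mul_comm, ← div_lt_iff₀ h1α]
    unfold q; linarith
  have hq' : 1 < q' := by
    rw [add_div, mul_div_assoc] at hp'
    unfold q'; linarith
  refine ⟨(∫⁻ t : ℝ, ENNReal.ofReal (1 / (1 + t ^ 2))) *
    (16 * (bracketInt q' * bracketInt ((1 - α) * q))), ?_, fun y => ?_⟩
  · exact ENNReal.mul_lt_top lintegral_one_div_one_add_sq_lt_top (ENNReal.mul_lt_top (by simp)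
      (ENNReal.mul_lt_top (bracketInt_lt_top hq') (bracketInt_lt_top hq)))
  have hb := beta_pos α y.2
  have hmeas := measurable_crossInt α q q' y.2
  refine (lintegral_mono fun x => majorant_mul_weightW_le hα0 hα1 hs p x y).trans ?_
  rw [Measure.volume_eq_prod, lintegral_prod_mul
    (f := fun t => ENNReal.ofReal (1 / (1 + ((t - y.1) / beta α y.2) ^ 2)))
    (g := fun ω => 16 * crossInt α q q' ω y.2) (by fun_prop) (by fun_prop),
    lintegral_one_div_one_add_sq_scale hb, lintegral_const_mul _ hmeas]
  set J := ∫⁻ t : ℝ, ENNReal.ofReal (1 / (1 + t ^ 2))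
  calc ENNReal.ofReal (beta α y.2) * J * (16 * ∫⁻ ω, crossInt α q q' ω y.2)
      ≤ ENNReal.ofReal (beta α y.2) * J * (16 * (ENNReal.ofReal (beta α y.2)⁻¹ *
          (bracketInt q' * bracketInt ((1 - α) * q)))) := by
        gcongr; exact lintegral_crossInt_le hα0 hα1 hq q' y.2
    _ = (ENNReal.ofReal (beta α y.2) * ENNReal.ofReal (beta α y.2)⁻¹) *
          (J * (16 * (bracketInt q' * bracketInt ((1 - α) * q)))) := by ring
    _ = _ := by
        rw [← ENNReal.ofReal_mul hb.le, mul_inv_cancel₀ hb.ne', ENNReal.ofReal_one, one_mul]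

theorem iteratedDeriv_translate_dilate_inv {k : ℕ} {f : ℝ → ℂ} (hf : ContDiff ℝ k f)
    (b ω x : ℝ) : iteratedDeriv k (translate ω (dilate b⁻¹ f)) x =
      (Real.sqrt b : ℂ) * (b : ℂ) ^ k * iteratedDeriv k f (b * (x - ω)) := by
  rw [translate_dilate_inv_eq, iteratedDeriv_const_mul_field,
    iteratedDeriv_comp_sub_const k (fun ξ => f (b * ξ)), iteratedDeriv_comp_const_smul hf]
  simp only [Complex.real_smul, Complex.ofReal_pow, mul_assoc]

/-- Bounds for the derivatives of `f` at `x` up to order `n` that are typical of a function of size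
`B` varying on the length scale `l⁻¹`. -/
def DerivBound (n : ℕ) (f : ℝ → ℂ) (l B x : ℝ) : Prop :=
  ∀ k ≤ n, ‖iteratedDeriv k f x‖ ≤ l ^ k * B

namespace DerivBound

variable {n : ℕ} {f g : ℝ → ℂ} {l l' B B' x : ℝ}

theorem norm_le (h : DerivBound n f l B x) : ‖f x‖ ≤ B := by
  simpa using h 0 n.zero_le

theorem nonneg (h : DerivBound n f l B x) : 0 ≤ B := (norm_nonneg _).trans h.norm_le

theorem mono (h : DerivBound n f l B x) (hl0 : 0 ≤ l) (hl : l ≤ l') (hB : B ≤ B') :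
    DerivBound n f l' B' x := fun k hk =>
  (h k hk).trans (mul_le_mul (by gcongr) hB h.nonneg (pow_nonneg (hl0.trans hl) k))

theorem of_le {m : ℕ} (h : DerivBound n f l B x) (hm : m ≤ n) : DerivBound m f l B x :=
  fun k hk => h k (hk.trans hm)

theorem add (hf : ContDiff ℝ n f) (hg : ContDiff ℝ n g) (hfB : DerivBound n f l B x)
    (hgB : DerivBound n g l B' x) : DerivBound n (f + g) l (B + B') x := fun k hk => by
  have hk' : (k : WithTop ℕ∞) ≤ n := mod_cast hk
  rw [iteratedDeriv_add (hf.of_le hk').contDiffAt (hg.of_le hk').contDiffAt, mul_add]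
  exact (norm_add_le _ _).trans (add_le_add (hfB k hk) (hgB k hk))

theorem mul (hf : ContDiff ℝ n f) (hg : ContDiff ℝ n g) (hl : 0 ≤ l)
    (hfB : DerivBound n f l B x) (hgB : DerivBound n g l B' x) :
    DerivBound n (f * g) l (2 ^ n * (B * B')) x := fun k hk => by
  have hk' : (k : WithTop ℕ∞) ≤ n := mod_cast hk
  have hB := hfB.nonneg
  have hB' := hgB.nonneg
  rw [iteratedDeriv_mul (hf.of_le hk').contDiffAt (hg.of_le hk').contDiffAt]
  calc ‖∑ i ∈ Finset.range (k + 1), (k.choose i : ℂ) * iteratedDeriv i f x *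
          iteratedDeriv (k - i) g x‖
      ≤ ∑ i ∈ Finset.range (k + 1), (k.choose i : ℝ) * (l ^ i * B) * (l ^ (k - i) * B') := by
        refine norm_sum_le_of_le _ fun i hi => ?_
        have hi : i ≤ k := Finset.mem_range_succ_iff.1 hi
        rw [norm_mul, norm_mul, Complex.norm_natCast]
        gcongr
        exacts [hfB i (hi.trans hk), hgB (k - i) ((k.sub_le i).trans hk)]
    _ = ∑ i ∈ Finset.range (k + 1), (k.choose i : ℝ) * (l ^ k * (B * B')) := by
        refine Finset.sum_congr rfl fun i hi => ?_
        rw [← pow_mul_pow_sub l (Finset.mem_range_succ_iff.1 hi)]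
        ring
    _ = l ^ k * (2 ^ k * (B * B')) := by
        rw [← Finset.sum_mul, ← Nat.cast_sum, Nat.sum_range_choose]
        push_cast; ring
    _ ≤ l ^ k * (2 ^ n * (B * B')) := by gcongr; norm_num

theorem conj (hfB : DerivBound n f l B x) :
    DerivBound n (fun ξ => starRingEnd ℂ (f ξ)) l B x := fun k hk => by
  refine le_of_eq_of_le ?_ (hfB k hk)
  rw [← norm_iteratedFDeriv_eq_norm_iteratedDeriv, ← norm_iteratedFDeriv_eq_norm_iteratedDeriv]
  exact Complex.conjLIE.norm_iteratedFDeriv_comp_left f x k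

theorem translate_dilate_inv (hf : ContDiff ℝ n f) {b ω : ℝ} (hb : 0 ≤ b)
    (hfB : DerivBound n f 1 B (b * (x - ω))) :
    DerivBound n (translate ω (dilate b⁻¹ f)) b (Real.sqrt b * B) x := fun k hk => by
  rw [iteratedDeriv_translate_dilate_inv (hf.of_le (mod_cast hk)), norm_mul, norm_mul, norm_pow,
    Complex.norm_real, Complex.norm_real, Real.norm_of_nonneg hb,
    Real.norm_of_nonneg b.sqrt_nonneg, mul_right_comm, mul_comm]
  gcongr
  simpa using hfB k hk

theorem norm_iteratedDeriv_inv_succ_le {c M K : ℝ} {k : ℕ} (hf : ContDiff ℝ (k + 1 : ℕ) f)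
    (hf0 : ∀ y, f y ≠ 0) (hl : 0 ≤ l) (hc : 0 < c) (hcx : c ≤ ‖f x‖)
    (hfM : DerivBound (k + 1) f l M x) (hinv : DerivBound k f⁻¹ l K x) :
    ‖iteratedDeriv (k + 1) f⁻¹ x‖ ≤ l ^ (k + 1) * (c⁻¹ * (2 ^ (k + 1) * (M * K))) := by
  have hM := hfM.nonneg
  have hK := hinv.nonneg
  have hleibniz := iteratedDeriv_mul (x := x) hf.contDiffAt (hf.inv hf0).contDiffAt
  have hone : f * f⁻¹ = fun _ => 1 := funext fun y => mul_inv_cancel₀ (hf0 y)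
  rw [hone, iteratedDeriv_const, if_neg k.succ_ne_zero, Finset.sum_range_succ'] at hleibniz
  have hhead : f x * iteratedDeriv (k + 1) f⁻¹ x = -∑ i ∈ Finset.range (k + 1),
      ((k + 1).choose (i + 1) : ℂ) * iteratedDeriv (i + 1) f x *
        iteratedDeriv (k + 1 - (i + 1)) f⁻¹ x := by
    rw [eq_neg_iff_add_eq_zero, add_comm]
    simpa using hleibniz.symm
  have hsum : ‖f x * iteratedDeriv (k + 1) f⁻¹ x‖ ≤ l ^ (k + 1) * (2 ^ (k + 1) * (M * K)) := by
    rw [hhead, norm_neg]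
    calc _ ≤ ∑ i ∈ Finset.range (k + 1), ((k + 1).choose (i + 1) : ℝ) * (l ^ (i + 1) * M) *
            (l ^ (k + 1 - (i + 1)) * K) := by
          refine norm_sum_le_of_le _ fun i hi => ?_
          have hi : i + 1 ≤ k + 1 := Nat.succ_le_of_lt (Finset.mem_range.1 hi)
          rw [norm_mul, norm_mul, Complex.norm_natCast]
          gcongr
          exacts [hfM (i + 1) hi, hinv (k + 1 - (i + 1)) (by lia)]
      _ = ∑ i ∈ Finset.range (k + 1), ((k + 1).choose (i + 1) : ℝ) * (l ^ (k + 1) * (M * K)) := by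
          refine Finset.sum_congr rfl fun i hi => ?_
          have hi : i + 1 ≤ k + 1 := Nat.succ_le_of_lt (Finset.mem_range.1 hi)
          rw [← pow_mul_pow_sub l hi]
          ring
      _ ≤ ∑ i ∈ Finset.range (k + 2), ((k + 1).choose i : ℝ) * (l ^ (k + 1) * (M * K)) := by
          rw [Finset.sum_range_succ' _ (k + 1)]
          refine le_add_of_nonneg_right ?_
          positivity
      _ = _ := by
          rw [← Finset.sum_mul, ← Nat.cast_sum, Nat.sum_range_choose]
          push_cast; ring
  rw [mul_left_comm, inv_mul_eq_div, le_div_iff₀' hc]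
  refine le_trans ?_ hsum
  rw [norm_mul]
  gcongr

theorem exists_inv (n : ℕ) {c : ℝ} (hc : 0 < c) (M : ℝ) : ∃ K, ∀ (f : ℝ → ℂ) (l x : ℝ),
    ContDiff ℝ n f → (∀ y, f y ≠ 0) → 0 ≤ l → c ≤ ‖f x‖ → DerivBound n f l M x →
      DerivBound n f⁻¹ l K x := by
  induction n with
  | zero =>
    refine ⟨c⁻¹, fun f l x _ _ _ hcx _ k hk => ?_⟩
    rw [Nat.le_zero.1 hk, iteratedDeriv_zero, pow_zero, one_mul, Pi.inv_apply, norm_inv]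
    gcongr
  | succ n ih =>
    obtain ⟨K, hK⟩ := ih
    refine ⟨max K (c⁻¹ * (2 ^ (n + 1) * (M * K))), fun f l x hf hf0 hl hcx hfM k hk => ?_⟩
    have hinv := hK f l x (hf.of_le (mod_cast n.le_succ)) hf0 hl hcx (hfM.of_le n.le_succ)
    rcases Nat.le_succ_iff.1 hk with hk | rfl
    · exact (hinv k hk).trans (by gcongr; exact le_max_left _ _)
    · exact (norm_iteratedDeriv_inv_succ_le hf hf0 hl hc hcx hfM hinv).trans
        (by gcongr; exact le_max_right _ _)

end DerivBound

theorem integrable_iteratedDeriv {n : ℕ} {f : ℝ → ℂ} (hf : ContDiff ℝ n f) {L : ℝ} {l B : ℝ → ℝ}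
    (hB : Integrable B) (hl : ∀ x, 0 ≤ l x) (hL : ∀ x, l x ≤ L)
    (h : ∀ x, DerivBound n f (l x) (B x) x) {k : ℕ} (hk : k ≤ n) :
    Integrable (iteratedDeriv k f) :=
  (hB.const_mul (L ^ k)).mono'
    (hf.continuous_iteratedDeriv k (mod_cast hk)).aestronglyMeasurable
    (Eventually.of_forall fun x => (h x).mono (hl x) (hL x) le_rfl k hk)

theorem norm_fourier_mul_le {f : ℝ → ℂ} (hf : ContDiff ℝ 2 f)
    (hint : ∀ k : ℕ, k ≤ 2 → Integrable (iteratedDeriv k f)) (l t : ℝ) :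
    ‖𝓕 f t‖ * (1 + (t / l) ^ 2) ≤ ∫ ξ, (‖f ξ‖ + ‖iteratedDeriv 2 f ξ‖ / l ^ 2) := by
  have hnorm (g : ℝ → ℂ) : ‖𝓕 g t‖ ≤ ∫ ξ, ‖g ξ‖ :=
    VectorFourier.norm_fourierIntegral_le_integral_norm _ _ _ _ _
  have hderiv : ‖𝓕 (iteratedDeriv 2 f) t‖ = (2 * Real.pi) ^ 2 * (t ^ 2 * ‖𝓕 f t‖) := by
    rw [Real.fourier_iteratedDeriv (N := 2) hf (fun k hk => hint k (mod_cast hk)) le_rfl]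
    simp only [smul_eq_mul, norm_mul, norm_pow, Complex.norm_ofNat, Complex.norm_real,
      Complex.norm_I, Real.norm_eq_abs, abs_of_pos Real.pi_pos, mul_one]
    rw [mul_pow, sq_abs, mul_assoc]
  have hpi : 1 ≤ (2 * Real.pi) ^ 2 := by nlinarith [Real.pi_gt_three]
  have hsq : t ^ 2 * ‖𝓕 f t‖ ≤ ∫ ξ, ‖iteratedDeriv 2 f ξ‖ :=
    (le_mul_of_one_le_left (by positivity) hpi).trans (hderiv.symm.trans_le (hnorm _))
  have hint0 : Integrable f := hint 0 (by norm_num)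
  rw [integral_add hint0.norm ((hint 2 le_rfl).norm.div_const _), integral_div]
  calc ‖𝓕 f t‖ * (1 + (t / l) ^ 2) = ‖𝓕 f t‖ + t ^ 2 * ‖𝓕 f t‖ / l ^ 2 := by
        rw [div_pow]; ring
    _ ≤ _ := by gcongr; exact hnorm _

theorem integrable_scaledDist_rpow (α η : ℝ) {p : ℝ} (hp : 1 < p) :
    Integrable fun ξ => scaledDist α η ξ ^ (-p) := by
  have h := ((integrable_bracket hp).comp_mul_left' (beta_pos α η).ne').comp_sub_right η
  simpa only [← scaledDist_eq_abs] using h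

theorem integrable_scaledDist_rpow_mul (α ω η : ℝ) {p : ℝ} (hp : 1 < p) :
    Integrable fun ξ => scaledDist α ω ξ ^ (-p) * scaledDist α η ξ ^ (-p) := by
  refine (integrable_scaledDist_rpow α η hp).bdd_mul (c := 1)
    (integrable_scaledDist_rpow α ω hp).aestronglyMeasurable (Eventually.of_forall fun ξ => ?_)
  rw [Real.norm_of_nonneg (Real.rpow_nonneg (scaledDist_pos α ω ξ).le _)]
  exact Real.rpow_le_one_of_one_le_of_nonpos (one_le_scaledDist α ω ξ) (by linarith)

/-- The size of a product of two windows at the frequencies `ω` and `η`, as a function of `ξ`. -/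
def crossBound (α p ω η ξ : ℝ) : ℝ :=
  Real.sqrt (beta α ω) * Real.sqrt (beta α η) *
    (scaledDist α ω ξ ^ (-p) * scaledDist α η ξ ^ (-p))

theorem crossBound_pos (α p ω η ξ : ℝ) : 0 < crossBound α p ω η ξ := by
  have := beta_pos α ω
  have := beta_pos α η
  have := scaledDist_pos α ω ξ
  have := scaledDist_pos α η ξ
  unfold crossBound; positivity

theorem integrable_crossBound (α ω η : ℝ) {p : ℝ} (hp : 1 < p) :
    Integrable (crossBound α p ω η) :=
  (integrable_scaledDist_rpow_mul α ω η hp).const_mul _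

theorem DerivBound.norm_add_le_freqMajorant {α p l C ω η ξ : ℝ} {f : ℝ → ℂ} (hl : 0 < l)
    (h : DerivBound 2 f (beta α ω + beta α η + beta α ξ) (C * crossBound α p ω η ξ) ξ) :
    ‖f ξ‖ + ‖iteratedDeriv 2 f ξ‖ / l ^ 2 ≤ C * freqMajorant α p l ω η ξ := by
  have hω := beta_pos α ω
  have hη := beta_pos α η
  have hξ := beta_pos α ξ
  have hB := h.nonneg
  set L := beta α ω + beta α η + beta α ξ
  set B := C * crossBound α p ω η ξ
  have hL : 0 ≤ L / l := by positivity
  calc ‖f ξ‖ + ‖iteratedDeriv 2 f ξ‖ / l ^ 2 ≤ B + L ^ 2 * B / l ^ 2 := by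
        gcongr
        exacts [h.norm_le, h 2 le_rfl]
    _ = B * (1 + (L / l) ^ 2) := by rw [div_pow]; ring
    _ ≤ B * (1 + L / l) ^ 2 := mul_le_mul_of_nonneg_left (by nlinarith) hB
    _ = C * freqMajorant α p l ω η ξ := by unfold B L crossBound freqMajorant; ring

theorem enorm_fourier_le_majorant {α : ℝ} (hα0 : 0 ≤ α) {p : ℝ} (hp : 1 < p) {f : ℝ → ℂ}
    (hf : ContDiff ℝ 2 f) {C : ℝ} {x y : ℝ × ℝ}
    (h : ∀ ξ, DerivBound 2 f (beta α x.2 + beta α y.2 + beta α ξ)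
      (C * crossBound α p x.2 y.2 ξ) ξ) {l : ℝ} (hl : 0 < l) :
    ‖𝓕 f (x.1 - y.1)‖ₑ ≤ ENNReal.ofReal C * majorant α p l x y := by
  have hint : ∀ k ≤ 2, Integrable (iteratedDeriv k f) := fun k =>
    integrable_iteratedDeriv (n := 2) (L := 3) hf ((integrable_crossBound α x.2 y.2 hp).const_mul C)
      (fun ξ => (add_pos (add_pos (beta_pos _ _) (beta_pos _ _)) (beta_pos _ _)).le)
      (fun ξ => by linarith [beta_le_one hα0 x.2, beta_le_one hα0 y.2, beta_le_one hα0 ξ]) h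
  have hC : 0 ≤ C := nonneg_of_mul_nonneg_left (h 0).nonneg (crossBound_pos α p x.2 y.2 0)
  have hfourier := norm_fourier_mul_le hf hint l (x.1 - y.1)
  rw [← le_div_iff₀ (by positivity)] at hfourier
  have hsum : Integrable fun ξ => ‖f ξ‖ + ‖iteratedDeriv 2 f ξ‖ / l ^ 2 :=
    (hint 0 (by norm_num)).norm.add ((hint 2 le_rfl).norm.div_const _)
  rw [← ofReal_norm]
  calc ENNReal.ofReal ‖𝓕 f (x.1 - y.1)‖
      ≤ ENNReal.ofReal ((∫ ξ, (‖f ξ‖ + ‖iteratedDeriv 2 f ξ‖ / l ^ 2)) /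
          (1 + ((x.1 - y.1) / l) ^ 2)) := ENNReal.ofReal_le_ofReal hfourier
    _ = (∫⁻ ξ, ENNReal.ofReal (‖f ξ‖ + ‖iteratedDeriv 2 f ξ‖ / l ^ 2)) *
          ENNReal.ofReal (1 / (1 + ((x.1 - y.1) / l) ^ 2)) := by
        rw [div_eq_mul_one_div, ENNReal.ofReal_mul (integral_nonneg fun ξ => by positivity),
          ofReal_integral_eq_lintegral_ofReal hsum (Eventually.of_forall fun ξ => by positivity)]
    _ ≤ (∫⁻ ξ, ENNReal.ofReal C * ENNReal.ofReal (freqMajorant α p l x.2 y.2 ξ)) *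
          ENNReal.ofReal (1 / (1 + ((x.1 - y.1) / l) ^ 2)) := by
        gcongr with ξ
        rw [← ENNReal.ofReal_mul hC]
        exact ENNReal.ofReal_le_ofReal ((h ξ).norm_add_le_freqMajorant hl)
    _ = _ := by rw [lintegral_const_mul' _ _ ENNReal.ofReal_ne_top, majorant, mul_assoc]

/-- `φ` is of class `C^n`, and its derivatives up to order `n` are bounded by `C (1 + |v|)^{-r}`. -/
structure DecayBound (n : ℕ) (r C : ℝ) (φ : ℝ → ℂ) : Prop where
  contDiff : ContDiff ℝ n φ
  derivBound : ∀ v, DerivBound n φ 1 (C * (1 + |v|) ^ (-r)) v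

theorem HasFourierDecay.exists_decayBound {n : ℕ} {r : ℝ} {ψ : L2} (h : HasFourierDecay n r ψ) :
    ∃ C φ, (𝓕 ψ : L2) =ᵐ[volume] φ ∧ DecayBound n r C φ := by
  obtain ⟨φ, hψφ, hφ, C, hC⟩ := h
  exact ⟨C, φ, hψφ, hφ, fun v k hk => by simpa using hC k hk v⟩

namespace DecayBound

variable {n : ℕ} {r r' C C' : ℝ} {φ φ' : ℝ → ℂ}

theorem const_nonneg (h : DecayBound n r C φ) : 0 ≤ C := by
  simpa using (h.derivBound 0).nonneg

theorem of_le {m : ℕ} (h : DecayBound n r C φ) (hm : m ≤ n) : DecayBound m r C φ :=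
  ⟨h.contDiff.of_le (mod_cast hm), fun v => (h.derivBound v).of_le hm⟩

theorem rpow_mono (h : DecayBound n r C φ) (hr : r' ≤ r) : DecayBound n r' C φ := by
  have hC := h.const_nonneg
  refine ⟨h.contDiff, fun v => (h.derivBound v).mono zero_le_one le_rfl ?_⟩
  gcongr
  linarith [abs_nonneg v]

protected theorem iteratedDeriv {k : ℕ} (h : DecayBound (n + k) r C φ) :
    DecayBound n r C (iteratedDeriv k φ) where
  contDiff := by
    rw [iteratedDeriv_eq_iterate]
    exact h.contDiff.iterate_deriv' n k
  derivBound v m hm := by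
    have hmk := h.derivBound v (m + k) (by lia)
    rw [iteratedDeriv_eq_iterate, Function.iterate_add_apply, ← iteratedDeriv_eq_iterate,
      ← iteratedDeriv_eq_iterate, one_pow] at hmk
    rwa [one_pow]

theorem mul (h : DecayBound n r C φ) (h' : DecayBound n r' C' φ') :
    DecayBound n (r + r') (2 ^ n * (C * C')) (φ * φ') := by
  refine ⟨h.contDiff.mul h'.contDiff, fun v => ?_⟩
  convert (h.derivBound v).mul h.contDiff h'.contDiff zero_le_one (h'.derivBound v) using 1
  rw [neg_add, Real.rpow_add (by positivity)]
  ring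

theorem conj (h : DecayBound n r C φ) : DecayBound n r C fun v => starRingEnd ℂ (φ v) :=
  ⟨Complex.conjLIE.contDiff.comp h.contDiff, fun v => (h.derivBound v).conj⟩

theorem norm_apply_le (h : DecayBound n r C φ) (v : ℝ) : ‖φ v‖ ≤ C * (1 + |v|) ^ (-r) :=
  (h.derivBound v).norm_le

theorem norm_le (h : DecayBound n r C φ) (hr : 0 ≤ r) (v : ℝ) : ‖φ v‖ ≤ C :=
  (h.norm_apply_le v).trans (mul_le_of_le_one_right h.const_nonneg
    (Real.rpow_le_one_of_one_le_of_nonpos (by linarith [abs_nonneg v]) (by linarith)))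

theorem integrable (h : DecayBound n r C φ) (hr : 1 < r) : Integrable φ :=
  ((integrable_bracket hr).const_mul C).mono' h.contDiff.continuous.aestronglyMeasurable
    (Eventually.of_forall h.norm_apply_le)

theorem memLp (h : DecayBound n r C φ) (hr : 1 < r) : MemLp φ 2 volume := by
  have hφ := h.contDiff.continuous
  rw [memLp_two_iff_integrable_sq_norm hφ.aestronglyMeasurable]
  simp only [sq]
  exact (h.integrable hr).norm.bdd_mul hφ.norm.aestronglyMeasurable
    (Eventually.of_forall fun v => (norm_norm _).trans_le (h.norm_le (by linarith) v))

end DecayBound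

theorem bracket_rpow_le {r v w : ℝ} (hr : 0 ≤ r) (h : |w - v| ≤ (1 + |v|) / 2) :
    (1 + |w|) ^ (-r) ≤ 2 ^ r * (1 + |v|) ^ (-r) := by
  have hw : (1 + |v|) / 2 ≤ 1 + |w| := by linarith [abs_sub_comm w v ▸ abs_sub_abs_le_abs_sub v w]
  calc (1 + |w|) ^ (-r) ≤ ((1 + |v|) / 2) ^ (-r) :=
        Real.rpow_le_rpow_of_nonpos (by positivity) hw (by linarith)
    _ = _ := by
        rw [Real.div_rpow (by positivity) zero_le_two, Real.rpow_neg zero_le_two]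
        field_simp

theorem DecayBound.norm_sub_le {r C : ℝ} {φ : ℝ → ℂ} (h : DecayBound 1 r C φ) (hr : 0 ≤ r)
    {v w : ℝ} (hvw : |w - v| ≤ (1 + |v|) / 2) :
    ‖φ v - φ w‖ ≤ C * (2 ^ r * (1 + |v|) ^ (-r)) * |w - v| := by
  have hC := h.const_nonneg
  rw [norm_sub_rev, ← Real.norm_eq_abs]
  refine (convex_closedBall v |w - v|).norm_image_sub_le_of_norm_deriv_le
    (fun x _ => h.contDiff.contDiffAt.differentiableAt one_ne_zero) (fun x hx => ?_)
    (Metric.mem_closedBall_self (abs_nonneg _)) (Metric.mem_closedBall.2 le_rfl)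
  calc ‖deriv φ x‖ ≤ C * (1 + |x|) ^ (-r) := by simpa using h.derivBound x 1 le_rfl
    _ ≤ C * (2 ^ r * (1 + |v|) ^ (-r)) := by
        gcongr
        exact bracket_rpow_le hr ((Metric.mem_closedBall.1 hx).trans hvw)

theorem abs_sub_one_le_abs_sq_sub_one {a : ℝ} (ha : 0 ≤ a) : |a - 1| ≤ |a ^ 2 - 1| := by
  rw [show a ^ 2 - 1 = (a - 1) * (a + 1) by ring, abs_mul,
    abs_of_nonneg (by positivity : 0 ≤ a + 1)]
  exact le_mul_of_one_le_right (abs_nonneg _) (by linarith)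

theorem abs_pow_sub_one_le {a e : ℝ} (ha : 0 ≤ a) (ha2 : a ≤ 2) (he : |a - 1| ≤ e) (m : ℕ) :
    |a ^ m - 1| ≤ m * 2 ^ m * e := by
  have hmax : max |a| |1| ≤ 2 := by rw [abs_of_nonneg ha, abs_one]; exact max_le ha2 one_le_two
  calc |a ^ m - 1| = |a ^ m - 1 ^ m| := by rw [one_pow]
    _ ≤ |a - 1| * m * max |a| |1| ^ (m - 1) := abs_pow_sub_pow_le ..
    _ ≤ e * m * 2 ^ m := by
        have he0 : 0 ≤ e := (abs_nonneg _).trans he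
        gcongr ?_ * _ * ?_
        exact (pow_le_pow_left₀ (by positivity) hmax _).trans
          (pow_le_pow_right₀ one_le_two (m.sub_le 1))
    _ = m * 2 ^ m * e := by ring

theorem abs_sqrt_pow_sub_one_le {k e : ℝ} (hk0 : 0 ≤ k) (hk4 : k ≤ 4) (hk : |k - 1| ≤ e) (m : ℕ) :
    |Real.sqrt k ^ m - 1| ≤ m * 2 ^ m * e := by
  have hroot := abs_sub_one_le_abs_sq_sub_one k.sqrt_nonneg
  rw [Real.sq_sqrt hk0] at hroot
  exact abs_pow_sub_one_le k.sqrt_nonneg (Real.sqrt_le_iff.2 ⟨by norm_num, by linarith⟩)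
    (hroot.trans hk) m

theorem contDiff_modulate {n : ℕ} (ω : ℝ) {f : ℝ → ℂ} (hf : ContDiff ℝ n f) :
    ContDiff ℝ n (modulate ω f) := by
  have hexp : ContDiff ℝ n fun t : ℝ => Complex.exp (2 * Real.pi * Complex.I * ω * t) :=
    (contDiff_const.mul Complex.ofRealCLM.contDiff).cexp
  exact hexp.mul hf

theorem norm_iteratedDeriv_modulate_one (ω : ℝ) (k : ℕ) (v : ℝ) :
    ‖iteratedDeriv k (modulate ω 1) v‖ = (2 * Real.pi * |ω|) ^ k := by
  set c : ℂ := 2 * Real.pi * Complex.I * ω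
  have hexp : iteratedDeriv k (modulate ω 1) = fun t => c ^ k * modulate ω 1 t := by
    induction k with
    | zero => simp
    | succ k ih =>
      ext t
      have hderiv : HasDerivAt (modulate ω 1) (Complex.exp (c * t) * c * 1) t := by
        have hlin : HasDerivAt (fun t : ℝ => c * t) c t := by
          simpa using (hasDerivAt_id t).ofReal_comp.const_mul c
        exact hlin.cexp.mul_const 1
      rw [iteratedDeriv_succ, ih, (hderiv.const_mul (c ^ k)).deriv]
      simp only [modulate, Pi.one_apply]
      ring
  have hc : ‖c‖ = 2 * Real.pi * |ω| := by simp [c, abs_of_pos Real.pi_pos]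
  simp [hexp, norm_modulate, hc]

theorem derivBound_one_sub_modulate_one (n : ℕ) {e δ : ℝ} (he : e ≤ 1 / 8) (hδ : |δ| ≤ e) (v : ℝ) :
    DerivBound n (1 - modulate δ 1) 1 (8 * e * (1 + |v|)) v := by
  have he0 : 0 ≤ e := (abs_nonneg _).trans hδ
  have hb0 : 0 ≤ 2 * Real.pi * |δ| := by positivity
  have hb : 2 * Real.pi * |δ| ≤ 8 * e := by nlinarith [Real.pi_lt_four, abs_nonneg δ]
  have hv := abs_nonneg v
  intro k _
  rw [one_pow, one_mul]
  rcases Nat.eq_zero_or_pos k with rfl | hk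
  · have harg : (2 * Real.pi * Complex.I * δ * v : ℂ) =
        Complex.I * ((2 * Real.pi * δ * v : ℝ) : ℂ) := by push_cast; ring
    rw [iteratedDeriv_zero, Pi.sub_apply, Pi.one_apply, norm_sub_rev, modulate, harg, Pi.one_apply,
      mul_one]
    refine Real.norm_exp_I_mul_ofReal_sub_one_le.trans ?_
    rw [Real.norm_eq_abs, abs_mul, abs_mul, abs_of_pos Real.two_pi_pos]
    nlinarith [mul_le_mul_of_nonneg_right hb hv]
  · have hderiv : iteratedDeriv k (1 - modulate δ 1) v = -iteratedDeriv k (modulate δ 1) v :=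
      (iteratedDeriv_const_sub hk (1 : ℂ)).trans (iteratedDeriv_neg k _ v)
    rw [hderiv, norm_neg, norm_iteratedDeriv_modulate_one]
    calc (2 * Real.pi * |δ|) ^ k ≤ 2 * Real.pi * |δ| :=
          pow_le_of_le_one hb0 (by linarith) hk.ne'
      _ ≤ 8 * e * (1 + |v|) := by nlinarith

theorem contDiff_translate_dilate_inv {n : ℕ} (b ω : ℝ) {f : ℝ → ℂ} (hf : ContDiff ℝ n f) :
    ContDiff ℝ n (translate ω (dilate b⁻¹ f)) := by
  rw [translate_dilate_inv_eq]
  exact contDiff_const.mul (hf.comp (by fun_prop))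

/-- The change of a window `φ` under a small translation by `μ`, a dilation by the factor `k⁻¹`
close to `1`, and a small modulation by `δ`. -/
def windowDefect (φ : ℝ → ℂ) (k δ μ : ℝ) : ℝ → ℂ :=
  φ - modulate δ (translate μ (dilate k⁻¹ φ))

theorem abs_affine_sub_le {e k μ v : ℝ} (he : e ≤ 1 / 8) (hk : |k - 1| ≤ e) (hμ : |μ| ≤ e) :
    |k * (v - μ) - v| ≤ 2 * e * (1 + |v|) := by
  have hk2 : |k| ≤ 2 := by rw [abs_le] at hk ⊢; constructor <;> linarith
  calc |k * (v - μ) - v| = |(k - 1) * v - k * μ| := by ring_nf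
    _ ≤ |k - 1| * |v| + |k| * |μ| := by rw [← abs_mul, ← abs_mul]; exact abs_sub _ _
    _ ≤ e * |v| + 2 * e := by gcongr
    _ ≤ 2 * e * (1 + |v|) := by nlinarith [abs_nonneg v, (abs_nonneg _).trans hμ]

namespace DecayBound

variable {n : ℕ} {r C e k μ : ℝ} {φ : ℝ → ℂ}

theorem translate_dilate_inv (h : DecayBound n r C φ) (hr : 0 ≤ r) (he : e ≤ 1 / 8)
    (hk : |k - 1| ≤ e) (hμ : |μ| ≤ e) (v : ℝ) :
    DerivBound n (translate μ (dilate k⁻¹ φ)) 1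
      (2 ^ (n + 1) * (C * (2 ^ r * (1 + |v|) ^ (-r)))) v := by
  have hC := h.const_nonneg
  have hk0 : 0 ≤ k := by linarith [(abs_le.1 hk).1]
  have hk2 : k ≤ 2 := by linarith [(abs_le.1 hk).2]
  have hsqrt : Real.sqrt k ≤ 2 := Real.sqrt_le_iff.2 ⟨by norm_num, by linarith⟩
  have hw : |k * (v - μ) - v| ≤ (1 + |v|) / 2 :=
    (abs_affine_sub_le he hk hμ).trans (by nlinarith [abs_nonneg v])
  intro j hj
  refine (DerivBound.translate_dilate_inv h.contDiff hk0 (h.derivBound _) j hj).trans ?_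
  calc k ^ j * (Real.sqrt k * (C * (1 + |k * (v - μ)|) ^ (-r)))
      ≤ 2 ^ n * (2 * (C * (2 ^ r * (1 + |v|) ^ (-r)))) := by
        gcongr ?_ * (?_ * (_ * ?_))
        · exact (pow_le_pow_left₀ hk0 hk2 j).trans (pow_le_pow_right₀ one_le_two hj)
        · exact bracket_rpow_le hr hw
    _ = _ := by ring

theorem sub_translate_dilate_inv (h : DecayBound (n + 1) r C φ) (hr : 0 ≤ r) (he : e ≤ 1 / 8)
    (hk : |k - 1| ≤ e) (hμ : |μ| ≤ e) (v : ℝ) :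
    DerivBound n (φ - translate μ (dilate k⁻¹ φ)) 1
      ((2 + (2 * n + 1) * 2 ^ (2 * n + 1)) *
        (e * (1 + |v|) * (C * (2 ^ r * (1 + |v|) ^ (-r))))) v := fun j hj => by
  have hC := h.const_nonneg
  have he0 : 0 ≤ e := (abs_nonneg _).trans hμ
  have hk0 : 0 ≤ k := by linarith [(abs_le.1 hk).1]
  have hφ : ContDiff ℝ j φ := h.contDiff.of_le (mod_cast hj.trans n.le_succ)
  have hdist := abs_affine_sub_le (v := v) he hk hμ
  have hw : |k * (v - μ) - v| ≤ (1 + |v|) / 2 := hdist.trans (by nlinarith [abs_nonneg v])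
  set w := k * (v - μ)
  set P := C * (2 ^ r * (1 + |v|) ^ (-r))
  have hsize : ‖iteratedDeriv j φ w‖ ≤ P := by
    have hj' : DecayBound (0 + j) r C φ := h.of_le (by lia)
    refine (hj'.iteratedDeriv.norm_apply_le w).trans ?_
    unfold P
    gcongr
    exact bracket_rpow_le hr hw
  have hdiff : ‖iteratedDeriv j φ v - iteratedDeriv j φ w‖ ≤ 2 * (e * (1 + |v|) * P) := by
    have hj' : DecayBound (1 + j) r C φ := h.of_le (by lia)
    refine (hj'.iteratedDeriv.norm_sub_le hr hw).trans ?_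
    calc P * |w - v| ≤ P * (2 * e * (1 + |v|)) := by gcongr
      _ = _ := by ring
  have hfactor : |Real.sqrt k ^ (2 * j + 1) - 1| ≤ (2 * n + 1) * 2 ^ (2 * n + 1) * e := by
    refine (abs_sqrt_pow_sub_one_le hk0 (by linarith [(abs_le.1 hk).2]) hk _).trans ?_
    push_cast
    gcongr
    norm_num
  have hsplit : iteratedDeriv j (φ - translate μ (dilate k⁻¹ φ)) v =
      (iteratedDeriv j φ v - iteratedDeriv j φ w) -
        ((Real.sqrt k ^ (2 * j + 1) - 1 : ℝ) : ℂ) * iteratedDeriv j φ w := by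
    rw [iteratedDeriv_sub hφ.contDiffAt (contDiff_translate_dilate_inv k μ hφ).contDiffAt,
      iteratedDeriv_translate_dilate_inv hφ, pow_succ, pow_mul, Real.sq_sqrt hk0]
    push_cast
    ring
  rw [one_pow, one_mul, hsplit]
  refine (_root_.norm_sub_le _ _).trans ?_
  rw [norm_mul, Complex.norm_real, Real.norm_eq_abs]
  have he1 : e ≤ e * (1 + |v|) := le_mul_of_one_le_right he0 (by simp)
  calc _ ≤ 2 * (e * (1 + |v|) * P) + (2 * n + 1) * 2 ^ (2 * n + 1) * e * P := by gcongr
    _ ≤ 2 * (e * (1 + |v|) * P) + (2 * n + 1) * 2 ^ (2 * n + 1) * (e * (1 + |v|)) * P := by gcongr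
    _ = _ := by ring

theorem exists_windowDefect (n : ℕ) (hr : 0 ≤ r) : ∃ K, ∀ (C e k δ μ : ℝ) (φ : ℝ → ℂ),
    DecayBound (n + 1) r C φ → e ≤ 1 / 8 → |k - 1| ≤ e → |δ| ≤ e → |μ| ≤ e →
      DecayBound n (r - 1) (K * C * e) (windowDefect φ k δ μ) := by
  refine ⟨(2 + (2 * n + 1) * 2 ^ (2 * n + 1) + 2 ^ n * (8 * 2 ^ (n + 1))) * 2 ^ r,
    fun C e k δ μ φ h he hk hδ hμ => ?_⟩
  have hn := h.of_le n.le_succ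
  have hT := contDiff_translate_dilate_inv k μ hn.contDiff
  have hone : ContDiff ℝ n (1 : ℝ → ℂ) := contDiff_const
  have hmod : ContDiff ℝ n (1 - modulate δ 1) := hone.sub (contDiff_modulate δ hone)
  have hdiff : ContDiff ℝ n (φ - translate μ (dilate k⁻¹ φ)) := hn.contDiff.sub hT
  have hsplit : windowDefect φ k δ μ = (φ - translate μ (dilate k⁻¹ φ)) +
      (1 - modulate δ 1) * translate μ (dilate k⁻¹ φ) := by
    ext v
    simp only [windowDefect, modulate, Pi.sub_apply, Pi.add_apply, Pi.mul_apply, Pi.one_apply]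
    ring
  rw [hsplit]
  have hprod : ContDiff ℝ n ((1 - modulate δ 1) * translate μ (dilate k⁻¹ φ)) := hmod.mul hT
  refine ⟨hdiff.add hprod, fun v => ?_⟩
  convert (h.sub_translate_dilate_inv hr he hk hμ v).add hdiff hprod
    ((derivBound_one_sub_modulate_one n he hδ v).mul hmod hT zero_le_one
      (hn.translate_dilate_inv hr he hk hμ v)) using 1
  rw [show -(r - 1) = 1 + -r by ring, Real.rpow_add (by positivity), Real.rpow_one]
  ring

end DecayBound

/-- The integral `∫ β(ω)^k F(β(ω)(ξ - ω)) dω`. For `k = 1` and `F = |ψ̂|²` it is the symbol of the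
frame operator; each derivative in `ξ` raises `k` by one and differentiates `F`. -/
def symbolInt (α : ℝ) (k : ℕ) (F : ℝ → ℂ) (ξ : ℝ) : ℂ :=
  ∫ ω, (beta α ω : ℂ) ^ k * F (beta α ω * (ξ - ω))

section SymbolInt

variable {α p C : ℝ} {F : ℝ → ℂ}

theorem nonneg_of_one_lt_mul (hα1 : α < 1) (hp : 1 < (1 - α) * p) : 0 ≤ p :=
  (pos_of_mul_pos_right (one_pos.trans hp) (sub_pos.2 hα1).le).le

theorem integrable_beta_mul_scaledDist_rpow (hα0 : 0 ≤ α) (hα1 : α < 1) (hp : 1 < (1 - α) * p)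
    (ξ : ℝ) : Integrable fun ω => beta α ξ * scaledDist α ω ξ ^ (-p) := by
  have hm : Measurable fun ω => scaledDist α ω ξ :=
    ((continuous_scaledDist α).comp (by fun_prop : Continuous fun ω : ℝ => (ω, ξ))).measurable
  refine ⟨Measurable.aestronglyMeasurable (by fun_prop), ?_⟩
  rw [hasFiniteIntegral_iff_ofReal (Eventually.of_forall fun ω =>
    mul_nonneg (beta_pos α ξ).le (Real.rpow_nonneg (scaledDist_pos α ω ξ).le _))]
  exact (lintegral_scaledDist_left hα0 hα1 (nonneg_of_one_lt_mul hα1 hp) ξ).trans_lt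
    (bracketInt_lt_top hp)

theorem integrable_scaledDist_left (hα0 : 0 ≤ α) (hα1 : α < 1) (hp : 1 < (1 - α) * p) (ξ : ℝ) :
    Integrable fun ω => scaledDist α ω ξ ^ (-p) := by
  simpa only [inv_mul_cancel_left₀ (beta_pos α ξ).ne'] using
    (integrable_beta_mul_scaledDist_rpow hα0 hα1 hp ξ).const_mul (beta α ξ)⁻¹

theorem integral_scaledDist_left_le (hα0 : 0 ≤ α) (hα1 : α < 1) (hp : 1 < (1 - α) * p) (ξ : ℝ) :
    ∫ ω, beta α ξ * scaledDist α ω ξ ^ (-p) ≤ (bracketInt ((1 - α) * p)).toReal := by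
  rw [integral_eq_lintegral_of_nonneg_ae (Eventually.of_forall fun ω =>
    mul_nonneg (beta_pos α ξ).le (Real.rpow_nonneg (scaledDist_pos α ω ξ).le _))
    (integrable_beta_mul_scaledDist_rpow hα0 hα1 hp ξ).aestronglyMeasurable]
  exact ENNReal.toReal_mono (bracketInt_lt_top hp).ne
    (lintegral_scaledDist_left hα0 hα1 (nonneg_of_one_lt_mul hα1 hp) ξ)

theorem norm_symbol_integrand (k : ℕ) (ω ξ : ℝ) :
    ‖(beta α ω : ℂ) ^ k * F (beta α ω * (ξ - ω))‖ =
      beta α ω ^ k * ‖F (beta α ω * (ξ - ω))‖ := by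
  rw [norm_mul, norm_pow, Complex.norm_real, Real.norm_of_nonneg (beta_pos α ω).le]

theorem norm_symbol_integrand_le (hα0 : 0 ≤ α) (hF : DecayBound 0 p C F) (k : ℕ) (ω ξ : ℝ) :
    ‖(beta α ω : ℂ) ^ k * F (beta α ω * (ξ - ω))‖ ≤ C * scaledDist α ω ξ ^ (-p) := by
  rw [norm_symbol_integrand, scaledDist_eq_abs]
  exact (mul_le_of_le_one_left (norm_nonneg _)
    (pow_le_one₀ (beta_pos α ω).le (beta_le_one hα0 ω))).trans (hF.norm_apply_le _)

theorem measurable_symbol_integrand (hF : Continuous F) (k : ℕ) (ξ : ℝ) :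
    Measurable fun ω => (beta α ω : ℂ) ^ k * F (beta α ω * (ξ - ω)) := by
  have hFm := hF.measurable
  fun_prop

theorem integrable_symbol_integrand (hα0 : 0 ≤ α) (hα1 : α < 1) (hp : 1 < (1 - α) * p)
    (hF : DecayBound 0 p C F) (k : ℕ) (ξ : ℝ) :
    Integrable fun ω => (beta α ω : ℂ) ^ k * F (beta α ω * (ξ - ω)) :=
  ((integrable_scaledDist_left hα0 hα1 hp ξ).const_mul C).mono'
    (measurable_symbol_integrand hF.contDiff.continuous k ξ).aestronglyMeasurable
    (Eventually.of_forall fun ω => norm_symbol_integrand_le hα0 hF k ω ξ)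

theorem beta_pow_mul_scaledDist_rpow_le (hα0 : 0 ≤ α) (hα1 : α < 1) {n k : ℕ} (hk : k ≤ n)
    (p ω ξ : ℝ) : beta α ω ^ (k + 1) * scaledDist α ω ξ ^ (-p) ≤
      beta α ξ ^ k * (beta α ξ * scaledDist α ω ξ ^ (-(p - (n + 1) * α))) := by
  have hU := scaledDist_pos α ω ξ
  have hω := beta_pos α ω
  have hξ := beta_pos α ξ
  have hkn : ((k + 1 : ℕ) : ℝ) ≤ n + 1 := by exact_mod_cast Nat.succ_le_succ hk
  have hβ : beta α ω ^ (k + 1) ≤ beta α ξ ^ (k + 1) * scaledDist α ω ξ ^ ((n + 1) * α) :=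
    calc beta α ω ^ (k + 1) ≤ (beta α ξ * scaledDist α ω ξ ^ α) ^ (k + 1) := by
          gcongr
          exact beta_le_mul_scaledDist hα0 hα1 ω ξ
      _ = beta α ξ ^ (k + 1) * scaledDist α ω ξ ^ ((k + 1 : ℕ) * α) := by
          rw [mul_pow, mul_comm (_ : ℝ) α, Real.rpow_mul hU.le, Real.rpow_natCast]
      _ ≤ _ := by
          gcongr
          exact one_le_scaledDist α ω ξ
  calc beta α ω ^ (k + 1) * scaledDist α ω ξ ^ (-p)
      ≤ beta α ξ ^ (k + 1) * scaledDist α ω ξ ^ ((n + 1) * α) * scaledDist α ω ξ ^ (-p) := by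
        gcongr
    _ = _ := by
        rw [neg_sub, sub_eq_add_neg, Real.rpow_add hU]
        ring

theorem norm_symbolInt_le (hα0 : 0 ≤ α) (hα1 : α < 1) {n k : ℕ}
    (hp : 1 < (1 - α) * (p - (n + 1) * α)) (hF : DecayBound 0 p C F) (hk : k ≤ n) (ξ : ℝ) :
    ‖symbolInt α (k + 1) F ξ‖ ≤
      beta α ξ ^ k * (C * (bracketInt ((1 - α) * (p - (n + 1) * α))).toReal) := by
  have hC := hF.const_nonneg
  have hξ := beta_pos α ξ
  have hle (ω : ℝ) : ‖(beta α ω : ℂ) ^ (k + 1) * F (beta α ω * (ξ - ω))‖ ≤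
      beta α ξ ^ k * C * (beta α ξ * scaledDist α ω ξ ^ (-(p - (n + 1) * α))) :=
    calc ‖(beta α ω : ℂ) ^ (k + 1) * F (beta α ω * (ξ - ω))‖
        ≤ beta α ω ^ (k + 1) * (C * scaledDist α ω ξ ^ (-p)) := by
          have hω := beta_pos α ω
          rw [norm_symbol_integrand, scaledDist_eq_abs]
          gcongr
          exact hF.norm_apply_le _
      _ = C * (beta α ω ^ (k + 1) * scaledDist α ω ξ ^ (-p)) := by ring
      _ ≤ C * (beta α ξ ^ k * (beta α ξ * scaledDist α ω ξ ^ (-(p - (n + 1) * α)))) :=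
          mul_le_mul_of_nonneg_left (beta_pow_mul_scaledDist_rpow_le hα0 hα1 hk p ω ξ) hC
      _ = _ := by ring
  calc ‖symbolInt α (k + 1) F ξ‖
      ≤ ∫ ω, beta α ξ ^ k * C * (beta α ξ * scaledDist α ω ξ ^ (-(p - (n + 1) * α))) :=
        norm_integral_le_of_norm_le
          ((integrable_beta_mul_scaledDist_rpow hα0 hα1 hp ξ).const_mul _)
          (Eventually.of_forall hle)
    _ = beta α ξ ^ k * C * ∫ ω, (beta α ξ * scaledDist α ω ξ ^ (-(p - (n + 1) * α))) :=
        integral_const_mul _ _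
    _ ≤ beta α ξ ^ k * C * (bracketInt ((1 - α) * (p - (n + 1) * α))).toReal := by
        gcongr
        exact integral_scaledDist_left_le hα0 hα1 hp ξ
    _ = _ := by ring

theorem norm_symbol_integrand_le_of_mem_ball (hα0 : 0 ≤ α) (hp : 0 ≤ p) (hF : DecayBound 0 p C F)
    (k : ℕ) {ξ x : ℝ} (hx : x ∈ Metric.ball ξ (1 / 2)) (ω : ℝ) :
    ‖(beta α ω : ℂ) ^ k * F (beta α ω * (x - ω))‖ ≤
      C * (2 ^ p * scaledDist α ω ξ ^ (-p)) := by
  have hC := hF.const_nonneg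
  have hb := beta_pos α ω
  have hx' : |x - ξ| ≤ 1 / 2 := by
    rw [← Real.dist_eq]
    exact (Metric.mem_ball.1 hx).le
  have hxξ : |beta α ω * (x - ω) - beta α ω * (ξ - ω)| ≤ (1 + |beta α ω * (ξ - ω)|) / 2 :=
    calc |beta α ω * (x - ω) - beta α ω * (ξ - ω)| = beta α ω * |x - ξ| := by
          rw [← mul_sub, abs_mul, abs_of_pos hb, sub_sub_sub_cancel_right]
      _ ≤ 1 * (1 / 2) := by
          gcongr
          exact beta_le_one hα0 ω
      _ ≤ _ := by linarith [abs_nonneg (beta α ω * (ξ - ω))]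
  refine (norm_symbol_integrand_le hα0 hF k ω x).trans ?_
  rw [scaledDist_eq_abs, scaledDist_eq_abs]
  gcongr
  exact bracket_rpow_le hp hxξ

theorem hasDerivAt_symbolInt (hα0 : 0 ≤ α) (hα1 : α < 1) (hp : 1 < (1 - α) * p)
    (hF : DecayBound 1 p C F) (k : ℕ) (ξ : ℝ) :
    HasDerivAt (symbolInt α k F) (symbolInt α (k + 1) (deriv F) ξ) ξ := by
  have hF0 : DecayBound 0 p C F := hF.of_le zero_le_one
  have hF' : DecayBound 0 p C (deriv F) := by
    simpa only [iteratedDeriv_one] using DecayBound.iteratedDeriv (n := 0) (k := 1) hF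
  have hderiv (ω x : ℝ) : HasDerivAt (fun x : ℝ => (beta α ω : ℂ) ^ k * F (beta α ω * (x - ω)))
      ((beta α ω : ℂ) ^ (k + 1) * deriv F (beta α ω * (x - ω))) x := by
    have hd := (hF.contDiff.differentiable one_ne_zero (beta α ω * (x - ω))).hasDerivAt
    have haff : HasDerivAt (fun x => beta α ω * (x - ω)) (beta α ω) x := by
      simpa using ((hasDerivAt_id x).sub_const ω).const_mul (beta α ω)
    refine ((hd.scomp x haff).const_mul ((beta α ω : ℂ) ^ k)).congr_deriv ?_
    rw [Complex.real_smul]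
    ring
  exact (hasDerivAt_integral_of_dominated_loc_of_deriv_le (Metric.ball_mem_nhds ξ one_half_pos)
    (Eventually.of_forall fun x =>
      (measurable_symbol_integrand hF.contDiff.continuous k x).aestronglyMeasurable)
    (integrable_symbol_integrand hα0 hα1 hp hF0 k ξ)
    (measurable_symbol_integrand hF'.contDiff.continuous (k + 1) ξ).aestronglyMeasurable
    (Eventually.of_forall fun ω x hx =>
      norm_symbol_integrand_le_of_mem_ball hα0 (nonneg_of_one_lt_mul hα1 hp) hF' (k + 1) hx ω)
    (((integrable_scaledDist_left hα0 hα1 hp ξ).const_mul _).const_mul _)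
    (Eventually.of_forall fun ω x _ => hderiv ω x)).2

theorem iteratedDeriv_symbolInt (hα0 : 0 ≤ α) (hα1 : α < 1) (hp : 1 < (1 - α) * p) {n : ℕ}
    (hF : DecayBound n p C F) (k : ℕ) :
    iteratedDeriv n (symbolInt α k F) = symbolInt α (n + k) (iteratedDeriv n F) := by
  induction n with
  | zero => simp
  | succ n ih =>
    rw [iteratedDeriv_succ, ih (hF.of_le n.le_succ), iteratedDeriv_succ, add_right_comm]
    exact funext fun ξ => (hasDerivAt_symbolInt hα0 hα1 hp
      (DecayBound.iteratedDeriv (n := 1) (add_comm n 1 ▸ hF)) (n + k) ξ).deriv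

theorem contDiff_symbolInt (hα0 : 0 ≤ α) (hα1 : α < 1) (hp : 1 < (1 - α) * p) {n : ℕ}
    (hF : DecayBound (n + 1) p C F) (k : ℕ) : ContDiff ℝ n (symbolInt α k F) := by
  refine contDiff_of_differentiable_iteratedDeriv fun m hm => ?_
  replace hm : m ≤ n := mod_cast hm
  rw [iteratedDeriv_symbolInt hα0 hα1 hp (hF.of_le (hm.trans n.le_succ)) k]
  exact fun ξ => (hasDerivAt_symbolInt hα0 hα1 hp
    (hF.of_le (by lia) : DecayBound (1 + m) p C F).iteratedDeriv (m + k) ξ).differentiableAt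

theorem derivBound_symbolInt (hα0 : 0 ≤ α) (hα1 : α < 1) {n : ℕ}
    (hp : 1 < (1 - α) * (p - (n + 1) * α)) (hF : DecayBound n p C F) (ξ : ℝ) :
    DerivBound n (symbolInt α 1 F) (beta α ξ)
      (C * (bracketInt ((1 - α) * (p - (n + 1) * α))).toReal) ξ := by
  intro k hk
  have hp' : 1 < (1 - α) * p := hp.trans_le (mul_le_mul_of_nonneg_left
    (sub_le_self p (by positivity)) (sub_pos.2 hα1).le)
  rw [iteratedDeriv_symbolInt hα0 hα1 hp' (hF.of_le hk)]
  exact norm_symbolInt_le hα0 hα1 hp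
    (hF.of_le (by lia) : DecayBound (0 + k) p C F).iteratedDeriv hk ξ

end SymbolInt

theorem abs_rpow_sub_one_le {a q : ℝ} (ha0 : 0 ≤ a) (ha1 : a ≤ 1) (hq : 0 < q) :
    |q ^ a - 1| ≤ |q - 1| := by
  rcases le_total q 1 with hq1 | hq1
  · have hle : q ≤ q ^ a := by
      simpa using Real.rpow_le_rpow_of_exponent_ge hq hq1 ha1
    rw [abs_of_nonpos (sub_nonpos.2 (Real.rpow_le_one hq.le hq1 ha0)),
      abs_of_nonpos (sub_nonpos.2 hq1)]
    linarith
  · have hle : q ^ a ≤ q := by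
      simpa using Real.rpow_le_rpow_of_exponent_le hq1 ha1
    rw [abs_of_nonneg (sub_nonneg.2 (Real.one_le_rpow hq1 ha0)),
      abs_of_nonneg (sub_nonneg.2 hq1)]
    linarith

section Symbol

variable {α : ℝ}

theorem abs_beta_sub_le (hα0 : 0 ≤ α) (hα1 : α < 1) {τ ω ω₀ : ℝ} (hτ : τ ≤ 1 / 2)
    (h : |ω - ω₀| ≤ τ * (beta α ω₀)⁻¹) : |beta α ω - beta α ω₀| ≤ 2 * τ * beta α ω₀ := by
  have hb := beta_pos α ω₀
  have hW : 0 < 1 + |ω| := by positivity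
  have hW₀ : 0 < 1 + |ω₀| := by positivity
  have hτ0 : 0 ≤ τ := nonneg_of_mul_nonneg_left ((abs_nonneg _).trans h) (inv_pos.2 hb)
  have hd : |ω - ω₀| ≤ τ * (1 + |ω₀|) := by
    refine h.trans (mul_le_mul_of_nonneg_left ?_ hτ0)
    rw [beta_inv]
    exact one_add_abs_rpow_le hα1 ω₀
  have hW2 : 1 + |ω₀| ≤ 2 * (1 + |ω|) := by
    have h₁ := abs_sub_abs_le_abs_sub ω₀ ω
    rw [abs_sub_comm] at h₁
    nlinarith
  have hq : |(1 + |ω₀|) / (1 + |ω|) - 1| ≤ 2 * τ := by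
    rw [div_sub_one hW.ne', abs_div, abs_of_pos hW, div_le_iff₀ hW, add_sub_add_left_eq_sub]
    calc |(|ω₀| - |ω|)| ≤ |ω₀ - ω| := abs_abs_sub_abs_le _ _
      _ ≤ τ * (1 + |ω₀|) := by rwa [abs_sub_comm]
      _ ≤ τ * (2 * (1 + |ω|)) := by gcongr
      _ = _ := by ring
  have hβ : beta α ω = beta α ω₀ * ((1 + |ω₀|) / (1 + |ω|)) ^ α := by
    rw [Real.div_rpow hW₀.le hW.le, beta, beta, Real.rpow_neg hW.le, Real.rpow_neg hW₀.le]
    field_simp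
  calc |beta α ω - beta α ω₀| = beta α ω₀ * |((1 + |ω₀|) / (1 + |ω|)) ^ α - 1| := by
        rw [hβ, ← mul_sub_one, abs_mul, abs_of_pos hb]
    _ ≤ beta α ω₀ * (2 * τ) := by
        gcongr
        exact (abs_rpow_sub_one_le hα0 hα1.le (by positivity)).trans hq
    _ = _ := by ring

theorem abs_beta_mul_sub_le (hα0 : 0 ≤ α) (hα1 : α < 1) {τ ω ω₀ : ℝ} (ξ : ℝ) (hτ : τ ≤ 1 / 2)
    (h : |ω - ω₀| ≤ τ * (beta α ω₀)⁻¹) :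
    |beta α ω * (ξ - ω) - beta α ω₀ * (ξ - ω₀)| ≤ 2 * τ * (1 + |beta α ω₀ * (ξ - ω₀)|) := by
  have hb := beta_pos α ω₀
  have hsub := abs_beta_sub_le hα0 hα1 hτ h
  have hβ2 : beta α ω ≤ 2 * beta α ω₀ := by
    nlinarith [(abs_le.1 hsub).2]
  calc |beta α ω * (ξ - ω) - beta α ω₀ * (ξ - ω₀)|
      = |(beta α ω - beta α ω₀) * (ξ - ω₀) - beta α ω * (ω - ω₀)| := by ring_nf
    _ ≤ |beta α ω - beta α ω₀| * |ξ - ω₀| + beta α ω * |ω - ω₀| := by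
        refine (abs_sub _ _).trans_eq ?_
        rw [abs_mul, abs_mul, abs_of_pos (beta_pos α ω)]
    _ ≤ 2 * τ * beta α ω₀ * |ξ - ω₀| + 2 * beta α ω₀ * (τ * (beta α ω₀)⁻¹) := by gcongr
    _ = _ := by
        rw [abs_mul, abs_of_pos hb]
        field_simp
        ring

theorem exists_beta_mul_eq (hα0 : 0 ≤ α) (hα1 : α < 1) (ξ p : ℝ) :
    ∃ ω, beta α ω * (ξ - ω) = p := by
  have h1α : 0 < 1 - α := sub_pos.2 hα1
  have hξ := beta_pos α ξ
  let T := ((1 + |p|) ^ (1 - α)⁻¹ - 1) / beta α ξ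
  have hT0 : 0 ≤ T :=
    div_nonneg (sub_nonneg.2 (Real.one_le_rpow (by linarith [abs_nonneg p]) (inv_pos.2 h1α).le))
      hξ.le
  have hT {ω : ℝ} (hω : |ξ - ω| = T) : |p| ≤ beta α ω * T := by
    have h := scaledDist_swap_rpow_le hα0 hα1 ω ξ
    rw [scaledDist, hω, mul_div_cancel₀ _ hξ.ne', add_sub_cancel,
      Real.rpow_inv_rpow (by positivity) h1α.ne'] at h
    linarith
  refine mem_range_of_exists_le_of_exists_ge
    ((continuous_beta α).mul (by fun_prop) : Continuous fun ω => beta α ω * (ξ - ω))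
    ⟨ξ + T, ?_⟩ ⟨ξ - T, ?_⟩
  · have h := hT (ω := ξ + T) (by rw [sub_add_cancel_left, abs_neg, abs_of_nonneg hT0])
    rw [sub_add_cancel_left]
    linarith [neg_abs_le p]
  · have h := hT (ω := ξ - T) (by rw [sub_sub_cancel, abs_of_nonneg hT0])
    rw [sub_sub_cancel]
    exact (le_abs_self p).trans h

/-- On the ball of radius `τ β(ω₀)⁻¹` about a solution `ω₀` of `β(ω₀)(ξ - ω₀) = p` the integrand is
at least `β(ω₀) g(p) / 4`. -/
theorem exists_le_integral_beta_mul (hα0 : 0 ≤ α) (hα1 : α < 1) {g : ℝ → ℝ} (hg : Continuous g)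
    (hg0 : ∀ x, 0 ≤ g x) {p : ℝ} (hp : g p ≠ 0)
    (hi : ∀ ξ, Integrable fun ω => beta α ω * g (beta α ω * (ξ - ω))) :
    ∃ c, 0 < c ∧ ∀ ξ, c ≤ ∫ ω, beta α ω * g (beta α ω * (ξ - ω)) := by
  replace hp : 0 < g p := (hg0 p).lt_of_ne' hp
  obtain ⟨d, hd, hgd⟩ := Metric.eventually_nhds_iff.1
    ((hg.tendsto p).eventually (lt_mem_nhds (half_lt_self hp)))
  let τ := min (1 / 4) (d / (4 * (1 + |p|)))
  have hτ0 : 0 < τ := by positivity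
  have hτ4 : τ ≤ 1 / 4 := min_le_left _ _
  have hτd : 2 * τ * (1 + |p|) < d := by
    have h : τ * (4 * (1 + |p|)) ≤ d := (le_div_iff₀ (by positivity)).1 (min_le_right _ _)
    linarith
  refine ⟨g p / 2 * τ, by positivity, fun ξ => ?_⟩
  obtain ⟨ω₀, hω₀⟩ := exists_beta_mul_eq hα0 hα1 ξ p
  have hb := beta_pos α ω₀
  let I := Metric.closedBall ω₀ (τ * (beta α ω₀)⁻¹)
  have hlow : ∀ ω ∈ I, beta α ω₀ / 2 * (g p / 2) ≤ beta α ω * g (beta α ω * (ξ - ω)) := by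
    intro ω hω
    have hβ : beta α ω₀ / 2 ≤ beta α ω := by
      nlinarith [(abs_le.1 (abs_beta_sub_le hα0 hα1 (by linarith) hω)).1]
    have hdist := abs_beta_mul_sub_le hα0 hα1 ξ (by linarith) hω
    rw [hω₀] at hdist
    exact mul_le_mul hβ (hgd (hdist.trans_lt hτd)).le (by positivity) (beta_pos α ω).le
  calc g p / 2 * τ = ∫ _ in I, beta α ω₀ / 2 * (g p / 2) := by
        rw [setIntegral_const, Real.volume_real_closedBall (by positivity), smul_eq_mul]
        field_simp
    _ ≤ ∫ ω in I, beta α ω * g (beta α ω * (ξ - ω)) :=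
        setIntegral_mono_on (integrableOn_const measure_closedBall_lt_top.ne) (hi ξ).integrableOn
          measurableSet_closedBall hlow
    _ ≤ _ := setIntegral_le_integral (hi ξ) (Eventually.of_forall fun ω =>
        mul_nonneg (beta_pos α ω).le (hg0 _))

/-- The symbol `m(ξ) = ∫ β(ω) |φ(β(ω)(ξ - ω))|² dω`, for which `A_ψ` is the Fourier multiplier
with symbol `m` when `φ = ψ̂`. -/
def symbol (α : ℝ) (φ : ℝ → ℂ) (ξ : ℝ) : ℝ :=
  ∫ ω, beta α ω * ‖φ (beta α ω * (ξ - ω))‖ ^ 2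

theorem ofReal_symbol (α : ℝ) (φ : ℝ → ℂ) :
    (fun ξ => (symbol α φ ξ : ℂ)) = symbolInt α 1 (φ * fun v => starRingEnd ℂ (φ v)) := by
  ext ξ
  rw [symbol, symbolInt, ← integral_complex_ofReal]
  congr with ω
  rw [Pi.mul_apply, Complex.mul_conj, Complex.normSq_eq_norm_sq, pow_one, Complex.ofReal_mul]

variable {φ : ℝ → ℂ} {n : ℕ} {r C : ℝ}

namespace DecayBound

theorem normSq (h : DecayBound n r C φ) (hr : 0 ≤ r) :
    DecayBound n r (2 ^ n * (C * C)) (φ * fun v => starRingEnd ℂ (φ v)) :=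
  (h.mul h.conj).rpow_mono (le_add_of_nonneg_left hr)

theorem integrable_symbol_integrand (h : DecayBound 0 r C φ) (hα0 : 0 ≤ α) (hα1 : α < 1)
    (hr : 1 < (1 - α) * r) (ξ : ℝ) :
    Integrable fun ω => beta α ω * ‖φ (beta α ω * (ξ - ω))‖ ^ 2 := by
  refine (AlphaMod.integrable_symbol_integrand hα0 hα1 hr
    (h.normSq (nonneg_of_one_lt_mul hα1 hr)) 1 ξ).norm.congr (Eventually.of_forall fun ω => ?_)
  dsimp only
  rw [norm_symbol_integrand, pow_one, Pi.mul_apply, norm_mul, RCLike.norm_conj, sq]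

theorem contDiff_symbol (h : DecayBound (n + 1) r C φ) (hα0 : 0 ≤ α) (hα1 : α < 1)
    (hr : 1 < (1 - α) * r) : ContDiff ℝ n fun ξ => (symbol α φ ξ : ℂ) := by
  rw [ofReal_symbol]
  exact contDiff_symbolInt hα0 hα1 hr (h.normSq (nonneg_of_one_lt_mul hα1 hr)) 1

theorem continuous_symbol (h : DecayBound 1 r C φ) (hα0 : 0 ≤ α) (hα1 : α < 1)
    (hr : 1 < (1 - α) * r) : Continuous (symbol α φ) :=
  (Complex.continuous_re.comp (contDiff_symbol (n := 0) h hα0 hα1 hr).continuous).congr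
    fun _ => Complex.ofReal_re _

theorem exists_derivBound_symbol (h : DecayBound n r C φ) (hα0 : 0 ≤ α) (hα1 : α < 1)
    (hr : 1 < (1 - α) * (r - (n + 1) * α)) :
    ∃ M, ∀ ξ, DerivBound n (fun ξ => (symbol α φ ξ : ℂ)) (beta α ξ) M ξ := by
  have hr0 : 0 ≤ r := by
    have h1 := nonneg_of_one_lt_mul hα1 hr
    have h2 : 0 ≤ (n + 1) * α := by positivity
    linarith
  simp only [ofReal_symbol]
  exact ⟨_, derivBound_symbolInt hα0 hα1 hr (h.normSq hr0)⟩

theorem exists_symbol_lower (h : DecayBound 0 r C φ) (hα0 : 0 ≤ α) (hα1 : α < 1)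
    (hr : 1 < (1 - α) * r) (hφ : φ ≠ 0) : ∃ c, 0 < c ∧ ∀ ξ, c ≤ symbol α φ ξ := by
  obtain ⟨p, hp⟩ := Function.ne_iff.1 hφ
  exact exists_le_integral_beta_mul hα0 hα1 (g := fun v => ‖φ v‖ ^ 2)
    (h.contDiff.continuous.norm.pow 2) (fun v => sq_nonneg _)
    (pow_ne_zero 2 (norm_ne_zero_iff.2 hp)) (h.integrable_symbol_integrand hα0 hα1 hr)

end DecayBound

end Symbol

section Multiplier

variable {X : Type*} [MeasurableSpace X] {μ : Measure X} {m : X → ℂ}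

/-- Multiplication by an essentially bounded function on `L²`. -/
def mulLp (hm : MemLp m ∞ μ) : Lp ℂ 2 μ →L[ℂ] Lp ℂ 2 μ :=
  (ContinuousLinearMap.mul ℂ ℂ).holderL μ ∞ 2 2 (hm.toLp m)

theorem coeFn_mulLp (hm : MemLp m ∞ μ) (f : Lp ℂ 2 μ) : mulLp hm f =ᵐ[μ] fun x => m x * f x := by
  filter_upwards [(ContinuousLinearMap.mul ℂ ℂ).coeFn_holder (r := 2) (hm.toLp m) f,
    hm.coeFn_toLp] with x hx hmx
  rw [mulLp, ContinuousLinearMap.holderL_apply_apply, hx, hmx, ContinuousLinearMap.mul_apply']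

theorem mulLp_mulLp_inv (hm : MemLp m ∞ μ) (hm' : MemLp m⁻¹ ∞ μ) (h0 : ∀ x, m x ≠ 0)
    (f : Lp ℂ 2 μ) : mulLp hm (mulLp hm' f) = f := by
  ext1
  filter_upwards [coeFn_mulLp hm (mulLp hm' f), coeFn_mulLp hm' f] with x h h'
  rw [h, h', Pi.inv_apply, mul_inv_cancel_left₀ (h0 x)]

theorem mulLp_inv_mulLp (hm : MemLp m ∞ μ) (hm' : MemLp m⁻¹ ∞ μ) (h0 : ∀ x, m x ≠ 0)
    (f : Lp ℂ 2 μ) : mulLp hm' (mulLp hm f) = f := by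
  ext1
  filter_upwards [coeFn_mulLp hm' (mulLp hm f), coeFn_mulLp hm f] with x h h'
  rw [h, h', Pi.inv_apply, inv_mul_cancel_left₀ (h0 x)]

/-- Multiplication by an essentially bounded function with essentially bounded inverse, as an
automorphism of `L²`. -/
def mulLpEquiv (hm : MemLp m ∞ μ) (hm' : MemLp m⁻¹ ∞ μ) (h0 : ∀ x, m x ≠ 0) :
    Lp ℂ 2 μ ≃L[ℂ] Lp ℂ 2 μ :=
  ContinuousLinearEquiv.equivOfInverse (mulLp hm) (mulLp hm') (mulLp_inv_mulLp hm hm' h0)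
    (mulLp_mulLp_inv hm hm' h0)

end Multiplier

section FourierMultiplier

variable {m : ℝ → ℂ}

/-- The invertible Fourier multiplier with symbol `m`. -/
def fourierMultiplier (hm : MemLp m ∞ volume) (hm' : MemLp m⁻¹ ∞ volume) (h0 : ∀ x, m x ≠ 0) :
    L2 ≃L[ℂ] L2 :=
  ((Lp.fourierTransformₗᵢ ℝ ℂ).toContinuousLinearEquiv.trans (mulLpEquiv hm hm' h0)).trans
    (Lp.fourierTransformₗᵢ ℝ ℂ).symm.toContinuousLinearEquiv

theorem fourier_fourierMultiplier (hm : MemLp m ∞ volume) (hm' : MemLp m⁻¹ ∞ volume)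
    (h0 : ∀ x, m x ≠ 0) (f : L2) :
    (𝓕 (fourierMultiplier hm hm' h0 f) : L2) =ᵐ[volume] fun ξ => m ξ * (𝓕 f : L2) ξ := by
  rw [show 𝓕 (fourierMultiplier hm hm' h0 f) = mulLp hm (𝓕 f) from
    (Lp.fourierTransformₗᵢ ℝ ℂ).apply_symm_apply _]
  exact coeFn_mulLp hm _

theorem fourier_fourierMultiplier_symm (hm : MemLp m ∞ volume) (hm' : MemLp m⁻¹ ∞ volume)
    (h0 : ∀ x, m x ≠ 0) (f : L2) :
    (𝓕 ((fourierMultiplier hm hm' h0).symm f) : L2) =ᵐ[volume]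
      fun ξ => (m ξ)⁻¹ * (𝓕 f : L2) ξ := by
  rw [show 𝓕 ((fourierMultiplier hm hm' h0).symm f) = mulLp hm' (𝓕 f) from
    (Lp.fourierTransformₗᵢ ℝ ℂ).apply_symm_apply _]
  exact coeFn_mulLp hm' _

theorem inner_eq_integral_fourier {f h : L2} {F H : ℝ → ℂ} (hf : (𝓕 f : L2) =ᵐ[volume] F)
    (hh : (𝓕 h : L2) =ᵐ[volume] H) : inner ℂ h f = ∫ ξ, F ξ * starRingEnd ℂ (H ξ) := by
  rw [← Lp.inner_fourier_eq, L2.inner_def]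
  refine integral_congr_ae ?_
  filter_upwards [hf, hh] with ξ hfξ hhξ
  rw [hfξ, hhξ, RCLike.inner_apply]

end FourierMultiplier

theorem integrable_mul_comp_snd {X Y : Type*} [MeasurableSpace X] [MeasurableSpace Y]
    {μ : Measure X} {ν : Measure Y} [SFinite μ] [SFinite ν] {k : X × Y → ℝ} {g : Y → ℂ} {M : ℝ}
    (hk : Measurable k) (hk0 : 0 ≤ k) (hki : ∀ y, Integrable (fun x => k (x, y)) μ)
    (hkM : ∀ y, ∫ x, k (x, y) ∂μ ≤ M) (hg : Integrable g ν) :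
    Integrable (fun p => (k p : ℂ) * g p.2) (μ.prod ν) := by
  have hms : AEStronglyMeasurable (fun p => (k p : ℂ) * g p.2) (μ.prod ν) :=
    (Complex.measurable_ofReal.comp hk).aestronglyMeasurable.mul hg.aestronglyMeasurable.comp_snd
  refine (integrable_prod_iff' hms).2
    ⟨Eventually.of_forall fun y => (hki y).ofReal.mul_const (g y), ?_⟩
  refine (hg.norm.const_mul M).mono' hms.norm.prod_swap.integral_prod_right'
    (Eventually.of_forall fun y => ?_)
  simp only [norm_mul, Complex.norm_real, Real.norm_of_nonneg (hk0 _), integral_mul_const]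
  rw [norm_norm, Real.norm_of_nonneg (integral_nonneg fun x => hk0 (x, y))]
  exact mul_le_mul_of_nonneg_right (hkM y) (norm_nonneg _)

/-- For fixed `ω`, the function whose inverse Fourier transform is `x ↦ ⟨f, ψ_{(x, ω)}⟩`, when
`φ` is the Fourier transform of `ψ`. -/
def freqSlice (α : ℝ) (φ : ℝ → ℂ) (f : L2) (ω ξ : ℝ) : ℂ :=
  (𝓕 f : L2) ξ * starRingEnd ℂ (windowHat α φ ω ξ)

theorem continuous_uncurry_atomHat (α : ℝ) {φ : ℝ → ℂ} (hφ : Continuous φ) :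
    Continuous fun p : (ℝ × ℝ) × ℝ => atomHat α φ p.1 p.2 := by
  have hβ := continuous_beta α
  simp only [atomHat, modulate, windowHat_apply]
  fun_prop

theorem windowHat_mul_conj (α : ℝ) (φ : ℝ → ℂ) (ω ξ : ℝ) :
    windowHat α φ ω ξ * starRingEnd ℂ (windowHat α φ ω ξ) =
      ((beta α ω * ‖φ (beta α ω * (ξ - ω))‖ ^ 2 : ℝ) : ℂ) := by
  rw [Complex.mul_conj, Complex.normSq_eq_norm_sq, norm_windowHat, mul_pow,
    Real.sq_sqrt (beta_pos α ω).le]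

theorem freqSlice_mul_conj (α : ℝ) (φ : ℝ → ℂ) (f h : L2) (ω ξ : ℝ) :
    freqSlice α φ f ω ξ * starRingEnd ℂ (freqSlice α φ h ω ξ) =
      ((beta α ω * ‖φ (beta α ω * (ξ - ω))‖ ^ 2 : ℝ) : ℂ) *
        ((𝓕 f : L2) ξ * starRingEnd ℂ ((𝓕 h : L2) ξ)) := by
  rw [← windowHat_mul_conj, freqSlice, freqSlice, map_mul, Complex.conj_conj]
  ring

theorem integrable_fourier_mul_conj (f h : L2) :
    Integrable fun ξ => (𝓕 f : L2) ξ * starRingEnd ℂ ((𝓕 h : L2) ξ) := by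
  simpa only [RCLike.inner_apply] using L2.integrable_inner (𝕜 := ℂ) (𝓕 h : L2) (𝓕 f : L2)

namespace DecayBound

variable {α r C : ℝ} {φ : ℝ → ℂ} {ψ : L2}

theorem inner_atom (h : DecayBound 0 r C φ) (hr : 1 < r) (hψ : (𝓕 ψ : L2) =ᵐ[volume] φ)
    (f : L2) (z : ℝ × ℝ) :
    inner ℂ (atom α ψ z) f = ∫ ξ, (𝓕 f : L2) ξ * starRingEnd ℂ (atomHat α φ z ξ) :=
  inner_eq_integral_fourier EventuallyEq.rfl
    (fourier_atom α hψ (h.integrable hr) (h.memLp hr) z)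

theorem inner_atom_eq_fourierInv (h : DecayBound 0 r C φ) (hr : 1 < r)
    (hψ : (𝓕 ψ : L2) =ᵐ[volume] φ) (f : L2) (z : ℝ × ℝ) :
    inner ℂ (atom α ψ z) f = 𝓕⁻ (freqSlice α φ f z.2) z.1 := by
  rw [h.inner_atom hr hψ, Real.fourierInv_eq']
  congr with ξ
  have hexp : starRingEnd ℂ (Complex.exp (2 * Real.pi * Complex.I * ↑(-z.1) * ξ)) =
      Complex.exp (↑(2 * Real.pi * inner ℝ ξ z.1) * Complex.I) := by
    rw [← Complex.exp_conj, real_inner_eq_re_inner, RCLike.inner_apply, RCLike.conj_to_real]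
    simp only [map_mul, Complex.conj_ofReal, Complex.conj_I, map_ofNat, RCLike.re_to_real]
    push_cast
    ring_nf
  rw [atomHat, modulate, freqSlice, map_mul, hexp, smul_eq_mul]
  ring

theorem stronglyMeasurable_inner_atom (h : DecayBound 0 r C φ) (hr : 1 < r)
    (hψ : (𝓕 ψ : L2) =ᵐ[volume] φ) (f : L2) :
    StronglyMeasurable fun z => inner ℂ (atom α ψ z) f := by
  simp only [h.inner_atom hr hψ]
  have hf : StronglyMeasurable fun p : (ℝ × ℝ) × ℝ => (𝓕 f : L2) p.2 :=
    (Lp.stronglyMeasurable (𝓕 f : L2)).comp_measurable measurable_snd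
  exact (hf.mul (Complex.continuous_conj.comp (continuous_uncurry_atomHat α
    h.contDiff.continuous)).stronglyMeasurable).integral_prod_right

theorem memLp_freqSlice (h : DecayBound 0 r C φ) (hr : 0 ≤ r) (f : L2) (ω : ℝ) :
    MemLp (freqSlice α φ f ω) 2 volume := by
  have hφ := h.contDiff.continuous
  have hwin : Continuous (windowHat α φ ω) := by
    simp only [funext (windowHat_apply α φ ω)]
    fun_prop
  refine (Lp.memLp (𝓕 f : L2)).of_le_mul (c := Real.sqrt (beta α ω) * C)
    ((Lp.aestronglyMeasurable _).mul
      (Complex.continuous_conj.comp hwin).aestronglyMeasurable)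
    (Eventually.of_forall fun ξ => ?_)
  rw [freqSlice, norm_mul, RCLike.norm_conj, norm_windowHat, mul_comm]
  gcongr
  exact h.norm_le hr _

theorem integrable_freqSlice (h : DecayBound 0 r C φ) (hr : 1 < r) (f : L2) (ω : ℝ) :
    Integrable (freqSlice α φ f ω) :=
  MemLp.integrable_mul (Lp.memLp (𝓕 f : L2)) (memLp_windowHat α (h.memLp hr) ω).star

theorem integral_inner_atom_mul (h : DecayBound 0 r C φ) (hr : 1 < r)
    (hψ : (𝓕 ψ : L2) =ᵐ[volume] φ) (f g : L2) (ω : ℝ) :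
    Integrable (fun x => inner ℂ (atom α ψ (x, ω)) f * inner ℂ g (atom α ψ (x, ω))) ∧
    ∫ x, inner ℂ (atom α ψ (x, ω)) f * inner ℂ g (atom α ψ (x, ω)) =
      ∫ ξ, freqSlice α φ f ω ξ * starRingEnd ℂ (freqSlice α φ g ω ξ) := by
  have hmem (f : L2) := h.memLp_freqSlice (α := α) (one_pos.trans hr).le f ω
  let F (f : L2) : L2 := (hmem f).toLp _
  have hF (f : L2) : (𝓕⁻ (F f) : L2) =ᵐ[volume] fun x => inner ℂ (atom α ψ (x, ω)) f :=
    (fourierInv_toLp_ae_eq (h.integrable_freqSlice hr f ω) (hmem f)).trans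
      (Eventually.of_forall fun x => (h.inner_atom_eq_fourierInv hr hψ f (x, ω)).symm)
  have hprod : (fun x => inner ℂ ((𝓕⁻ (F g) : L2) x) ((𝓕⁻ (F f) : L2) x)) =ᵐ[volume]
      fun x => inner ℂ (atom α ψ (x, ω)) f * inner ℂ g (atom α ψ (x, ω)) := by
    filter_upwards [hF f, hF g] with x hfx hgx
    rw [RCLike.inner_apply, hfx, hgx, inner_conj_symm]
  refine ⟨(L2.integrable_inner (𝕜 := ℂ) (𝓕⁻ (F g) : L2) (𝓕⁻ (F f))).congr hprod, ?_⟩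
  rw [← integral_congr_ae hprod, ← L2.inner_def]
  refine inner_eq_integral_fourier ?_ ?_
  · rw [FourierTransform.fourier_fourierInv_eq]
    exact (hmem f).coeFn_toLp
  · rw [FourierTransform.fourier_fourierInv_eq]
    exact (hmem g).coeFn_toLp

theorem integrable_freqSlice_mul_conj (h : DecayBound 0 r C φ) (hα0 : 0 ≤ α) (hα1 : α < 1)
    (hr : 1 < (1 - α) * r) {M : ℝ} (hM : ∀ ξ, symbol α φ ξ ≤ M) (f g : L2) :
    Integrable (fun p : ℝ × ℝ => freqSlice α φ f p.1 p.2 *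
      starRingEnd ℂ (freqSlice α φ g p.1 p.2)) (volume.prod volume) := by
  simp only [freqSlice_mul_conj]
  have hβ := continuous_beta α
  have hφ := h.contDiff.continuous
  exact integrable_mul_comp_snd
    (k := fun p => beta α p.1 * ‖φ (beta α p.1 * (p.2 - p.1))‖ ^ 2)
    (Continuous.measurable (by fun_prop))
    (fun p => mul_nonneg (beta_pos α p.1).le (sq_nonneg _))
    (h.integrable_symbol_integrand hα0 hα1 hr) hM (integrable_fourier_mul_conj f g)

theorem memLp_inner_atom (h : DecayBound 0 r C φ) (hα0 : 0 ≤ α) (hα1 : α < 1) (hr1 : 1 < r)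
    (hr : 1 < (1 - α) * r) (hψ : (𝓕 ψ : L2) =ᵐ[volume] φ) {M : ℝ} (hM : ∀ ξ, symbol α φ ξ ≤ M)
    (f : L2) : MemLp (fun z => inner ℂ (atom α ψ z) f) 2 (volume : Measure (ℝ × ℝ)) := by
  have hm := h.stronglyMeasurable_inner_atom (α := α) hr1 hψ f
  have hsq (z : ℝ × ℝ) : ‖inner ℂ (atom α ψ z) f‖ ^ 2 =
      RCLike.re (inner ℂ (atom α ψ z) f * inner ℂ f (atom α ψ z)) := by
    rw [← inner_conj_symm f, RCLike.mul_conj, ← RCLike.ofReal_pow, RCLike.ofReal_re]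
  have hslice (ω : ℝ) : ∫ x, ‖‖inner ℂ (atom α ψ (x, ω)) f‖ ^ 2‖ =
      RCLike.re (∫ ξ, freqSlice α φ f ω ξ * starRingEnd ℂ (freqSlice α φ f ω ξ)) := by
    obtain ⟨hint, heq⟩ := h.integral_inner_atom_mul (α := α) hr1 hψ f f ω
    rw [← heq, ← integral_re hint]
    exact integral_congr_ae (Eventually.of_forall fun x =>
      (Real.norm_of_nonneg (sq_nonneg _)).trans (hsq (x, ω)))
  have hms : AEStronglyMeasurable (fun z : ℝ × ℝ => ‖inner ℂ (atom α ψ z) f‖ ^ 2)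
      (volume.prod volume) := (hm.norm.pow 2).aestronglyMeasurable
  rw [memLp_two_iff_integrable_sq_norm hm.aestronglyMeasurable, Measure.volume_eq_prod,
    integrable_prod_iff' hms]
  constructor
  · simp only [hsq]
    exact Eventually.of_forall fun ω => (h.integral_inner_atom_mul (α := α) hr1 hψ f f ω).1.re
  · simp only [hslice]
    exact (h.integrable_freqSlice_mul_conj hα0 hα1 hr hM f f).integral_prod_left.re

theorem isFrameOperator_fourierMultiplier (h : DecayBound 0 r C φ) (hα0 : 0 ≤ α) (hα1 : α < 1)
    (hr1 : 1 < r) (hr : 1 < (1 - α) * r) (hψ : (𝓕 ψ : L2) =ᵐ[volume] φ) {M : ℝ}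
    (hM : ∀ ξ, symbol α φ ξ ≤ M) (hm : MemLp (fun ξ => (symbol α φ ξ : ℂ)) ∞ volume)
    (hm' : MemLp (fun ξ => (symbol α φ ξ : ℂ))⁻¹ ∞ volume) (h0 : ∀ ξ, (symbol α φ ξ : ℂ) ≠ 0) :
    IsFrameOperator α ψ (fourierMultiplier hm hm' h0) := by
  intro f g
  have hint : Integrable fun z : ℝ × ℝ => inner ℂ (atom α ψ z) f * inner ℂ g (atom α ψ z) := by
    refine (MemLp.integrable_mul (h.memLp_inner_atom hα0 hα1 hr1 hr hψ hM f)
      (h.memLp_inner_atom hα0 hα1 hr1 hr hψ hM g).star).congr (Eventually.of_forall fun z => ?_)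
    simp only [Pi.mul_apply, Pi.star_apply, RCLike.star_def, inner_conj_symm]
  refine ⟨hint, ?_⟩
  rw [inner_eq_integral_fourier (fourier_fourierMultiplier hm hm' h0 f) EventuallyEq.rfl,
    Measure.volume_eq_prod, integral_prod_symm _ hint]
  simp only [(h.integral_inner_atom_mul (α := α) hr1 hψ f g _).2]
  rw [integral_integral_swap (h.integrable_freqSlice_mul_conj hα0 hα1 hr hM f g)]
  congr with ξ
  simp only [freqSlice_mul_conj]
  rw [integral_mul_const, integral_complex_ofReal, ← symbol, mul_assoc]

theorem exists_frameOperator (h : DecayBound 1 r C φ) (hα0 : 0 ≤ α) (hα1 : α < 1) (hr1 : 1 < r)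
    (hr : 1 < (1 - α) * (r - α)) (hψ : (𝓕 ψ : L2) =ᵐ[volume] φ) (hφ : φ ≠ 0) :
    ∃ A : L2 ≃L[ℂ] L2, IsFrameOperator α ψ A ∧
      ∀ f, (𝓕 (A.symm f) : L2) =ᵐ[volume] fun ξ => (symbol α φ ξ : ℂ)⁻¹ * (𝓕 f : L2) ξ := by
  have h0 : DecayBound 0 r C φ := h.of_le zero_le_one
  have hr' : 1 < (1 - α) * r := by nlinarith
  obtain ⟨M, hM⟩ := h0.exists_derivBound_symbol hα0 hα1 (by simpa using hr)
  obtain ⟨c, hc, hcm⟩ := h0.exists_symbol_lower hα0 hα1 hr' hφ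
  have hsym0 (ξ : ℝ) : (symbol α φ ξ : ℂ) ≠ 0 :=
    Complex.ofReal_ne_zero.2 (hc.trans_le (hcm ξ)).ne'
  have hcont : Continuous fun ξ => (symbol α φ ξ : ℂ) :=
    Complex.continuous_ofReal.comp (h.continuous_symbol hα0 hα1 hr')
  have hm : MemLp (fun ξ => (symbol α φ ξ : ℂ)) ∞ volume :=
    memLp_top_of_bound hcont.aestronglyMeasurable M (Eventually.of_forall fun ξ => (hM ξ).norm_le)
  have hm' : MemLp (fun ξ => (symbol α φ ξ : ℂ))⁻¹ ∞ volume := by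
    refine memLp_top_of_bound (hcont.inv₀ hsym0).aestronglyMeasurable c⁻¹
      (Eventually.of_forall fun ξ => ?_)
    rw [Pi.inv_apply, norm_inv, Complex.norm_real]
    exact inv_anti₀ hc ((hcm ξ).trans (le_abs_self _))
  have hle (ξ : ℝ) : symbol α φ ξ ≤ M := (le_abs_self _).trans <| by
    simpa only [Complex.norm_real, Real.norm_eq_abs] using (hM ξ).norm_le
  exact ⟨fourierMultiplier hm hm' hsym0, h0.isFrameOperator_fourierMultiplier hα0 hα1 hr1 hr' hψ
    hle hm hm' hsym0, fourier_fourierMultiplier_symm hm hm' hsym0⟩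

end DecayBound

/-- The phase `Γ(y, z) = e^{2πi(y₁ - z₁)y₂}`, which compensates the change of the modulation between
the atoms at `y` and at `z`. -/
def phase (y z : ℝ × ℝ) : ℂ := Complex.exp ((2 * Real.pi * (y.1 - z.1) * y.2 : ℝ) * Complex.I)

theorem norm_phase (y z : ℝ × ℝ) : ‖phase y z‖ = 1 := Complex.norm_exp_ofReal_mul_I _

theorem continuous_phase : Continuous (Function.uncurry phase) := by
  unfold Function.uncurry phase
  fun_prop

/-- At distance `e` between `y` and `z`, measured in units of `β` at `y`, the kernel changes by at
most `L e` times the majorant, once `Γ` has compensated the change of the modulation. -/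
def HasOscBound (α p L : ℝ) (R Γ : ℝ × ℝ → ℝ × ℝ → ℂ) : Prop :=
  ∀ (e : ℝ) (x y z : ℝ × ℝ), e ≤ 1 / 8 → |beta α z.2 / beta α y.2 - 1| ≤ e →
    |(y.1 - z.1) / beta α y.2| ≤ e → |beta α y.2 * (z.2 - y.2)| ≤ e → ∀ l, 0 < l →
      ‖R x y - Γ y z * R x z‖ₑ ≤ ENNReal.ofReal (L * e) * majorant α p l x y

theorem conj_phase_mul_modulate (y z : ℝ × ℝ) (f : ℝ → ℂ) (ξ : ℝ) :
    starRingEnd ℂ (phase y z) * modulate (-z.1) f ξ =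
      modulate (-y.1) (fun ξ => modulate (y.1 - z.1) 1 (ξ - y.2) * f ξ) ξ := by
  simp only [phase, modulate, Pi.one_apply, mul_one, ← Complex.exp_conj, ← mul_assoc,
    ← Complex.exp_add, map_mul, Complex.conj_ofReal, Complex.conj_I]
  congr 2
  push_cast
  ring

theorem windowHat_windowDefect (α : ℝ) (φ : ℝ → ℂ) (ω η t ξ : ℝ) :
    windowHat α (windowDefect φ (beta α η / beta α ω) (t / beta α ω) (beta α ω * (η - ω))) ω ξ =
      windowHat α φ ω ξ - modulate t 1 (ξ - ω) * windowHat α φ η ξ := by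
  have hω := beta_pos α ω
  have harg : beta α η / beta α ω * (beta α ω * (ξ - ω) - beta α ω * (η - ω)) =
      beta α η * (ξ - η) := by field_simp; ring
  have hsqrt : Real.sqrt (beta α η) =
      Real.sqrt (beta α ω) * Real.sqrt (beta α η / beta α ω) := by
    rw [← Real.sqrt_mul hω.le, mul_div_cancel₀ _ hω.ne']
  have hmod : 2 * Real.pi * Complex.I * ↑(t / beta α ω) * ↑(beta α ω * (ξ - ω)) =
      2 * Real.pi * Complex.I * t * ↑(ξ - ω) := by
    have : (beta α ω : ℂ) ≠ 0 := Complex.ofReal_ne_zero.2 hω.ne'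
    push_cast
    field_simp
  simp only [windowHat_apply, windowDefect, translate_dilate_inv_eq, Pi.sub_apply, modulate,
    harg, hmod, hsqrt, Pi.one_apply]
  push_cast
  ring

theorem atomHat_windowDefect (α : ℝ) (φ : ℝ → ℂ) (y z : ℝ × ℝ) (ξ : ℝ) :
    atomHat α (windowDefect φ (beta α z.2 / beta α y.2) ((y.1 - z.1) / beta α y.2)
      (beta α y.2 * (z.2 - y.2))) y ξ =
      atomHat α φ y ξ - starRingEnd ℂ (phase y z) * atomHat α φ z ξ := by
  rw [atomHat, atomHat, atomHat, conj_phase_mul_modulate]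
  simp only [modulate, windowHat_windowDefect]
  ring

/-- The matrix coefficients, with respect to atoms with the windows `φ` and `θ` in frequency, of the
Fourier multiplier with symbol `m`. -/
def multiplierKernel (α : ℝ) (m φ θ : ℝ → ℂ) (x y : ℝ × ℝ) : ℂ :=
  ∫ ξ, m ξ * (atomHat α φ x ξ * starRingEnd ℂ (atomHat α θ y ξ))

theorem multiplierKernel_eq_fourier (α : ℝ) (m φ θ : ℝ → ℂ) (x y : ℝ × ℝ) :
    multiplierKernel α m φ θ x y =
      𝓕 (m * (windowHat α φ x.2 * fun ξ => starRingEnd ℂ (windowHat α θ y.2 ξ))) (x.1 - y.1) := by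
  rw [multiplierKernel, Real.fourier_eq']
  congr with ξ
  have hexp : Complex.exp (↑(-2 * Real.pi * inner ℝ ξ (x.1 - y.1)) * Complex.I) =
      Complex.exp (2 * Real.pi * Complex.I * ↑(-x.1) * ξ) *
        starRingEnd ℂ (Complex.exp (2 * Real.pi * Complex.I * ↑(-y.1) * ξ)) := by
    rw [← Complex.exp_conj, ← Complex.exp_add, real_inner_eq_re_inner, RCLike.inner_apply,
      RCLike.conj_to_real]
    simp only [map_mul, Complex.conj_ofReal, Complex.conj_I, map_ofNat, RCLike.re_to_real]
    push_cast
    ring_nf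
  simp only [atomHat, modulate, map_mul, hexp, Pi.mul_apply, smul_eq_mul]
  ring

namespace DecayBound

variable {α p r C C' K c : ℝ} {φ θ m : ℝ → ℂ} {ψ : L2}

theorem derivBound_windowHat {n : ℕ} (h : DecayBound n r C φ) (ω ξ : ℝ) :
    DerivBound n (windowHat α φ ω) (beta α ω)
      (Real.sqrt (beta α ω) * (C * scaledDist α ω ξ ^ (-r))) ξ := by
  rw [scaledDist_eq_abs]
  exact DerivBound.translate_dilate_inv h.contDiff (beta_pos α ω).le (h.derivBound _)

theorem enorm_multiplierKernel_le (h : DecayBound 2 p C φ) (h' : DecayBound 2 p C' θ)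
    (hα0 : 0 ≤ α) (hp : 1 < p) (hm : ContDiff ℝ 2 m) (hmK : ∀ ξ, DerivBound 2 m (beta α ξ) K ξ)
    (x y : ℝ × ℝ) {l : ℝ} (hl : 0 < l) :
    ‖multiplierKernel α m φ θ x y‖ₑ ≤ ENNReal.ofReal (16 * K * C * C') * majorant α p l x y := by
  have hω := beta_pos α x.2
  have hη := beta_pos α y.2
  have hwin {C : ℝ} {φ : ℝ → ℂ} (h : DecayBound 2 p C φ) (ω : ℝ) :
      ContDiff ℝ 2 (windowHat α φ ω) := contDiff_translate_dilate_inv (n := 2) _ _ h.contDiff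
  have hconj : ContDiff ℝ 2 fun ξ => starRingEnd ℂ (windowHat α θ y.2 ξ) :=
    Complex.conjLIE.contDiff.comp (hwin h' y.2)
  rw [multiplierKernel_eq_fourier]
  refine enorm_fourier_le_majorant hα0 hp (hm.mul ((hwin h x.2).mul hconj)) (fun ξ => ?_) hl
  have hξ := beta_pos α ξ
  have hL : 0 ≤ beta α x.2 + beta α y.2 + beta α ξ := by positivity
  convert ((hmK ξ).mono hξ.le (by linarith) le_rfl).mul hm ((hwin h x.2).mul hconj) hL
    (((h.derivBound_windowHat x.2 ξ).mono hω.le (by linarith) le_rfl).mul (hwin h x.2) hconj hL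
      ((h'.derivBound_windowHat y.2 ξ).conj.mono hη.le (by linarith) le_rfl)) using 1
  · rfl
  · unfold crossBound
    ring

theorem integrable_multiplierKernel_integrand (h : DecayBound 0 r C φ) (h' : DecayBound 0 r C' θ)
    (hr : 1 < r) (hm : Continuous m) (hmK : ∀ ξ, ‖m ξ‖ ≤ K) (x y : ℝ × ℝ) :
    Integrable fun ξ => m ξ * (atomHat α φ x ξ * starRingEnd ℂ (atomHat α θ y ξ)) :=
  (MemLp.integrable_mul (memLp_atomHat α (h.memLp hr) x)
    (memLp_atomHat α (h'.memLp hr) y).star).bdd_mul hm.aestronglyMeasurable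
    (Eventually.of_forall hmK)

theorem multiplierKernel_sub_phase_mul (h : DecayBound 0 r C φ) (hr : 1 < r) (hm : Continuous m)
    (hmK : ∀ ξ, ‖m ξ‖ ≤ K) (x y z : ℝ × ℝ) :
    multiplierKernel α m φ φ x y - phase y z * multiplierKernel α m φ φ x z =
      multiplierKernel α m φ (windowDefect φ (beta α z.2 / beta α y.2)
        ((y.1 - z.1) / beta α y.2) (beta α y.2 * (z.2 - y.2))) x y := by
  have hint (y) := h.integrable_multiplierKernel_integrand (α := α) h hr hm hmK x y
  simp only [multiplierKernel]
  rw [← integral_const_mul, ← integral_sub (hint y) ((hint z).const_mul _)]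
  congr with ξ
  rw [atomHat_windowDefect, map_sub, map_mul, Complex.conj_conj]
  ring

theorem norm_atomHat_le (h : DecayBound 0 r C φ) (hα0 : 0 ≤ α) (z : ℝ × ℝ) (ξ : ℝ) :
    ‖atomHat α φ z ξ‖ ≤ C * scaledDist α z.2 ξ ^ (-r) := by
  rw [norm_atomHat, norm_windowHat, scaledDist_eq_abs]
  exact (mul_le_of_le_one_left (norm_nonneg _) (Real.sqrt_le_one.2 (beta_le_one hα0 z.2))).trans
    (h.norm_apply_le _)

theorem norm_atomHat_le_of_abs_le (h : DecayBound 0 r C φ) (hα0 : 0 ≤ α) (hα1 : α < 1)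
    (hr : 0 ≤ r) {z : ℝ × ℝ} {R : ℝ} (hz : |z.2| ≤ R) (ξ : ℝ) :
    ‖atomHat α φ z ξ‖ ≤ C * ((1 + R) ^ r * (1 + |ξ|) ^ (-r)) := by
  have hC := h.const_nonneg
  have hR : 0 < 1 + R := by linarith [abs_nonneg z.2]
  have hdist : (1 + |ξ|) / (1 + R) ≤ scaledDist α z.2 ξ := by
    rw [div_le_iff₀' hR]
    have := scaledDist_pos α z.2 ξ
    exact (one_add_abs_le_mul_scaledDist hα1 z.2 ξ).trans (by gcongr)
  refine (h.norm_atomHat_le hα0 z ξ).trans ?_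
  gcongr
  calc scaledDist α z.2 ξ ^ (-r) ≤ ((1 + |ξ|) / (1 + R)) ^ (-r) :=
        Real.rpow_le_rpow_of_nonpos (by positivity) hdist (by linarith)
    _ = _ := by
        rw [Real.div_rpow (by positivity) hR.le, Real.rpow_neg hR.le]
        field_simp

theorem continuous_multiplierKernel (h : DecayBound 0 r C φ) (h' : DecayBound 0 r C' θ)
    (hα0 : 0 ≤ α) (hα1 : α < 1) (hr : 1 < r) (hm : Continuous m) (hmK : ∀ ξ, ‖m ξ‖ ≤ K) :
    Continuous (Function.uncurry (multiplierKernel α m φ θ)) := by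
  have hK : 0 ≤ K := (norm_nonneg _).trans (hmK 0)
  have hC := h.const_nonneg
  have hr0 : 0 ≤ r := by linarith
  have hcont {φ : ℝ → ℂ} (hφ : Continuous φ) (ξ : ℝ) : Continuous fun z => atomHat α φ z ξ :=
    (continuous_uncurry_atomHat α hφ).comp (by fun_prop : Continuous fun z => (z, ξ))
  have huncurry : Function.uncurry (multiplierKernel α m φ θ) = fun q => ∫ ξ,
      m ξ * (atomHat α φ q.1 ξ * starRingEnd ℂ (atomHat α θ q.2 ξ)) := rfl
  rw [huncurry, continuous_iff_continuousAt]
  rintro ⟨x₀, y₀⟩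
  have hnear : ∀ᶠ q : (ℝ × ℝ) × (ℝ × ℝ) in 𝓝 (x₀, y₀), |q.2.2| < 1 + |y₀.2| :=
    ContinuousAt.eventually_lt (by fun_prop) continuousAt_const (by simp)
  have hbound : Integrable fun ξ : ℝ =>
      K * (C * (C' * ((1 + (1 + |y₀.2|)) ^ r * (1 + |ξ|) ^ (-r)))) :=
    ((((integrable_bracket hr).const_mul _).const_mul _).const_mul _).const_mul _
  refine continuousAt_of_dominated (Eventually.of_forall fun q =>
    (h.integrable_multiplierKernel_integrand h' hr hm hmK q.1 q.2).aestronglyMeasurable)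
    (hnear.mono fun q hq => Eventually.of_forall fun ξ => ?_) hbound
    (Eventually.of_forall fun ξ => Continuous.continuousAt ?_)
  · rw [norm_mul, norm_mul, RCLike.norm_conj]
    gcongr
    · exact hmK ξ
    · refine (h.norm_atomHat_le hα0 q.1 ξ).trans (mul_le_of_le_one_right hC ?_)
      exact Real.rpow_le_one_of_one_le_of_nonpos (one_le_scaledDist α _ ξ) (by linarith)
    · exact h'.norm_atomHat_le_of_abs_le hα0 hα1 hr0 hq.le ξ
  · exact continuous_const.mul (((hcont h.contDiff.continuous ξ).comp continuous_fst).mul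
      (Complex.continuous_conj.comp ((hcont h'.contDiff.continuous ξ).comp continuous_snd)))

theorem contDiff_inv_symbol {n : ℕ} (h : DecayBound (n + 1) r C φ) (hα0 : 0 ≤ α) (hα1 : α < 1)
    (hr : 1 < (1 - α) * r) (hφ : φ ≠ 0) :
    ContDiff ℝ n (fun ξ => (symbol α φ ξ : ℂ))⁻¹ := by
  obtain ⟨c, hc, hcm⟩ := (h.of_le (Nat.zero_le _)).exists_symbol_lower hα0 hα1 hr hφ
  exact (h.contDiff_symbol hα0 hα1 hr).inv fun ξ =>
    Complex.ofReal_ne_zero.2 (hc.trans_le (hcm ξ)).ne'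

theorem exists_derivBound_inv_symbol {n : ℕ} (h : DecayBound (n + 1) r C φ) (hα0 : 0 ≤ α)
    (hα1 : α < 1) (hr : 1 < (1 - α) * (r - (n + 1) * α)) (hφ : φ ≠ 0) :
    ∃ K, ∀ ξ, DerivBound n (fun ξ => (symbol α φ ξ : ℂ))⁻¹ (beta α ξ) K ξ := by
  have hr' : 1 < (1 - α) * r := hr.trans_le
    (mul_le_mul_of_nonneg_left (sub_le_self _ (by positivity)) (by linarith))
  obtain ⟨c, hc, hcm⟩ := (h.of_le (Nat.zero_le _)).exists_symbol_lower hα0 hα1 hr' hφ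
  obtain ⟨M, hM⟩ := (h.of_le n.le_succ).exists_derivBound_symbol hα0 hα1 hr
  obtain ⟨K, hK⟩ := DerivBound.exists_inv n hc M
  refine ⟨K, fun ξ => hK _ _ _ (h.contDiff_symbol hα0 hα1 hr')
    (fun ξ => Complex.ofReal_ne_zero.2 (hc.trans_le (hcm ξ)).ne') (beta_pos α ξ).le ?_ (hM ξ)⟩
  rw [Complex.norm_real]
  exact (hcm ξ).trans (le_abs_self _)

theorem exists_hasOscBound_multiplierKernel (h : DecayBound 3 r C φ) (hα0 : 0 ≤ α) (hr : 2 < r)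
    (hm : ContDiff ℝ 2 m) (hmK : ∀ ξ, DerivBound 2 m (beta α ξ) K ξ) :
    ∃ L, HasOscBound α (r - 1) L (multiplierKernel α m φ φ) phase := by
  obtain ⟨D, hD⟩ := exists_windowDefect 2 (r := r) (by linarith)
  refine ⟨16 * K * C * (D * C), fun e x y z he hk hδ hμ l hl => ?_⟩
  have h2 : DecayBound 2 (r - 1) C φ := (h.of_le (by lia)).rpow_mono (by linarith)
  rw [(h.of_le (Nat.zero_le _)).multiplierKernel_sub_phase_mul (by linarith) hm.continuous
    (fun ξ => (hmK ξ).norm_le) x y z, mul_assoc, mul_assoc, ← mul_assoc (16 * K)]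
  exact h2.enorm_multiplierKernel_le (hD C e _ _ _ φ h he hk hδ hμ) hα0 (by linarith) hm hmK x y hl

theorem exists_frameOperator_kernelR_eq (h : DecayBound 1 r C φ) (hα0 : 0 ≤ α) (hα1 : α < 1)
    (hr1 : 1 < r) (hr : 1 < (1 - α) * (r - α)) (hψ : (𝓕 ψ : L2) =ᵐ[volume] φ) (hφ : φ ≠ 0) :
    ∃ A : L2 ≃L[ℂ] L2, IsFrameOperator α ψ A ∧
      kernelR α ψ A = multiplierKernel α (fun ξ => (symbol α φ ξ : ℂ))⁻¹ φ φ := by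
  obtain ⟨A, hA, hinv⟩ := h.exists_frameOperator hα0 hα1 hr1 hr hψ hφ
  refine ⟨A, hA, funext₂ fun x y => ?_⟩
  have hatom := fourier_atom α hψ (h.integrable hr1) (h.memLp hr1)
  have hsymm : (𝓕 (A.symm (atom α ψ x)) : L2) =ᵐ[volume]
      fun ξ => (symbol α φ ξ : ℂ)⁻¹ * atomHat α φ x ξ := by
    filter_upwards [hinv (atom α ψ x), hatom x] with ξ h1 h2
    rw [h1, h2]
  rw [kernelR, inner_eq_integral_fourier hsymm (hatom y)]
  simp only [multiplierKernel, Pi.inv_apply, mul_assoc]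

theorem exists_kernel_bounds (h : DecayBound 3 r C φ) (hα0 : 0 ≤ α) (hα1 : α < 1) (hr2 : 2 < r)
    (hr : 1 < (1 - α) * (r - 3 * α)) (hψ : (𝓕 ψ : L2) =ᵐ[volume] φ) (hφ : φ ≠ 0) :
    ∃ A : L2 ≃L[ℂ] L2, IsFrameOperator α ψ A ∧ Continuous (Function.uncurry (kernelR α ψ A)) ∧
      (∃ L, IsMajorized α (r - 1) L fun x y => ‖kernelR α ψ A x y‖ₑ) ∧
      ∃ L, HasOscBound α (r - 1) L (kernelR α ψ A) phase := by
  have h0 : DecayBound 0 r C φ := h.of_le (Nat.zero_le _)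
  have h2 : DecayBound 2 (r - 1) C φ := (h.of_le (by lia)).rpow_mono (by linarith)
  obtain ⟨A, hA, hker⟩ := (h.of_le (by lia)).exists_frameOperator_kernelR_eq hα0 hα1 (by linarith)
    (by nlinarith : 1 < (1 - α) * (r - α)) hψ hφ
  have hm := h.contDiff_inv_symbol (n := 2) hα0 hα1 (by nlinarith) hφ
  obtain ⟨K, hK⟩ := h.exists_derivBound_inv_symbol (n := 2) hα0 hα1 (by norm_num; linarith) hφ
  refine ⟨A, hA, ?_⟩
  rw [hker]
  exact ⟨h0.continuous_multiplierKernel h0 hα0 hα1 (by linarith) hm.continuous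
      fun ξ => (hK ξ).norm_le,
    ⟨_, fun x y l hl => h2.enorm_multiplierKernel_le h2 hα0 (by linarith) hm hK x y hl⟩,
    h.exists_hasOscBound_multiplierKernel hα0 hr2 hm hK⟩

end DecayBound

theorem exists_sub_eq_mul_sub {f f' : ℝ → ℝ} (hf : ∀ t, HasDerivAt f (f' t) t) (a b : ℝ) :
    ∃ u ∈ uIcc a b, f b - f a = f' u * (b - a) := by
  rcases eq_or_ne a b with rfl | hab
  · exact ⟨a, left_mem_uIcc, by simp⟩
  wlog h : a < b generalizing a b
  · obtain ⟨u, hu, heq⟩ := this b a hab.symm (hab.lt_or_gt.resolve_left h)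
    exact ⟨u, uIcc_comm b a ▸ hu, by linarith⟩
  obtain ⟨u, hu, heq⟩ := exists_hasDerivAt_eq_slope f f' h
    (fun v _ => (hf v).continuousAt.continuousWithinAt) fun v _ => hf v
  exact ⟨u, Icc_subset_uIcc (Ioo_subset_Icc_self hu), by rw [heq, div_mul_cancel₀ _ (by linarith)]⟩

section Covering

variable {α c ε : ℝ} {i : ℤ × ℤ} {y z : ℝ × ℝ}

theorem isOpen_coverU (α c ε : ℝ) (i : ℤ × ℤ) : IsOpen (coverU α c ε i) :=
  isOpen_Ioo.prod isOpen_Ioo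

theorem mem_coverU_iff :
    z ∈ coverU α c ε i ↔
      |z.1 - ε * beta α (omegaPt α ε i.1) * i.2| < ε * beta α (omegaPt α ε i.1) ∧
        |z.2 - omegaPt α ε i.1| < 2 * ε * c * (beta α (omegaPt α ε i.1))⁻¹ := by
  simp only [coverU, mem_prod, mem_Ioo, abs_lt, lt_sub_iff_add_lt, sub_lt_iff_lt_add',
    neg_add_lt_iff_lt_add, mul_sub_one, mul_add_one]

theorem volume_coverU (hε : 0 < ε) (i : ℤ × ℤ) :
    volume (coverU α c ε i) = ENNReal.ofReal (8 * ε ^ 2 * c) := by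
  have hb := beta_pos α (omegaPt α ε i.1)
  rw [coverU, Measure.volume_eq_prod, Measure.prod_prod, Real.volume_Ioo, Real.volume_Ioo,
    ← ENNReal.ofReal_mul (by nlinarith [mul_pos hε hb])]
  congr 1
  field_simp
  ring

theorem nonempty_coverU (hε : 0 < ε) (hc : 0 < c) (i : ℤ × ℤ) : (coverU α c ε i).Nonempty := by
  have hb := beta_pos α (omegaPt α ε i.1)
  refine ⟨(ε * beta α (omegaPt α ε i.1) * i.2, omegaPt α ε i.1), mem_coverU_iff.2 ?_⟩
  simp only [sub_self, abs_zero]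
  constructor <;> positivity

theorem abs_beta_sub_beta_omegaPt_le (hα0 : 0 ≤ α) (hα1 : α < 1) (hεc : ε * c ≤ 1 / 16)
    (hz : z ∈ coverU α c ε i) :
    |beta α z.2 - beta α (omegaPt α ε i.1)| ≤ 4 * (ε * c) * beta α (omegaPt α ε i.1) :=
  (abs_beta_sub_le hα0 hα1 (by linarith) (mem_coverU_iff.1 hz).2.le).trans_eq (by ring)

theorem beta_omegaPt_le (hα0 : 0 ≤ α) (hα1 : α < 1) (hεc : ε * c ≤ 1 / 16)
    (hz : z ∈ coverU α c ε i) : beta α (omegaPt α ε i.1) ≤ 4 / 3 * beta α z.2 := by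
  have := abs_le.1 (abs_beta_sub_beta_omegaPt_le hα0 hα1 hεc hz)
  nlinarith [beta_pos α (omegaPt α ε i.1)]

theorem beta_le_omegaPt (hα0 : 0 ≤ α) (hα1 : α < 1) (hεc : ε * c ≤ 1 / 16)
    (hz : z ∈ coverU α c ε i) : beta α z.2 ≤ 5 / 4 * beta α (omegaPt α ε i.1) := by
  have := abs_le.1 (abs_beta_sub_beta_omegaPt_le hα0 hα1 hεc hz)
  nlinarith [beta_pos α (omegaPt α ε i.1)]

theorem abs_beta_div_beta_sub_one_le (hα0 : 0 ≤ α) (hα1 : α < 1) (hεc0 : 0 ≤ ε * c)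
    (hεc : ε * c ≤ 1 / 16) (hy : y ∈ coverU α c ε i) (hz : z ∈ coverU α c ε i) :
    |beta α z.2 / beta α y.2 - 1| ≤ 16 * (ε * c) := by
  have hb := beta_pos α y.2
  rw [div_sub_one hb.ne', abs_div, abs_of_pos hb, div_le_iff₀ hb]
  calc |beta α z.2 - beta α y.2|
      ≤ |beta α z.2 - beta α (omegaPt α ε i.1)| + |beta α y.2 - beta α (omegaPt α ε i.1)| := by
        rw [abs_sub_comm (beta α y.2)]
        exact abs_sub_le _ _ _
    _ ≤ 8 * (ε * c) * beta α (omegaPt α ε i.1) := by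
        linarith [abs_beta_sub_beta_omegaPt_le hα0 hα1 hεc hy,
          abs_beta_sub_beta_omegaPt_le hα0 hα1 hεc hz]
    _ ≤ 16 * (ε * c) * beta α y.2 := by
        nlinarith [beta_omegaPt_le hα0 hα1 hεc hy]

theorem abs_fst_sub_div_beta_le (hα0 : 0 ≤ α) (hα1 : α < 1) (hε : 0 < ε) (hεc : ε * c ≤ 1 / 16)
    (hy : y ∈ coverU α c ε i) (hz : z ∈ coverU α c ε i) :
    |(y.1 - z.1) / beta α y.2| ≤ 4 * ε := by
  have hb := beta_pos α y.2
  have hy1 := abs_lt.1 (mem_coverU_iff.1 hy).1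
  have hz1 := abs_lt.1 (mem_coverU_iff.1 hz).1
  rw [abs_div, abs_of_pos hb, div_le_iff₀ hb]
  calc |y.1 - z.1| ≤ 2 * ε * beta α (omegaPt α ε i.1) := by
        rw [abs_le]
        constructor <;> linarith
    _ ≤ 4 * ε * beta α y.2 := by nlinarith [beta_omegaPt_le hα0 hα1 hεc hy]

theorem abs_beta_mul_snd_sub_le (hα0 : 0 ≤ α) (hα1 : α < 1)
    (hεc : ε * c ≤ 1 / 16) (hy : y ∈ coverU α c ε i) (hz : z ∈ coverU α c ε i) :
    |beta α y.2 * (z.2 - y.2)| ≤ 5 * (ε * c) := by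
  have hB := beta_pos α (omegaPt α ε i.1)
  have hy2 := abs_lt.1 (mem_coverU_iff.1 hy).2
  have hz2 := abs_lt.1 (mem_coverU_iff.1 hz).2
  rw [abs_mul, abs_of_pos (beta_pos α y.2)]
  calc beta α y.2 * |z.2 - y.2|
      ≤ 5 / 4 * beta α (omegaPt α ε i.1) * (4 * (ε * c) * (beta α (omegaPt α ε i.1))⁻¹) := by
        gcongr
        · exact beta_le_omegaPt hα0 hα1 hεc hy
        · rw [abs_le]
          constructor <;> linarith
    _ = 5 * (ε * c) := by field_simp

theorem weightV_div_weightV_le {s : ℝ} (hα1 : α < 1) (hs : 0 ≤ s) (hεc : ε * c ≤ 1 / 16)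
    (hy : y ∈ coverU α c ε i) (hz : z ∈ coverU α c ε i) :
    weightV s y / weightV s z ≤ 2 ^ s := by
  have hclose {z : ℝ × ℝ} (hz : z ∈ coverU α c ε i) :
      |(1 + |z.2|) - (1 + |omegaPt α ε i.1|)| ≤ 1 / 8 * (1 + |omegaPt α ε i.1|) :=
    calc |(1 + |z.2|) - (1 + |omegaPt α ε i.1|)| ≤ |z.2 - omegaPt α ε i.1| := by
          rw [add_sub_add_left_eq_sub]
          exact abs_abs_sub_abs_le_abs_sub _ _
      _ ≤ 2 * ε * c * (1 + |omegaPt α ε i.1|) ^ α := by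
          rw [← beta_inv]
          exact (mem_coverU_iff.1 hz).2.le
      _ ≤ 1 / 8 * (1 + |omegaPt α ε i.1|) :=
          mul_le_mul (by linarith) (one_add_abs_rpow_le hα1 _) (by positivity) (by norm_num)
  have hyω := abs_le.1 (hclose hy)
  have hzω := abs_le.1 (hclose hz)
  rw [weightV, weightV, ← Real.div_rpow (by positivity) (by positivity)]
  refine Real.rpow_le_rpow (by positivity) ?_ hs
  rw [div_le_iff₀ (by positivity)]
  linarith [abs_nonneg (omegaPt α ε i.1)]

theorem weightConst_coverU_le {s : ℝ} (hα1 : α < 1) (hs : 0 ≤ s) (hεc : ε * c ≤ 1 / 16) :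
    weightConst (weightW s) (coverU α c ε) ≤ ENNReal.ofReal (2 ^ s) :=
  iSup_le fun _ => iSup₂_le fun _ hx => iSup₂_le fun _ hy => ENNReal.ofReal_le_ofReal <|
    max_le (weightV_div_weightV_le hα1 hs hεc hx hy)
      (weightV_div_weightV_le hα1 hs hεc hy hx)

/-- The derivative `(1 + (1 - α)|t|)^{α/(1-α)}` of `p_α`. -/
def pDensity (α t : ℝ) : ℝ := (1 + (1 - α) * |t|) ^ (α / (1 - α))

theorem pAlpha_neg (α t : ℝ) : pAlpha α (-t) = -pAlpha α t := by
  simp only [pAlpha, Real.sign_neg, abs_neg, neg_mul]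

theorem pAlpha_of_nonneg {t : ℝ} (ht : 0 ≤ t) :
    pAlpha α t = (1 + (1 - α) * t) ^ (1 / (1 - α)) - 1 := by
  rcases ht.eq_or_lt with rfl | h
  · simp [pAlpha]
  · rw [pAlpha, Real.sign_of_pos h, abs_of_pos h, one_mul]

theorem abs_pAlpha (hα1 : α < 1) (t : ℝ) :
    |pAlpha α t| = (1 + (1 - α) * |t|) ^ (1 / (1 - α)) - 1 := by
  have : 0 < 1 - α := by linarith
  have heven : |pAlpha α t| = |pAlpha α (|t|)| := by
    rcases abs_choice t with h | h <;> rw [h]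
    rw [pAlpha_neg, abs_neg]
  rw [heven, pAlpha_of_nonneg (abs_nonneg t), abs_of_nonneg]
  exact sub_nonneg.2 (Real.one_le_rpow (le_add_of_nonneg_right (by positivity)) (by positivity))

theorem beta_pAlpha_inv (hα1 : α < 1) (t : ℝ) : (beta α (pAlpha α t))⁻¹ = pDensity α t := by
  have : 0 < 1 - α := by linarith
  rw [beta_inv, abs_pAlpha hα1, add_sub_cancel, ← Real.rpow_mul (by positivity), pDensity,
    one_div_mul_eq_div]

theorem one_le_pDensity (hα0 : 0 ≤ α) (hα1 : α < 1) (t : ℝ) : 1 ≤ pDensity α t := by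
  have : 0 < 1 - α := by linarith
  exact Real.one_le_rpow (le_add_of_nonneg_right (by positivity)) (by positivity)

theorem pDensity_le_mul (hα0 : 0 ≤ α) (hα1 : α < 1) {t t' d : ℝ} (h : |t - t'| ≤ d) :
    pDensity α t ≤ (1 + d) ^ (α / (1 - α)) * pDensity α t' := by
  have h1α : 0 < 1 - α := by linarith
  have hd : 0 ≤ d := (abs_nonneg _).trans h
  rw [pDensity, pDensity, ← Real.mul_rpow (by positivity) (by positivity)]
  refine Real.rpow_le_rpow (by positivity) ?_ (by positivity)
  have h2 : |t| ≤ |t'| + d := by linarith [abs_sub_abs_le_abs_sub t t']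
  have h3 := abs_nonneg t'
  nlinarith [mul_nonneg h1α.le h3, mul_nonneg hd (mul_nonneg h1α.le h3)]

theorem hasDerivWithinAt_pAlpha_Ici (hα1 : α < 1) {t : ℝ} (ht : 0 ≤ t) :
    HasDerivWithinAt (pAlpha α) (pDensity α t) (Ici 0) t := by
  have h1α : 0 < 1 - α := by linarith
  have hbase : HasDerivAt (fun u => 1 + (1 - α) * u) (1 - α) t := by
    simpa using ((hasDerivAt_id t).const_mul (1 - α)).const_add 1
  have hpow := (hbase.rpow_const (p := 1 / (1 - α)) (Or.inl (by positivity))).sub_const 1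
  have hval : (1 - α) * (1 / (1 - α)) * (1 + (1 - α) * t) ^ (1 / (1 - α) - 1) =
      pDensity α t := by
    rw [mul_one_div_cancel h1α.ne', one_mul, pDensity, abs_of_nonneg ht]
    congr 1
    field_simp
    ring
  rw [hval] at hpow
  exact hpow.hasDerivWithinAt.congr (fun u hu => pAlpha_of_nonneg hu) (pAlpha_of_nonneg ht)

theorem hasDerivWithinAt_pAlpha_Iic (hα1 : α < 1) {t : ℝ} (ht : t ≤ 0) :
    HasDerivWithinAt (pAlpha α) (pDensity α t) (Iic 0) t := by
  have h := ((hasDerivWithinAt_pAlpha_Ici hα1 (neg_nonneg.2 ht)).scomp t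
    (hasDerivAt_neg t).hasDerivWithinAt fun u (hu : u ≤ 0) => neg_nonneg.2 hu).fun_neg
  refine (h.congr_deriv ?_).congr_of_mem (fun u _ => ?_) ht
  · simp [pDensity]
  · simp [pAlpha_neg]

theorem hasDerivAt_pAlpha (hα1 : α < 1) (t : ℝ) : HasDerivAt (pAlpha α) (pDensity α t) t := by
  rcases lt_trichotomy t 0 with ht | rfl | ht
  · exact (hasDerivWithinAt_pAlpha_Iic hα1 ht.le).hasDerivAt (Iic_mem_nhds ht)
  · rw [← hasDerivWithinAt_univ, ← Iic_union_Ici]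
    exact (hasDerivWithinAt_pAlpha_Iic hα1 le_rfl).union (hasDerivWithinAt_pAlpha_Ici hα1 le_rfl)
  · exact (hasDerivWithinAt_pAlpha_Ici hα1 ht.le).hasDerivAt (Ici_mem_nhds ht)

theorem monotone_pAlpha (hα0 : 0 ≤ α) (hα1 : α < 1) : Monotone (pAlpha α) :=
  monotone_of_deriv_nonneg (fun t => (hasDerivAt_pAlpha hα1 t).differentiableAt) fun t =>
    (hasDerivAt_pAlpha hα1 t).deriv ▸ zero_le_one.trans (one_le_pDensity hα0 hα1 t)

theorem pAlpha_surjective (hα0 : 0 ≤ α) (hα1 : α < 1) : Function.Surjective (pAlpha α) := by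
  have hle {t : ℝ} (ht : 0 ≤ t) : t ≤ pAlpha α t := by
    obtain ⟨u, -, hu⟩ := exists_sub_eq_mul_sub (hasDerivAt_pAlpha hα1) 0 t
    rw [pAlpha_of_nonneg le_rfl, mul_zero, add_zero, Real.one_rpow, sub_self, sub_zero,
      sub_zero] at hu
    exact hu ▸ le_mul_of_one_le_left ht (one_le_pDensity hα0 hα1 u)
  have hcont : Continuous (pAlpha α) :=
    continuous_iff_continuousAt.2 fun t => (hasDerivAt_pAlpha hα1 t).continuousAt
  refine fun w => mem_range_of_exists_le_of_exists_ge hcont ⟨-|w|, ?_⟩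
    ⟨|w|, (le_abs_self w).trans (hle (abs_nonneg w))⟩
  rw [pAlpha_neg]
  exact (neg_le_neg (hle (abs_nonneg w))).trans (neg_abs_le w)

end Covering

theorem encard_le_of_abs_sub_lt_three {S : Set (ℤ × ℤ)} {N a : ℤ} {f : ℤ → ℝ}
    (hS : ∀ i ∈ S, |i.1 - a| ≤ N ∧ |(i.2 : ℝ) - f i.1| < 3) :
    S.encard ≤ (Finset.Icc (-N) N ×ˢ Finset.Icc (-4 : ℤ) 4).card := by
  rw [← encard_coe_eq_coe_finsetCard]
  refine encard_le_encard_of_injOn (f := fun i => (i.1 - a, i.2 - ⌊f i.1⌋)) (fun i hi => ?_) ?_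
  · have h2 := abs_lt.1 (hS i hi).2
    have hlow : ((-4 : ℤ) : ℝ) < (i.2 - ⌊f i.1⌋ : ℤ) := by
      push_cast
      linarith [Int.floor_le (f i.1)]
    have hupp : ((i.2 - ⌊f i.1⌋ : ℤ) : ℝ) < (4 : ℤ) := by
      push_cast
      linarith [Int.lt_floor_add_one (f i.1)]
    rw [Finset.mem_coe, Finset.mem_product, Finset.mem_Icc, Finset.mem_Icc]
    exact ⟨abs_le.1 (hS i hi).1, (Int.cast_lt.1 hlow).le, (Int.cast_lt.1 hupp).le⟩
  · rintro ⟨u, v⟩ - ⟨u', v'⟩ - h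
    obtain ⟨hu, hv⟩ := Prod.mk.inj h
    obtain rfl : u = u' := sub_left_injective hu
    exact congrArg (Prod.mk u) (sub_left_injective hv)

section Covering

variable {α c ε : ℝ} {i j : ℤ × ℤ}

theorem beta_omegaPt_le_of_overlap (hα0 : 0 ≤ α) (hα1 : α < 1) (hεc : ε * c ≤ 1 / 16)
    (h : (coverU α c ε j ∩ coverU α c ε i).Nonempty) :
    beta α (omegaPt α ε i.1) ≤ 5 / 3 * beta α (omegaPt α ε j.1) := by
  obtain ⟨z, hj, hi⟩ := h
  linarith [beta_omegaPt_le hα0 hα1 hεc hi, beta_le_omegaPt hα0 hα1 hεc hj]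

theorem abs_omegaPt_sub_le_of_overlap (hα0 : 0 ≤ α) (hα1 : α < 1) (hεc0 : 0 ≤ ε * c)
    (hεc : ε * c ≤ 1 / 16) (h : (coverU α c ε j ∩ coverU α c ε i).Nonempty) :
    |omegaPt α ε j.1 - omegaPt α ε i.1| ≤ 6 * (ε * c) * (beta α (omegaPt α ε i.1))⁻¹ := by
  have hi := beta_pos α (omegaPt α ε i.1)
  have hj := beta_pos α (omegaPt α ε j.1)
  have hinv : (beta α (omegaPt α ε j.1))⁻¹ ≤ 5 / 3 * (beta α (omegaPt α ε i.1))⁻¹ := by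
    rw [← div_eq_mul_inv, le_div_iff₀ hi, inv_mul_le_iff₀ hj, mul_comm]
    exact beta_omegaPt_le_of_overlap hα0 hα1 hεc h
  obtain ⟨z, hzj, hzi⟩ := h
  calc |omegaPt α ε j.1 - omegaPt α ε i.1|
      ≤ |z.2 - omegaPt α ε j.1| + |z.2 - omegaPt α ε i.1| := by
        rw [abs_sub_comm z.2]
        exact abs_sub_le _ _ _
    _ ≤ 2 * (ε * c) * (5 / 3 * (beta α (omegaPt α ε i.1))⁻¹) +
          2 * (ε * c) * (beta α (omegaPt α ε i.1))⁻¹ := by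
        rw [← mul_assoc 2 ε c]
        have := mul_le_mul_of_nonneg_left hinv hεc0
        refine add_le_add ((mem_coverU_iff.1 hzj).2.le.trans ?_) (mem_coverU_iff.1 hzi).2.le
        linarith
    _ ≤ _ := by linarith [mul_nonneg hεc0 (inv_pos.2 hi).le]

theorem abs_fst_sub_le_of_overlap (hα0 : 0 ≤ α) (hα1 : α < 1) (hε : 0 < ε) (hc : 0 < c)
    (hεc : ε * c ≤ 1 / 16) (h : (coverU α c ε j ∩ coverU α c ε i).Nonempty) :
    |(j.1 : ℝ) - i.1| ≤ 12 * c := by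
  have hB := beta_pos α (omegaPt α ε i.1)
  have hω := abs_omegaPt_sub_le_of_overlap hα0 hα1 (by positivity) hεc h
  obtain ⟨u, hu, heq⟩ := exists_sub_eq_mul_sub (hasDerivAt_pAlpha hα1) (ε * i.1) (ε * j.1)
  have hubeta : beta α (pAlpha α u) ≤ 2 * beta α (omegaPt α ε i.1) := by
    have hu' : |pAlpha α u - omegaPt α ε i.1| ≤ |omegaPt α ε j.1 - omegaPt α ε i.1| :=
      abs_sub_left_of_mem_uIcc ((monotone_pAlpha hα0 hα1).mapsTo_uIcc hu)
    have := abs_le.1 (abs_beta_sub_le hα0 hα1 (by linarith) (hu'.trans hω))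
    nlinarith
  have hlow : (2 * beta α (omegaPt α ε i.1))⁻¹ * (ε * |(j.1 : ℝ) - i.1|) ≤
      6 * (ε * c) * (beta α (omegaPt α ε i.1))⁻¹ := by
    calc _ ≤ (beta α (pAlpha α u))⁻¹ * (ε * |(j.1 : ℝ) - i.1|) := by
          have := beta_pos α (pAlpha α u)
          gcongr
      _ = |omegaPt α ε j.1 - omegaPt α ε i.1| := by
          rw [omegaPt, omegaPt, heq, ← beta_pAlpha_inv hα1, ← mul_sub, abs_mul, abs_mul,
            abs_of_pos hε, abs_of_pos (inv_pos.2 (beta_pos _ _))]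
      _ ≤ _ := hω
  rw [mul_inv] at hlow
  refine le_of_mul_le_mul_left ?_ (mul_pos hε (inv_pos.2 hB))
  linarith

theorem abs_snd_sub_lt_of_overlap (hα0 : 0 ≤ α) (hα1 : α < 1) (hε : 0 < ε) (hεc : ε * c ≤ 1 / 16)
    (h : (coverU α c ε j ∩ coverU α c ε i).Nonempty) :
    |(j.2 : ℝ) - beta α (omegaPt α ε i.1) / beta α (omegaPt α ε j.1) * i.2| < 3 := by
  have hij := beta_omegaPt_le_of_overlap hα0 hα1 hεc h
  obtain ⟨z, hzj, hzi⟩ := h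
  have hj := beta_pos α (omegaPt α ε j.1)
  have hzj := abs_lt.1 (mem_coverU_iff.1 hzj).1
  have hzi := abs_lt.1 (mem_coverU_iff.1 hzi).1
  have hεj : 0 < ε * beta α (omegaPt α ε j.1) := mul_pos hε hj
  have heq : (j.2 : ℝ) - beta α (omegaPt α ε i.1) / beta α (omegaPt α ε j.1) * i.2 =
      (ε * beta α (omegaPt α ε j.1) * j.2 - ε * beta α (omegaPt α ε i.1) * i.2) /
        (ε * beta α (omegaPt α ε j.1)) := by field_simp
  rw [heq, abs_div, abs_of_pos hεj, div_lt_iff₀ hεj, abs_lt]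
  have := mul_le_mul_of_nonneg_left hij hε.le
  constructor <;> linarith

theorem exists_finite_overlap_coverU (hα0 : 0 ≤ α) (hα1 : α < 1) (hε : 0 < ε) (hc : 0 < c)
    (hεc : ε * c ≤ 1 / 16) :
    ∃ N : ℕ, ∀ i, {j | (coverU α c ε j ∩ coverU α c ε i).Nonempty}.encard ≤ N := by
  refine ⟨_, fun i => encard_le_of_abs_sub_lt_three (N := ⌈12 * c⌉) (a := i.1)
    (f := fun l => beta α (omegaPt α ε i.1) / beta α (omegaPt α ε l) * i.2) fun j hj =>
      ⟨?_, abs_snd_sub_lt_of_overlap hα0 hα1 hε hεc hj⟩⟩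
  have := (abs_fst_sub_le_of_overlap hα0 hα1 hε hc hεc hj).trans (Int.le_ceil _)
  exact_mod_cast this

theorem abs_sub_mul_round_le {h : ℝ} (hh : 0 < h) (t : ℝ) : |t - h * round (t / h)| ≤ h / 2 := by
  have heq : t - h * round (t / h) = h * (t / h - round (t / h)) := by field_simp
  rw [heq, abs_mul, abs_of_pos hh]
  linarith [mul_le_mul_of_nonneg_left (abs_sub_round (t / h)) hh.le]

theorem abs_pAlpha_sub_omegaPt_round_lt (hα0 : 0 ≤ α) (hα1 : α < 1) (hε : 0 < ε)
    (hdens : (1 + ε) ^ (α / (1 - α)) < 4 * c) (t : ℝ) :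
    |pAlpha α t - omegaPt α ε (round (t / ε))| <
      2 * ε * c * (beta α (omegaPt α ε (round (t / ε))))⁻¹ := by
  have hround := abs_sub_mul_round_le hε t
  obtain ⟨u, hu, heq⟩ := exists_sub_eq_mul_sub (hasDerivAt_pAlpha hα1) (ε * round (t / ε)) t
  have hu' : |u - ε * round (t / ε)| ≤ ε :=
    (abs_sub_left_of_mem_uIcc hu).trans (hround.trans (by linarith))
  have hpos := one_pos.trans_le (one_le_pDensity hα0 hα1 (ε * round (t / ε)))
  have hposu := one_pos.trans_le (one_le_pDensity hα0 hα1 u)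
  rw [omegaPt, heq, beta_pAlpha_inv hα1, abs_mul, abs_of_pos hposu]
  calc pDensity α u * |t - ε * round (t / ε)|
      ≤ (1 + ε) ^ (α / (1 - α)) * pDensity α (ε * round (t / ε)) * (ε / 2) := by
        gcongr
        exact pDensity_le_mul hα0 hα1 hu'
    _ < 4 * c * pDensity α (ε * round (t / ε)) * (ε / 2) := by gcongr
    _ = _ := by ring

theorem iUnion_coverU (hα0 : 0 ≤ α) (hα1 : α < 1) (hε : 0 < ε)
    (hdens : (1 + ε) ^ (α / (1 - α)) < 4 * c) : ⋃ i, coverU α c ε i = univ := by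
  refine eq_univ_of_forall fun z => mem_iUnion.2 ?_
  obtain ⟨t, ht⟩ := pAlpha_surjective hα0 hα1 z.2
  have hεB : 0 < ε * beta α (omegaPt α ε (round (t / ε))) := mul_pos hε (beta_pos _ _)
  refine ⟨(round (t / ε), round (z.1 / (ε * beta α (omegaPt α ε (round (t / ε)))))),
    mem_coverU_iff.2 ⟨?_, ht ▸ abs_pAlpha_sub_omegaPt_round_lt hα0 hα1 hε hdens t⟩⟩
  exact (abs_sub_mul_round_le hεB z.1).trans_lt (half_lt_self hεB)

theorem isModerateAdmissibleCovering_coverU (hα0 : 0 ≤ α) (hα1 : α < 1) (hε : 0 < ε)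
    (hc : 0 < c) (hεc : ε * c ≤ 1 / 16) (hdens : (1 + ε) ^ (α / (1 - α)) < 4 * c) :
    IsModerateAdmissibleCovering volume (coverU α c ε) where
  countable_index := inferInstance
  relatively_compact i :=
    ((Metric.isBounded_Ioo _ _).prod (Metric.isBounded_Ioo _ _)).isCompact_closure
  interior_nonempty i := by
    rw [(isOpen_coverU α c ε i).interior_eq]
    exact nonempty_coverU hε hc i
  covers := iUnion_coverU hα0 hα1 hε hdens
  finite_overlap := exists_finite_overlap_coverU hα0 hα1 hε hc hεc
  measure_lower := ⟨ENNReal.ofReal (8 * ε ^ 2 * c), ENNReal.ofReal_pos.2 (by positivity),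
    fun i => (volume_coverU hε i).ge⟩
  measure_comparable := ⟨1, ENNReal.one_ne_top, fun i j _ => by
    rw [volume_coverU hε, volume_coverU hε, one_mul]⟩

theorem eventually_mul_le (a : ℝ) {b : ℝ} (hb : 0 < b) : ∀ᶠ ε : ℝ in 𝓝[>] 0, ε * a ≤ b := by
  have h : ContinuousAt (fun ε : ℝ => ε * a) 0 := by fun_prop
  refine (h.eventually (ge_mem_nhds ?_)).filter_mono nhdsWithin_le_nhds
  simpa using hb

theorem eventually_isModerateAdmissibleCovering_coverU (hα0 : 0 ≤ α) (hα1 : α < 1)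
    (hc : 1 / 4 < c) :
    ∀ᶠ ε in 𝓝[>] 0, IsModerateAdmissibleCovering volume (coverU α c ε) := by
  have hdens : ∀ᶠ ε : ℝ in 𝓝[>] 0, (1 + ε) ^ (α / (1 - α)) < 4 * c := by
    have h : ContinuousAt (fun ε : ℝ => (1 + ε) ^ (α / (1 - α))) 0 :=
      ContinuousAt.rpow_const (by fun_prop) (Or.inl (by norm_num))
    refine (h.eventually (gt_mem_nhds ?_)).filter_mono nhdsWithin_le_nhds
    simp only [add_zero, Real.one_rpow]
    linarith
  filter_upwards [self_mem_nhdsWithin, eventually_mul_le c (b := 1 / 16) (by norm_num), hdens]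
    with ε hε hεc hdens using
      isModerateAdmissibleCovering_coverU hα0 hα1 hε (by linarith) hεc hdens

end Covering

theorem mem_nbhdQ {X ι : Type*} {U : ι → Set X} {y z : X} :
    z ∈ nbhdQ U y ↔ ∃ i, y ∈ U i ∧ z ∈ U i := by
  simp only [nbhdQ, mem_ofPred_eq, mem_iUnion, exists_prop]

theorem lowerSemicontinuous_osc {X ι : Type*} [TopologicalSpace X] {R Γ : X → X → ℂ}
    (hR : Continuous (Function.uncurry R)) (hΓ : Continuous (Function.uncurry Γ)) {U : ι → Set X}
    (hU : ∀ i, IsOpen (U i)) : LowerSemicontinuous (Function.uncurry (osc R U Γ)) := by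
  refine lowerSemicontinuous_iSup fun z p a ha => ?_
  change a < ⨆ _ : z ∈ nbhdQ U p.2, ‖R p.1 p.2 - Γ p.2 z * R p.1 z‖ₑ at ha
  change ∀ᶠ q : X × X in 𝓝 p, a < ⨆ _ : z ∈ nbhdQ U q.2, ‖R q.1 q.2 - Γ q.2 z * R q.1 z‖ₑ
  by_cases hz : z ∈ nbhdQ U p.2
  · rw [iSup_pos hz] at ha
    have hcont : Continuous fun q : X × X => ‖R q.1 q.2 - Γ q.2 z * R q.1 z‖ₑ := by
      have hΓz : Continuous fun q : X × X => Γ q.2 z :=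
        hΓ.comp (continuous_snd.prodMk continuous_const)
      have hRz : Continuous fun q : X × X => R q.1 z :=
        hR.comp (continuous_fst.prodMk continuous_const)
      exact (hR.sub (hΓz.mul hRz)).enorm
    obtain ⟨i, hy, hzi⟩ := mem_nbhdQ.1 hz
    filter_upwards [continuous_snd.continuousAt.eventually ((hU i).mem_nhds hy),
      hcont.continuousAt.eventually (lt_mem_nhds ha)] with q hq hlt
    rwa [iSup_pos (mem_nbhdQ.2 ⟨i, hq, hzi⟩)]
  · rw [iSup_neg hz] at ha
    exact absurd ha not_lt_bot

section Oscillation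

variable {α c s p L ε : ℝ} {C : ℝ≥0∞} {k : ℝ × ℝ → ℝ × ℝ → ℝ≥0∞}

theorem supIntFst_le_of_majorant
    (hC : ∀ y, ∫⁻ x, majorant α p (beta α y.2) x y * ENNReal.ofReal (weightW s x y) ≤ C)
    (hk : IsMajorized α p L k) :
    supIntFst k (weightW s) ≤ ENNReal.ofReal L * C := by
  refine iSup_le fun y => ?_
  calc ∫⁻ x, k x y * ENNReal.ofReal (weightW s x y)
      ≤ ∫⁻ x, ENNReal.ofReal L *
          (majorant α p (beta α y.2) x y * ENNReal.ofReal (weightW s x y)) := by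
        refine lintegral_mono fun x => ?_
        rw [← mul_assoc]
        gcongr
        exact hk x y _ (beta_pos α y.2)
    _ = ENNReal.ofReal L * ∫⁻ x,
          majorant α p (beta α y.2) x y * ENNReal.ofReal (weightW s x y) :=
        lintegral_const_mul' _ _ ENNReal.ofReal_ne_top
    _ ≤ _ := by gcongr; exact hC y

theorem supIntSnd_le_of_majorant
    (hC : ∀ y, ∫⁻ x, majorant α p (beta α y.2) x y * ENNReal.ofReal (weightW s x y) ≤ C)
    (hk : IsMajorized α p L k) :
    supIntSnd k (weightW s) ≤ ENNReal.ofReal L * C := by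
  have h := supIntFst_le_of_majorant hC (k := fun x y => k y x)
    fun x y l hl => majorant_comm α p l y x ▸ hk y x l hl
  simpa only [supIntFst, supIntSnd, weightW_comm] using h

theorem nbhdQ_coverU_close (hα0 : 0 ≤ α) (hα1 : α < 1) (hε : 0 < ε) (hc : 0 < c)
    (hsmall : ε * (4 + 16 * c) ≤ 1 / 8) {y z : ℝ × ℝ} (hz : z ∈ nbhdQ (coverU α c ε) y) :
    |beta α z.2 / beta α y.2 - 1| ≤ ε * (4 + 16 * c) ∧
      |(y.1 - z.1) / beta α y.2| ≤ ε * (4 + 16 * c) ∧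
      |beta α y.2 * (z.2 - y.2)| ≤ ε * (4 + 16 * c) := by
  obtain ⟨i, hyi, hzi⟩ := mem_nbhdQ.1 hz
  have hεc0 : 0 < ε * c := mul_pos hε hc
  have hεc : ε * c ≤ 1 / 16 := by linarith
  refine ⟨(abs_beta_div_beta_sub_one_le hα0 hα1 hεc0.le hεc hyi hzi).trans ?_,
    (abs_fst_sub_div_beta_le hα0 hα1 hε hεc hyi hzi).trans ?_,
    (abs_beta_mul_snd_sub_le hα0 hα1 hεc hyi hzi).trans ?_⟩ <;> linarith

theorem gammaMax_le {ψ : L2} {A : L2 ≃L[ℂ] L2} {Γ : ℝ × ℝ → ℝ × ℝ → ℂ}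
    (hα0 : 0 ≤ α) (hα1 : α < 1) (hc : 0 < c)
    (hC : ∀ y, ∫⁻ x, majorant α p (beta α y.2) x y * ENNReal.ofReal (weightW s x y) ≤ C)
    (hosc : HasOscBound α p L (kernelR α ψ A) Γ)
    (hε : 0 < ε) (hsmall : ε * (4 + 16 * c) ≤ 1 / 8) :
    gammaMax α c s ψ A Γ ε ≤ ENNReal.ofReal (L * (ε * (4 + 16 * c))) * C := by
  have hle : IsMajorized α p (L * (ε * (4 + 16 * c))) (oscEps α c ψ A Γ ε) := fun x y l hl =>
    iSup₂_le fun z hz => by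
      obtain ⟨hβ, hx, hω⟩ := nbhdQ_coverU_close hα0 hα1 hε hc hsmall hz
      exact hosc _ x y z hsmall hβ hx hω l hl
  exact max_le (supIntFst_le_of_majorant hC hle) (supIntSnd_le_of_majorant hC hle)

theorem tendsto_gammaMax {ψ : L2} {A : L2 ≃L[ℂ] L2} {Γ : ℝ × ℝ → ℝ × ℝ → ℂ}
    (hα0 : 0 ≤ α) (hα1 : α < 1) (hc : 0 < c) (hCtop : C ≠ ∞)
    (hC : ∀ y, ∫⁻ x, majorant α p (beta α y.2) x y * ENNReal.ofReal (weightW s x y) ≤ C)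
    (hosc : HasOscBound α p L (kernelR α ψ A) Γ) :
    Tendsto (gammaMax α c s ψ A Γ) (𝓝[>] 0) (𝓝 0) := by
  have hcont : Continuous fun ε : ℝ => ENNReal.ofReal (L * (ε * (4 + 16 * c))) * C :=
    (ENNReal.continuous_mul_const hCtop).comp (ENNReal.continuous_ofReal.comp (by fun_prop))
  have hlim := (hcont.tendsto' 0 0 (by simp)).mono_left (nhdsWithin_le_nhds (s := Ioi 0))
  refine tendsto_of_tendsto_of_tendsto_of_le_of_le' tendsto_const_nhds hlim
    (Eventually.of_forall fun _ => zero_le) ?_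
  filter_upwards [self_mem_nhdsWithin, eventually_mul_le (4 + 16 * c) (b := 1 / 8) (by norm_num)]
    with ε hε hsmall using gammaMax_le hα0 hα1 hc hC hosc hε hsmall

end Oscillation

theorem eventually_mul_add_max_lt_one {ι : Type*} {l : Filter ι} {γ W : ι → ℝ≥0∞} {ρ K : ℝ≥0∞}
    (hγ : Tendsto γ l (𝓝 0)) (hρ : ρ ≠ ∞) (hK : K ≠ ∞) (hW : ∀ᶠ i in l, W i ≤ K) :
    ∀ᶠ i in l, γ i * (ρ + max (ρ * W i) (ρ + γ i)) < 1 := by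
  have hlim : Tendsto (fun i => γ i * (ρ + max (ρ * K) (ρ + γ i))) l (𝓝 0) := by
    have hfactor : Tendsto (fun i => ρ + max (ρ * K) (ρ + γ i)) l
        (𝓝 (ρ + max (ρ * K) (ρ + 0))) :=
      tendsto_const_nhds.add (tendsto_const_nhds.max (tendsto_const_nhds.add hγ))
    have hfin : ρ + max (ρ * K) (ρ + 0) ≠ ∞ := by
      simp [hρ, ENNReal.mul_ne_top hρ hK]
    simpa using ENNReal.Tendsto.mul hγ (Or.inr hfin) hfactor (Or.inr ENNReal.zero_ne_top)
  filter_upwards [hW, hlim.eventually (gt_mem_nhds one_pos)] with i hWi hi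
  exact lt_of_le_of_lt (by gcongr) hi

theorem hasFourierDecay_toLp (G : SchwartzMap ℝ ℂ) (n : ℕ) (r : ℝ) :
    HasFourierDecay n r (G.toLp 2) := by
  refine ⟨(𝓕 G : SchwartzMap ℝ ℂ), ?_, (𝓕 G).smooth n, 2 ^ ⌈r⌉₊ * ((Finset.Iic (⌈r⌉₊, n)).sup
    fun m => SchwartzMap.seminorm ℝ m.1 m.2) (𝓕 G), fun l hl ξ => ?_⟩
  · rw [SchwartzMap.toLp_fourier_eq]
    exact (𝓕 G).coeFn_toLp 2 volume
  have hdecay := SchwartzMap.one_add_le_sup_seminorm_apply (𝕜 := ℝ) (m := (⌈r⌉₊, n)) le_rfl hl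
    (𝓕 G) ξ
  rw [norm_iteratedFDeriv_eq_norm_iteratedDeriv, Real.norm_eq_abs] at hdecay
  rw [Real.rpow_neg (by positivity), ← div_eq_mul_inv, le_div_iff₀ (by positivity), mul_comm]
  refine le_trans ?_ hdecay
  gcongr
  rw [← Real.rpow_natCast]
  exact Real.rpow_le_rpow_of_exponent_le (le_add_of_nonneg_right (abs_nonneg ξ)) (Nat.le_ceil r)

theorem exists_compactSupport_hasFourierDecay (n : ℕ) :
    ∃ ψ : L2, ψ ≠ 0 ∧ (∃ S : Set ℝ, IsCompact S ∧ ∀ᵐ t : ℝ, t ∉ S → ψ t = 0) ∧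
      ∀ r : ℝ, HasFourierDecay n r ψ := by
  let f : ContDiffBump (0 : ℝ) := ⟨1, 2, one_pos, one_lt_two⟩
  have hsupp : HasCompactSupport (Complex.ofRealCLM ∘ f) := f.hasCompactSupport.comp_left rfl
  let G := hsupp.toSchwartzMap (Complex.ofRealCLM.contDiff.comp f.contDiff)
  have hG (t : ℝ) : G t = f t := rfl
  have hae := G.coeFn_toLp 2 (volume : Measure ℝ)
  refine ⟨G.toLp 2, fun h => ?_, ⟨tsupport f, f.hasCompactSupport, ?_⟩,
    hasFourierDecay_toLp G n⟩
  · have hzero : G =ᵐ[volume] fun _ => 0 := hae.symm.trans (h ▸ Lp.coeFn_zero ℂ 2 volume)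
    have heval := congrFun ((G.continuous.ae_eq_iff_eq volume continuous_const).1 hzero) 0
    rw [hG, f.one_of_mem_closedBall (Metric.mem_closedBall_self f.rIn_pos.le)] at heval
    exact one_ne_zero (Complex.ofReal_eq_zero.1 heval)
  · filter_upwards [hae] with t ht hS
    rw [ht, hG, image_eq_zero_of_notMem_tsupport hS, Complex.ofReal_zero]

theorem ne_zero_of_fourier_ae_eq {ψ : L2} {φ : ℝ → ℂ} (hψ : (𝓕 ψ : L2) =ᵐ[volume] φ)
    (hψ0 : ψ ≠ 0) : φ ≠ 0 := by
  rintro rfl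
  have h : (𝓕 ψ : L2) = 0 := Lp.ext (hψ.trans (Lp.coeFn_zero ℂ 2 volume).symm)
  exact hψ0 (norm_eq_zero.1 (by rw [← Lp.norm_fourier_eq, h, norm_zero]))

theorem HasFourierDecay.exists_frameOperator {α s r : ℝ} {ψ : L2} (hψ : HasFourierDecay 3 r ψ)
    (hα0 : 0 ≤ α) (hα1 : α < 1) (hs : 0 ≤ s) (hψ0 : ψ ≠ 0)
    (hr : (1 + s) / (1 - α) + 5 * α / 2 + 1 < r)
    (hr' : (s + 2 * α) / (1 - α) + α / 2 + 2 < r) :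
    ∃ A : L2 ≃L[ℂ] L2, IsFrameOperator α ψ A ∧ Continuous (Function.uncurry (kernelR α ψ A)) ∧
      rho α s ψ A < ∞ ∧
      ∀ c, 0 < c → Tendsto (gammaMax α c s ψ A phase) (𝓝[>] 0) (𝓝 0) := by
  have h1α : 0 < 1 - α := by linarith
  have hmul : 1 + s < (1 - α) * (r - 5 * α / 2 - 1) := by
    rw [← div_lt_iff₀' h1α]
    linarith
  have hr2 : 2 < r := by nlinarith
  obtain ⟨C₀, φ, hφ, hdecay⟩ := hψ.exists_decayBound
  obtain ⟨A, hA, hcont, ⟨K, hK⟩, L, hosc⟩ := hdecay.exists_kernel_bounds hα0 hα1 hr2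
    (by nlinarith) hφ (ne_zero_of_fourier_ae_eq hφ hψ0)
  obtain ⟨C, hCtop, hC⟩ := exists_lintegral_majorant_le hα0 hα1 hs (p := r - 1)
    (by linarith) (by linarith)
  exact ⟨A, hA, hcont, (supIntFst_le_of_majorant hC hK).trans_lt
    (ENNReal.mul_lt_top ENNReal.ofReal_lt_top hCtop),
    fun c hc => tendsto_gammaMax hα0 hα1 hc hCtop.ne hC hosc⟩

theorem exponents_lt_of_threshold_lt {α s r : ℝ} (hα0 : 0 ≤ α) (hα1 : α < 1) (hs : 0 ≤ s)
    (hr : (2 + 2 * s + 7 * α - 4 * α ^ 2) / (2 * (1 - α) ^ 2) + 1 < r) :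
    (1 + s) / (1 - α) + 5 * α / 2 + 1 < r ∧ (s + 2 * α) / (1 - α) + α / 2 + 2 < r := by
  have h1α : 0 < 1 - α := by linarith
  have hsα := mul_nonneg hs hα0
  have hα2 : 0 ≤ α ^ 2 * (1 - α) := by positivity
  constructor <;> refine lt_of_le_of_lt ?_ hr
  · have h : (1 + s) / (1 - α) + 5 * α / 2 =
        (2 * (1 + s) * (1 - α) + 5 * α * (1 - α) ^ 2) / (2 * (1 - α) ^ 2) := by field_simp
    rw [h]
    gcongr
    nlinarith
  · have h : (s + 2 * α) / (1 - α) + α / 2 + 2 =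
        (2 * (s + 2 * α) * (1 - α) + (α + 2) * (1 - α) ^ 2) / (2 * (1 - α) ^ 2) + 1 := by
      field_simp
      ring
    rw [h]
    gcongr
    nlinarith

end

end AlphaMod

open AlphaMod in
theorem theorem5p8_general (α c : ℝ) (hα0 : 0 ≤ α) (hα1 : α < 1) (hc : 0 < c) :
    (∃ Γ : ℝ × ℝ → ℝ × ℝ → ℂ,
      Measurable (Function.uncurry Γ) ∧ (∀ y z, ‖Γ y z‖ = 1) ∧
      ∀ (s r : ℝ) (ψ : L2), 0 ≤ s → ψ ≠ 0 →
        (1 + s) / (1 - α) + 5 * α / 2 + 1 < r → (s + 2 * α) / (1 - α) + α / 2 + 2 < r →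
        HasFourierDecay 3 r ψ →
        ∃ A : L2 ≃L[ℂ] L2, IsFrameOperator α ψ A ∧
          (∀ ε : ℝ, 0 < ε → Measurable (Function.uncurry (oscEps α c ψ A Γ ε))) ∧
          Tendsto (gammaMax α c s ψ A Γ) (𝓝[>] 0) (𝓝 0) ∧
          (1 / 4 < c →
            rho α s ψ A < ∞ ∧
            ∃ ε₀ : ℝ, 0 < ε₀ ∧ ∃ K : ℝ≥0∞, K < ∞ ∧ ∀ ε : ℝ, 0 < ε → ε < ε₀ →
              IsModerateAdmissibleCovering volume (coverU α c ε) ∧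
              weightConst (weightW s) (coverU α c ε) ≤ K ∧
              gammaMax α c s ψ A Γ ε *
                (rho α s ψ A + max (rho α s ψ A * weightConst (weightW s) (coverU α c ε))
                  (rho α s ψ A + gammaMax α c s ψ A Γ ε)) < 1)) ∧
    (∃ ψ : L2, ψ ≠ 0 ∧ (∃ S : Set ℝ, IsCompact S ∧ ∀ᵐ t : ℝ, t ∉ S → ψ t = 0) ∧
      ∀ r : ℝ, HasFourierDecay 3 r ψ) := by
  refine ⟨⟨phase, continuous_phase.measurable, norm_phase, fun s r ψ hs hψ0 hr hr' hψ => ?_⟩,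
    exists_compactSupport_hasFourierDecay 3⟩
  obtain ⟨A, hA, hcont, hρ, hγ⟩ := hψ.exists_frameOperator hα0 hα1 hs hψ0 hr hr'
  refine ⟨A, hA, fun ε _ =>
    (lowerSemicontinuous_osc hcont continuous_phase (isOpen_coverU α c ε)).measurable, hγ c hc,
    fun hc4 => ⟨hρ, ?_⟩⟩
  have hW : ∀ᶠ ε in 𝓝[>] 0, weightConst (weightW s) (coverU α c ε) ≤ ENNReal.ofReal (2 ^ s) :=
    (eventually_mul_le c (b := 1 / 16) (by norm_num)).mono fun ε => weightConst_coverU_le hα1 hs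
  have hsmall := eventually_mul_add_max_lt_one (hγ c hc) hρ.ne ENNReal.ofReal_ne_top hW
  obtain ⟨ε₀, hε₀, hall⟩ := mem_nhdsGT_iff_exists_Ioo_subset.1
    ((eventually_isModerateAdmissibleCovering_coverU hα0 hα1 hc4).and (hW.and hsmall))
  exact ⟨ε₀, hε₀, _, ENNReal.ofReal_lt_top, fun ε hε hlt => hall ⟨hε, hlt⟩⟩

open AlphaMod in
theorem theorem5p8 (α c : ℝ) (hα0 : 0 ≤ α) (hα1 : α < 1) (hc : 0 < c) :
    (∃ Γ : ℝ × ℝ → ℝ × ℝ → ℂ,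
      Measurable (Function.uncurry Γ) ∧ (∀ y z, ‖Γ y z‖ = 1) ∧
      ∀ (s r : ℝ) (ψ : L2), 0 ≤ s → ψ ≠ 0 →
        (2 + 2 * s + 7 * α - 4 * α ^ 2) / (2 * (1 - α) ^ 2) + 1 < r →
        HasFourierDecay 3 r ψ →
        ∃ A : L2 ≃L[ℂ] L2, IsFrameOperator α ψ A ∧
          (∀ ε : ℝ, 0 < ε → Measurable (Function.uncurry (oscEps α c ψ A Γ ε))) ∧
          Tendsto (gammaMax α c s ψ A Γ) (𝓝[>] 0) (𝓝 0) ∧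
          (1 / 4 < c →
            rho α s ψ A < ∞ ∧
            ∃ ε₀ : ℝ, 0 < ε₀ ∧ ∃ K : ℝ≥0∞, K < ∞ ∧ ∀ ε : ℝ, 0 < ε → ε < ε₀ →
              IsModerateAdmissibleCovering volume (coverU α c ε) ∧
              weightConst (weightW s) (coverU α c ε) ≤ K ∧
              gammaMax α c s ψ A Γ ε *
                (rho α s ψ A + max (rho α s ψ A * weightConst (weightW s) (coverU α c ε))
                  (rho α s ψ A + gammaMax α c s ψ A Γ ε)) < 1)) ∧
    (∃ ψ : L2, ψ ≠ 0 ∧ (∃ S : Set ℝ, IsCompact S ∧ ∀ᵐ t : ℝ, t ∉ S → ψ t = 0) ∧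
      ∀ r : ℝ, HasFourierDecay 3 r ψ) := by
  obtain ⟨⟨Γ, hΓ, hΓ1, h⟩, hψ⟩ := theorem5p8_general α c hα0 hα1 hc
  exact ⟨⟨Γ, hΓ, hΓ1, fun s r ψ hs hψ0 hr => (exponents_lt_of_threshold_lt hα0 hα1 hs hr).elim
    (h s r ψ hs hψ0)⟩, hψ⟩
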